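/- Work over $\mathbb{C}$. For $n\ge 0$, $d\ge 0$ let $M^n_d\subset\mathbb{A}^{(n+1)(d+1)}$ be the space of nondegenerate morphisms $f=(F_0:\dots:F_n):\mathbb{P}^1\to\mathbb{P}^n$ of degree $d$, each identified with the coefficients of its parameterizing binary forms $F_i$ of degree $d$ (linearly independent and without common zero). For $p\in\mathbb{P}^1$ with local parameter $t$, and $j$ with $F_j(p)\neq 0$, put $f_i=F_i/F_j\in\mathbb{C}[[t]]$; the value semigroup of $f$ at $p$ is the set of $t$-adic orders of the nonzero elements of the image of $\mathbb{C}[[x_i : i\neq j]]\to\mathbb{C}[[t]]$, $x_i\mapsto f_i-f_i(p)$. The vanishing orders of $f$ at $p$ are the $t$-adic orders of the nonzero linear combinations of the $F_i$ at $p$; they form a sequence $k_0<k_1<\dots<k_n$. Let $g\ge 1$, and let $\mathcal{V}\subset M^n_d$ be the locus of morphisms $f$ which are normalizations of curves with a unique singularity, that singularity being a hyperelliptic cusp of genus $g$; that is, $f$ is injective, its value semigroup at some point $p$ is $\langle 2,2g+1\rangle$ (which has $g$ gaps), and its value semigroup at every other point is $\mathbb{N}$. For $\mathbf{k}=(k_0<\dots<k_n)$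 let $\mathcal{V}_{\mathbf{k}}\subset\mathcal{V}$ be the locus of those $f$ whose sequence of vanishing orders at the preimage $p$ of the cusp is $\mathbf{k}$. Here $\operatorname{cod}(Z,M^n_d)=\dim M^n_d-\dim Z$, with $\dim$ the dimension of the Zariski closure, and $Z$ is unirational if there is a dominant rational map from an affine space to $Z$. Suppose that $1\le g\le 7$, $n\le 2g$ and $d\ge\max(n,2g-2)$. (1) If $\mathcal{V}\neq\emptyset$, then $\operatorname{cod}(\mathcal{V},M^n_d)=(n-1)g$. (2) For every $\mathbf{k}$ with $\mathcal{V}_{\mathbf{k}}\neq\emptyset$, the stratum $\mathcal{V}_{\mathbf{k}}$ is unirational, and $$\operatorname{cod}(\mathcal{V}_{\mathbf{k}},M^n_d)=(n-1)g+\sum_{i=2}^n e_i,\qquad e_i=\begin{cases}\frac{k_i}{2}-i & \text{if } k_i\le 2g,\\ k_i-g-i & \text{if } k_i>2g.\end{cases}$$ In particular, if $k_n\le 2g$, then $\operatorname{cod}(\mathcal{V}_{\mathbf{k}},M^n_d)=(n-1)g+\sum_{i=2}^n\left(\frac{k_i}{2}-i\right)$. -/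

import Mathlib

noncomputable section

namespace UnicuspidalCurves

/-! ### Zariski dimension and unirationality of subsets of affine space -/

/-- The Zariski dimension of a subset `Z` of affine space: the Krull dimension of the coordinate
ring of its Zariski closure. -/
def zariskiDim {σ : Type} (Z : Set (σ → ℂ)) : WithBot ℕ∞ :=
  ringKrullDim (MvPolynomial σ ℂ ⧸ MvPolynomial.vanishingIdeal (k := ℂ) Z)

/-- `cod(V, M) = c`, that is, `dim M - dim V = c` (both dimensions being natural numbers; in
particular `V` is not empty). -/
def HasCodim {σ : Type} (V M : Set (σ → ℂ)) (c : ℚ) : Prop :=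
  ∃ v m : ℕ, zariskiDim V = v ∧ zariskiDim M = m ∧ (m : ℚ) - v = c

/-- `Z` is unirational: there is a dominant rational map `(p i / q)_i` from an affine space to `Z`.
It is defined on `q ≠ 0`, takes values in `Z` there, and every polynomial that vanishes on the image
vanishes on `Z`. -/
def IsUnirational {σ : Type} (Z : Set (σ → ℂ)) : Prop :=
  ∃ (m : ℕ) (p : σ → MvPolynomial (Fin m) ℂ) (q : MvPolynomial (Fin m) ℂ), q ≠ 0 ∧
    (∀ x : Fin m → ℂ, MvPolynomial.eval x q ≠ 0 →
      (fun i => MvPolynomial.eval x (p i) / MvPolynomial.eval x q) ∈ Z) ∧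
    ∀ h : MvPolynomial σ ℂ,
      (∀ x : Fin m → ℂ, MvPolynomial.eval x q ≠ 0 →
        MvPolynomial.eval (fun i => MvPolynomial.eval x (p i) / MvPolynomial.eval x q) h = 0) →
      ∀ z ∈ Z, MvPolynomial.eval z h = 0

/-! ### Morphisms from the projective line to projective space -/

/-- Coefficient arrays of `(n + 1)`-tuples of binary forms of degree `d`. -/
abbrev CoeffSpace (n d : ℕ) : Type := Fin (n + 1) × Fin (d + 1) → ℂ

variable {n d : ℕ}

/-- The `i`-th parameterizing form `∑ j, a (i, j) X₀ ^ j X₁ ^ (d - j)`. -/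
def form (a : CoeffSpace n d) (i : Fin (n + 1)) : MvPolynomial (Fin 2) ℂ :=
  ∑ j : Fin (d + 1), MvPolynomial.C (a (i, j)) *
    (MvPolynomial.X 0 ^ (j : ℕ) * MvPolynomial.X 1 ^ (d - (j : ℕ)))

/-- The projective line is `OnePoint ℂ = ℂ ∪ {∞}`, the point `s` being `(s : 1)` and `∞` being
`(1 : 0)`. These are homogeneous coordinates along the local parameter `t` centered at the point:
`(s + t : 1)` and `(1 : t)`. -/
def localCoords (p : OnePoint ℂ) : Fin 2 → PowerSeries ℂ :=
  p.elim ![1, PowerSeries.X] (fun s => ![PowerSeries.C s + PowerSeries.X, 1])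

/-- The expansion of the `i`-th parameterizing form in the local parameter `t` at `p`. -/
def germ (a : CoeffSpace n d) (p : OnePoint ℂ) (i : Fin (n + 1)) : PowerSeries ℂ :=
  MvPolynomial.aeval (localCoords p) (form a i)

/-- Homogeneous coordinates of the image of `p`. -/
def valueAt (a : CoeffSpace n d) (p : OnePoint ℂ) : Fin (n + 1) → ℂ :=
  fun i => PowerSeries.constantCoeff (germ a p i)

/-- The space `M^n_d` of nondegenerate morphisms of degree `d` from the projective line to
projective `n`-space, each given by the coefficients of its parameterizing forms: the forms are
linearly independent and have no common zero. -/
def morphismSpace (n d : ℕ) : Set (CoeffSpace n d) :=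
  {a | LinearIndependent ℂ (fun (i : Fin (n + 1)) (j : Fin (d + 1)) => a (i, j)) ∧
    ∀ p : OnePoint ℂ, valueAt a p ≠ 0}

/-- The morphism to projective space defined by a point of `M^n_d`. -/
def toProj (a : CoeffSpace n d) (ha : a ∈ morphismSpace n d) (p : OnePoint ℂ) :
    Projectivization ℂ (Fin (n + 1) → ℂ) :=
  Projectivization.mk ℂ (valueAt a p) (ha.2 p)

/-! ### Value semigroups, vanishing orders, unicuspidal curves -/

/-- The affine coordinates `f_i - f_i(p)`, `f_i = F_i / F_j`, centered at the image of `p` in the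
chart in which the `j`-th coordinate is not zero, as power series in the local parameter at `p`. (The
`j`-th of them is zero.) -/
def localFunction (a : CoeffSpace n d) (p : OnePoint ℂ) (j i : Fin (n + 1)) : PowerSeries ℂ :=
  germ a p i * (germ a p j)⁻¹ -
    PowerSeries.C (PowerSeries.constantCoeff (germ a p i * (germ a p j)⁻¹))

/-- The ring map `ℂ[[x]] → ℂ[[t]]`, `x_i ↦ f_i - f_i(p)`, in the chart `j`. -/
def localMap (a : CoeffSpace n d) (p : OnePoint ℂ) (j : Fin (n + 1))
    (h : MvPowerSeries (Fin (n + 1)) ℂ) : PowerSeries ℂ :=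
  MvPowerSeries.subst (τ := Unit) (localFunction a p j) h

/-- The `t`-adic valuations of the nonzero elements of the image of `ℂ[[x]] → ℂ[[t]]`. The image does
not depend on the chart `j` around the image of `p`. -/
def valueSemigroup (a : CoeffSpace n d) (p : OnePoint ℂ) : Set ℕ :=
  {m | ∃ j : Fin (n + 1), valueAt a p j ≠ 0 ∧
    ∃ h : MvPowerSeries (Fin (n + 1)) ℂ, (localMap a p j h).order = (m : ℕ∞)}

/-- The vanishing orders at `p` of the nonzero linear combinations of the parameterizing sections. -/
def vanishingOrders (a : CoeffSpace n d) (p : OnePoint ℂ) : Set ℕ :=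
  {m | ∃ c : Fin (n + 1) → ℂ, (∑ i, c i • germ a p i).order = (m : ℕ∞)}

/-- The morphism `a` is the normalization of a curve of genus `g` whose only singularity is a cusp
with value semigroup `S` and preimage `p`: the morphism is injective (every point of the image is
unibranch), the value semigroup at `p` is `S`, which has `g` gaps, and the image is smooth elsewhere
(the value semigroup is `ℕ`). -/
def IsUnicuspidalAt (g : ℕ) (S : AddSubmonoid ℕ) (a : CoeffSpace n d) (p : OnePoint ℂ) : Prop :=
  (∃ ha : a ∈ morphismSpace n d, Function.Injective (toProj a ha)) ∧
    valueSemigroup a p = (S : Set ℕ) ∧ ((S : Set ℕ)ᶜ).encard = (g : ℕ∞) ∧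
    ∀ q : OnePoint ℂ, q ≠ p → valueSemigroup a q = Set.univ

/-- `M^n_{d,g;S}`: unicuspidal rational curves of genus `g` with value semigroup `S`. -/
def unicuspidalLocus (n d g : ℕ) (S : AddSubmonoid ℕ) : Set (CoeffSpace n d) :=
  {a | ∃ p : OnePoint ℂ, IsUnicuspidalAt g S a p}

/-- `M^n_{d,g;S,k}`: those curves whose strictly increasing sequence of vanishing orders in the
preimage of the cusp is `k = (k_0, …, k_n)`. -/
def ramificationStratum (n d g : ℕ) (S : AddSubmonoid ℕ) (k : Fin (n + 1) → ℕ) :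
    Set (CoeffSpace n d) :=
  {a | ∃ p : OnePoint ℂ, IsUnicuspidalAt g S a p ∧ StrictMono k ∧
    Set.range k = vanishingOrders a p}

/-- The value semigroup `⟨2, 2g + 1⟩` of a hyperelliptic cusp of genus `g`. -/
def hyperellipticSemigroup (g : ℕ) : AddSubmonoid ℕ :=
  AddSubmonoid.closure {2, 2 * g + 1}

end UnicuspidalCurves

end

noncomputable section
namespace UnicuspidalCurves

/-! ### Krull dimension and transcendence degree -/

/-! A curve is studied through the span of its parameterizing forms and the powers of this span, the
spaces `monomialSpan a N` of forms of degree `N * d`. The value semigroup at `p` is the set of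
orders at `p` of such forms (`mem_valueSemigroup`). The semigroup ⟨2, 2g+1⟩ consists of the even
numbers and of all numbers from 2g on. For linearly independent forms, being unicuspidal at `p`
means two things: all orders at `p` lie in the semigroup, and in some large degree `N` every element
of the semigroup up to `N * d` is an order (`isUnicuspidalAt_of_isHyperellipticAt`,
`isHyperellipticAt_of_isUnicuspidalAt`). Given the first condition, the second is a lower bound on
the dimension of `monomialSpan a N`, hence open (`exists_certificate`).

The first condition is solved explicitly. Let f be the expansion at the cusp of a linear form that
does not vanish there, and let u be the normalized quotient by it of a linear form of order 2.
Cancelling leading terms against powers of u shows that every linear form is, modulo t^(2g), f times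
a polynomial in u of degree less than g (`IsHyperellipticAt.exists_sliceRow`); conversely such forms
only produce orders in the semigroup (`mem_semigroup_of_slice`). So the linear forms live in a space
with an adapted basis, of orders 0, 2, ..., 2g-2, 2g, 2g+1, ..., d. A curve amounts to the position
of the cusp, to f and u, and to a tuple of coordinate vectors in that basis. If d = 2g-2, the
coefficients of t^(2g-1) must vanish in addition; these linear conditions on f are solved by
Cramer's rule (`corrected`).

Prescribing the vanishing orders prescribes the pivots of the reduced echelon form of the coordinate
vectors. Hence an open part of an affine space of parameters dominates a nonempty stratum, which is
therefore unirational. The parametrization is generically finite: the cusp is a simple zero of the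
Wronskian of the first two forms, so it is algebraic over the coefficients, and all other parameters
are then rational (`mem_of_wronskian`, `SliceData.IsNormal.parameters_mem`). The dimension is thus
the number of parameters. If all columns without pivot are left free, the count is (n+1)(d+1) -
(n-1)g; echelon form in row i removes the columns without pivot to the left of the pivot, whose
number is e_i. The family with free columns bounds the dimension of the whole locus from below, and
the finitely many strata bound it from above. -/

theorem ringKrullDim_eq_of_isIntegral (R S : Type*) [CommRing R] [CommRing S] [Algebra R S]
    [Algebra.IsIntegral R S] [FaithfulSMul R S] : ringKrullDim S = ringKrullDim R := by
  apply le_antisymm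
  · exact Order.krullDim_le_of_strictMono (PrimeSpectrum.comap (algebraMap R S))
      fun I J h => Ideal.IsIntegral.comap_lt_comap (R := R) h
  · refine iSup_le fun l => ?_
    obtain ⟨P⟩ := (inferInstance : Nonempty (Ideal.primesOver (RelSeries.head l).asIdeal S))
    have := P.2.1
    have := P.2.2
    obtain ⟨L, hL, -, -⟩ := Ideal.exists_ltSeries_of_hasGoingUp l P.1
    rw [← hL]
    exact Order.LTSeries.length_le_krullDim L

/-- By Noether normalization the algebra is integral over a polynomial ring, for which dimension and
transcendence degree are both the number of variables; integral extensions change neither. -/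
theorem ringKrullDim_eq_of_trdeg_eq (k A : Type) [Field k] [CommRing A] [IsDomain A] [Algebra k A]
    [Algebra.FiniteType k A] {m : ℕ} (h : Algebra.trdeg k A = m) : ringKrullDim A = m := by
  obtain ⟨s, φ, hinj, hint⟩ := exists_integral_inj_algHom_of_fg k A
  algebraize [φ.toRingHom]
  have : Algebra.IsIntegral (MvPolynomial (Fin s) k) A := ⟨hint⟩
  have : FaithfulSMul (MvPolynomial (Fin s) k) A :=
    (faithfulSMul_iff_algebraMap_injective _ _).2 hinj
  have hs : Algebra.trdeg k (MvPolynomial (Fin s) k) + Algebra.trdeg (MvPolynomial (Fin s) k) A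
      = Algebra.trdeg k A := trdeg_add_eq _ _
  rw [trdeg_eq_zero (R := MvPolynomial (Fin s) k) (A := A), h, MvPolynomial.trdeg_of_isDomain] at hs
  simp only [Cardinal.mk_fin, Cardinal.lift_natCast, add_zero, Nat.cast_inj] at hs
  rw [ringKrullDim_eq_of_isIntegral (MvPolynomial (Fin s) k) A,
    MvPolynomial.ringKrullDim_of_isNoetherianRing]
  simp [hs]

open scoped IntermediateField.algebraAdjoinAdjoin in
/-- A set whose vanishing ideal is the kernel of a parametrization has dimension the number of
parameters, if every parameter lies in every algebraically closed subfield of the field of rational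
functions that contains the coordinates of the parametrization. -/
theorem zariskiDim_eq_card {σ τ : Type} [Finite σ] [Fintype τ] (Z : Set (σ → ℂ))
    (L : Type) [Field L] [Algebra (MvPolynomial τ ℂ) L] [IsFractionRing (MvPolynomial τ ℂ) L]
    (Ψ : σ → MvPolynomial τ ℂ)
    (hZ : ∀ h : MvPolynomial σ ℂ, (∀ z ∈ Z, MvPolynomial.eval z h = 0) ↔
      MvPolynomial.aeval Ψ h = 0)
    (hK : ∀ K : Subfield L, (∀ x : L, IsAlgebraic K x → x ∈ K) →
      (∀ c : ℂ, algebraMap (MvPolynomial τ ℂ) L (MvPolynomial.C c) ∈ K) →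
      (∀ i, algebraMap (MvPolynomial τ ℂ) L (Ψ i) ∈ K) →
      ∀ j, algebraMap (MvPolynomial τ ℂ) L (MvPolynomial.X j) ∈ K) :
    zariskiDim Z = Fintype.card τ := by
  let : Algebra ℂ L := ((algebraMap (MvPolynomial τ ℂ) L).comp MvPolynomial.C).toAlgebra
  have : IsScalarTower ℂ (MvPolynomial τ ℂ) L := IsScalarTower.of_algebraMap_eq' rfl
  set φ : σ → L := fun i => algebraMap (MvPolynomial τ ℂ) L (Ψ i) with hφ
  have hinj := IsFractionRing.injective (MvPolynomial τ ℂ) L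
  have : FaithfulSMul (MvPolynomial τ ℂ) L := (faithfulSMul_iff_algebraMap_injective _ _).2 hinj
  let K0 := IntermediateField.adjoin ℂ (Set.range φ)
  let A0 := Algebra.adjoin ℂ (Set.range φ)
  -- The hypothesis is applied to the relative algebraic closure of the field generated by the
  -- coordinates. It turns out to be all of `L`, so `A0`, the coordinate ring of the closure of `Z`,
  -- has the same transcendence degree as the polynomial ring of parameters.
  let K1 : IntermediateField K0 L := algebraicClosure K0 L
  have hX : ∀ j, algebraMap (MvPolynomial τ ℂ) L (MvPolynomial.X j) ∈ K1.toSubfield := by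
    refine hK K1.toSubfield (fun x hx => ?_) (fun c => ?_) fun i => ?_
    · have hx' : IsAlgebraic K1 x := hx
      exact mem_algebraicClosure_iff.2 (IsAlgebraic.restrictScalars K0 hx')
    · exact K1.algebraMap_mem (algebraMap ℂ K0 c)
    · exact K1.algebraMap_mem ⟨φ i, IntermediateField.subset_adjoin _ _ ⟨i, rfl⟩⟩
  have hpoly : ∀ f : MvPolynomial τ ℂ, algebraMap (MvPolynomial τ ℂ) L f ∈ K1.toSubfield := by
    intro f
    induction f using MvPolynomial.induction_on with
    | C c => exact K1.algebraMap_mem (algebraMap ℂ K0 c)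
    | add p q hp hq => rw [map_add]; exact add_mem hp hq
    | mul_X p j hp => rw [map_mul]; exact mul_mem hp (hX j)
  have hall : ∀ x : L, x ∈ K1.toSubfield := by
    intro x
    obtain ⟨a, b, -, rfl⟩ := IsFractionRing.div_surjective (A := MvPolynomial τ ℂ) x
    exact div_mem (hpoly a) (hpoly b)
  have : Algebra.IsAlgebraic K0 L := ⟨fun x => mem_algebraicClosure_iff.1 (hall x)⟩
  have : Algebra.IsAlgebraic A0 L := (IsFractionRing.comap_isAlgebraic_iff (K := K0)).2 this
  have : FaithfulSMul ℂ A0 := (faithfulSMul_iff_algebraMap_injective _ _).2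
    (algebraMap ℂ A0).injective
  have h1 : Algebra.trdeg ℂ A0 + Algebra.trdeg A0 L = Algebra.trdeg ℂ L :=
    trdeg_add_eq _ _
  have h2 : Algebra.trdeg ℂ (MvPolynomial τ ℂ) + Algebra.trdeg (MvPolynomial τ ℂ) L =
      Algebra.trdeg ℂ L := trdeg_add_eq _ _
  have : Algebra.IsAlgebraic (MvPolynomial τ ℂ) L := IsLocalization.isAlgebraic _ (nonZeroDivisors (MvPolynomial τ ℂ))
  rw [trdeg_eq_zero (R := A0), add_zero] at h1
  rw [trdeg_eq_zero (R := MvPolynomial τ ℂ) (A := L), add_zero] at h2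
  have h3 : Algebra.trdeg ℂ A0 = (Fintype.card τ : ℕ) := by
    rw [h1, ← h2, MvPolynomial.trdeg_of_isDomain]; simp
  have : Algebra.FiniteType ℂ A0 :=
    (Subalgebra.fg_iff_finiteType _).1 ⟨(Set.finite_range φ).toFinset, by simp [A0]⟩
  have h4 := ringKrullDim_eq_of_trdeg_eq ℂ A0 h3
  have hker : MvPolynomial.vanishingIdeal (k := ℂ) Z =
      RingHom.ker (MvPolynomial.aeval φ : MvPolynomial σ ℂ →ₐ[ℂ] L) := by
    ext h
    have e : (MvPolynomial.aeval φ : MvPolynomial σ ℂ →ₐ[ℂ] L) h =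
        algebraMap (MvPolynomial τ ℂ) L (MvPolynomial.aeval Ψ h) := by
      exact MvPolynomial.aeval_algebraMap_apply (B := L) Ψ h
    rw [MvPolynomial.mem_vanishingIdeal_iff, RingHom.mem_ker, e,
      map_eq_zero_iff _ hinj, ← hZ]
    simp [MvPolynomial.aeval_eq_eval]
  rw [zariskiDim, hker, ← h4]
  refine ringKrullDim_eq_of_ringEquiv ((RingHom.quotientKerEquivRange _).trans ?_)
  have : (MvPolynomial.aeval φ : MvPolynomial σ ℂ →ₐ[ℂ] L).range = A0 :=
    (Algebra.adjoin_range_eq_range_aeval ℂ φ).symm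
  exact (Subalgebra.equivOfEq _ _ this).toRingEquiv

end UnicuspidalCurves
end

noncomputable section
namespace UnicuspidalCurves
open Polynomial

/-! ### Binary forms as polynomials of bounded degree -/

/-- Binary forms of degree `e`, dehomogenized. -/
def formSpace (e : ℕ) : Submodule ℂ ℂ[X] := degreeLT ℂ (e + 1)

theorem mem_formSpace {e : ℕ} {F : ℂ[X]} : F ∈ formSpace e ↔ F.natDegree ≤ e := by
  rw [formSpace, mem_degreeLT, natDegree_le_iff_degree_le]
  exact_mod_cast Order.lt_succ_iff (a := F.degree) (b := (e : WithBot ℕ))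

instance (e : ℕ) : FiniteDimensional ℂ (formSpace e) :=
  Module.Finite.equiv (degreeLTEquiv ℂ (e + 1)).symm

theorem finrank_formSpace (e : ℕ) : Module.finrank ℂ (formSpace e) = e + 1 := by
  rw [formSpace, (degreeLTEquiv ℂ (e + 1)).finrank_eq]; simp

theorem mul_mem_formSpace {e e' : ℕ} {F G : ℂ[X]} (hF : F ∈ formSpace e) (hG : G ∈ formSpace e') :
    F * G ∈ formSpace (e + e') := by
  rw [mem_formSpace] at *
  exact natDegree_mul_le.trans (by omega)

theorem pow_mem_formSpace {e : ℕ} {F : ℂ[X]} (hF : F ∈ formSpace e) (m : ℕ) :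
    F ^ m ∈ formSpace (m * e) := by
  rw [mem_formSpace] at *
  exact natDegree_pow_le.trans (Nat.mul_le_mul_left _ hF)

theorem formSpace_eq_sum {e : ℕ} {F : ℂ[X]} (hF : F ∈ formSpace e) :
    F = ∑ j ∈ Finset.range (e + 1), F.coeff j • (X : ℂ[X]) ^ j := by
  conv_lhs => rw [F.as_sum_range' (e + 1) (by rw [mem_formSpace] at hF; omega)]
  exact Finset.sum_congr rfl fun j _ => by rw [← C_mul_X_pow_eq_monomial, smul_eq_C_mul]

/-- The value of a binary form of degree `e` at a pair of elements of an algebra. -/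
def homEval {A : Type*} [CommRing A] [Algebra ℂ A] (e : ℕ) (a b : A) : ℂ[X] →ₗ[ℂ] A where
  toFun F := ∑ j ∈ Finset.range (e + 1), F.coeff j • (a ^ j * b ^ (e - j))
  map_add' F G := by simp [add_smul, Finset.sum_add_distrib]
  map_smul' c F := by simp [Finset.smul_sum, smul_smul]

section homEval

variable {A : Type*} [CommRing A] [Algebra ℂ A] (a b : A)

theorem homEval_apply (e : ℕ) (F : ℂ[X]) : homEval e a b F =
    ∑ j ∈ Finset.range (e + 1), F.coeff j • (a ^ j * b ^ (e - j)) := rfl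

theorem homEval_X_pow {e j : ℕ} (hj : j ≤ e) : homEval e a b (X ^ j) = a ^ j * b ^ (e - j) := by
  rw [homEval_apply, Finset.sum_eq_single j]
  · simp
  · intro b _ hb; simp [coeff_X_pow, hb]
  · intro h; exact absurd (Finset.mem_range.2 (by omega)) h

/-- The degree bounds matter: `homEval e` ignores the coefficients beyond `e`. -/
theorem homEval_mul {e e' : ℕ} {F G : ℂ[X]} (hF : F ∈ formSpace e) (hG : G ∈ formSpace e') :
    homEval (e + e') a b (F * G) = homEval e a b F * homEval e' a b G := by
  conv_lhs => rw [formSpace_eq_sum hF, formSpace_eq_sum hG, Finset.sum_mul_sum]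
  rw [homEval_apply _ _ e, homEval_apply _ _ e', Finset.sum_mul_sum, map_sum]
  refine Finset.sum_congr rfl fun i hi => ?_
  rw [map_sum]
  refine Finset.sum_congr rfl fun j hj => ?_
  simp only [Finset.mem_range] at hi hj
  rw [smul_mul_smul_comm, ← pow_add, map_smul, homEval_X_pow _ _ (by omega), smul_mul_smul_comm]
  congr 1
  rw [show e + e' - (i + j) = (e - i) + (e' - j) by omega, pow_add, pow_add]
  ring

end homEval

/-- The expansion of a binary form of degree `e` in the local parameter at a point of the projective
line. -/
def expansion (e : ℕ) (p : OnePoint ℂ) : ℂ[X] →ₗ[ℂ] PowerSeries ℂ :=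
  homEval e (localCoords p 0) (localCoords p 1)

theorem expansion_apply (e : ℕ) (p : OnePoint ℂ) (F : ℂ[X]) : expansion e p F =
    ∑ j ∈ Finset.range (e + 1), F.coeff j • (localCoords p 0 ^ j * localCoords p 1 ^ (e - j)) := rfl

theorem expansion_X_pow {e j : ℕ} (hj : j ≤ e) (p : OnePoint ℂ) :
    expansion e p (X ^ j) = localCoords p 0 ^ j * localCoords p 1 ^ (e - j) :=
  homEval_X_pow _ _ hj

theorem expansion_mul {e e' : ℕ} {F G : ℂ[X]} (hF : F ∈ formSpace e) (hG : G ∈ formSpace e')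
    (p : OnePoint ℂ) : expansion (e + e') p (F * G) = expansion e p F * expansion e' p G :=
  homEval_mul _ _ hF hG

theorem expansion_pow {e : ℕ} {F : ℂ[X]} (hF : F ∈ formSpace e) (p : OnePoint ℂ) (m : ℕ) :
    expansion (m * e) p (F ^ m) = expansion e p F ^ m := by
  induction m with
  | zero => simpa using expansion_X_pow (le_refl 0) p
  | succ m ih =>
    rw [pow_succ, pow_succ, ← ih, add_mul, one_mul, expansion_mul (pow_mem_formSpace hF m) hF]

theorem localCoords_coe (s : ℂ) :
    localCoords (s : OnePoint ℂ) = ![PowerSeries.C s + PowerSeries.X, 1] := rfl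

theorem localCoords_infty : localCoords OnePoint.infty = ![1, PowerSeries.X] := rfl

theorem constantCoeff_expansion_coe {e : ℕ} {F : ℂ[X]} (hF : F ∈ formSpace e) (s : ℂ) :
    PowerSeries.constantCoeff (expansion e (s : OnePoint ℂ) F) = F.eval s := by
  rw [expansion_apply, localCoords_coe]
  conv_rhs => rw [formSpace_eq_sum hF]
  simp [eval_finsetSum, map_sum, PowerSeries.smul_eq_C_mul]

theorem constantCoeff_expansion_infty {e : ℕ} (F : ℂ[X]) :
    PowerSeries.constantCoeff (expansion e OnePoint.infty F) = F.coeff e := by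
  rw [expansion_apply, localCoords_infty, map_sum, Finset.sum_eq_single e]
  · simp [PowerSeries.smul_eq_C_mul]
  · intro j hj hje
    have : e - j ≠ 0 := by simp only [Finset.mem_range] at hj; omega
    simp [PowerSeries.smul_eq_C_mul, this]
  · simp

/-- A linear form vanishing exactly at `p`. -/
def pointForm (p : OnePoint ℂ) : ℂ[X] := p.elim 1 (fun s => X - C s)

theorem pointForm_mem (p : OnePoint ℂ) : pointForm p ∈ formSpace 1 := by
  rw [mem_formSpace]
  induction p using OnePoint.rec with
  | infty => simp [pointForm]
  | coe s => exact (natDegree_X_sub_C s).le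

theorem expansion_pointForm_self (p : OnePoint ℂ) :
    expansion 1 p (pointForm p) = PowerSeries.X := by
  induction p using OnePoint.rec with
  | infty => simp [pointForm, expansion_apply, localCoords_infty, coeff_one]
  | coe s =>
    simp [pointForm, expansion_apply, localCoords_coe, Finset.sum_range_succ,
      PowerSeries.smul_eq_C_mul, coeff_X, coeff_C]

theorem constantCoeff_expansion_pointForm {p q : OnePoint ℂ} (h : p ≠ q) :
    PowerSeries.constantCoeff (expansion 1 q (pointForm p)) ≠ 0 := by
  induction q using OnePoint.rec with
  | infty =>
    rw [constantCoeff_expansion_infty]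
    induction p using OnePoint.rec with
    | infty => exact absurd rfl h
    | coe s => simp [pointForm, coeff_X]
  | coe t =>
    rw [constantCoeff_expansion_coe (pointForm_mem p)]
    induction p using OnePoint.rec with
    | infty => simp [pointForm]
    | coe s =>
      simp only [pointForm, OnePoint.elim_some, eval_sub, eval_X, eval_C]
      exact sub_ne_zero.2 fun e => h (by rw [e])

/-- The vanishing order at `p` of a binary form of degree `e`. -/
def ordAt (e : ℕ) (p : OnePoint ℂ) (F : ℂ[X]) : ℕ∞ := (expansion e p F).order

theorem ordAt_mul {e e' : ℕ} {F G : ℂ[X]} (hF : F ∈ formSpace e) (hG : G ∈ formSpace e')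
    (p : OnePoint ℂ) : ordAt (e + e') p (F * G) = ordAt e p F + ordAt e' p G := by
  rw [ordAt, expansion_mul hF hG, PowerSeries.order_mul]; rfl

theorem ordAt_pow {e : ℕ} {F : ℂ[X]} (hF : F ∈ formSpace e) (p : OnePoint ℂ) (m : ℕ) :
    ordAt (m * e) p (F ^ m) = m • ordAt e p F := by
  rw [ordAt, expansion_pow hF, PowerSeries.order_pow]; rfl

theorem ordAt_eq_zero_iff {e : ℕ} {p : OnePoint ℂ} {F : ℂ[X]} :
    ordAt e p F = 0 ↔ PowerSeries.constantCoeff (expansion e p F) ≠ 0 := by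
  rw [ordAt, ← not_iff_not, not_not, ← PowerSeries.order_ne_zero_iff_constCoeff_eq_zero]

theorem ordAt_pointForm_self (p : OnePoint ℂ) : ordAt 1 p (pointForm p) = 1 := by
  rw [ordAt, expansion_pointForm_self, PowerSeries.order_X]

theorem ordAt_pointForm {p q : OnePoint ℂ} (h : p ≠ q) : ordAt 1 q (pointForm p) = 0 :=
  ordAt_eq_zero_iff.2 (constantCoeff_expansion_pointForm h)

/-- At infinity the point form is the constant 1 regarded as a form of degree one, so dividing by it
only lowers the degree bound. -/
theorem exists_eq_pointForm_mul {e : ℕ} {p : OnePoint ℂ} {F : ℂ[X]} (hF : F ∈ formSpace (e + 1))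
    (h : ordAt (e + 1) p F ≠ 0) : ∃ G ∈ formSpace e, F = pointForm p * G := by
  rw [Ne, ordAt_eq_zero_iff, not_not] at h
  induction p using OnePoint.rec with
  | infty =>
    rw [constantCoeff_expansion_infty] at h
    refine ⟨F, ?_, by simp [pointForm]⟩
    rw [mem_formSpace, natDegree_le_iff_coeff_eq_zero] at *
    intro N hN
    rcases Nat.eq_or_lt_of_le hN with rfl | h'
    · exact h
    · exact hF N h'
  | coe s =>
    rw [constantCoeff_expansion_coe hF] at h
    obtain ⟨G, rfl⟩ := dvd_iff_isRoot.2 h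
    refine ⟨G, ?_, rfl⟩
    rcases eq_or_ne G 0 with rfl | hG
    · exact zero_mem _
    rw [mem_formSpace] at *
    rw [natDegree_mul (X_sub_C_ne_zero s) hG, natDegree_X_sub_C] at hF
    omega

theorem pointForm_ne_zero (p : OnePoint ℂ) : pointForm p ≠ 0 := by
  intro h
  have := ordAt_pointForm_self p
  rw [h, ordAt, map_zero, PowerSeries.order_zero] at this
  exact absurd this (by simp)

theorem ordAt_le {e : ℕ} {p : OnePoint ℂ} {F : ℂ[X]} (hF : F ∈ formSpace e) (h0 : F ≠ 0) :
    ordAt e p F ≤ e := by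
  induction e generalizing F with
  | zero =>
    rw [mem_formSpace, Nat.le_zero] at hF
    obtain ⟨c, rfl⟩ : ∃ c, F = C c := ⟨_, eq_C_of_natDegree_eq_zero hF⟩
    have hc : c ≠ 0 := fun h => h0 (by rw [h, C_0])
    rw [(ordAt_eq_zero_iff).2]
    · simp
    · simp [expansion_apply, PowerSeries.smul_eq_C_mul, hc]
  | succ e ih =>
    by_cases h : ordAt (e + 1) p F = 0
    · rw [h]; exact zero_le
    obtain ⟨G, hG, rfl⟩ := exists_eq_pointForm_mul hF h
    rw [add_comm e 1, ordAt_mul (pointForm_mem p) hG, ordAt_pointForm_self]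
    have := ih hG (right_ne_zero_of_mul h0)
    push_cast
    gcongr

theorem exists_ordAt_eq {e : ℕ} {p : OnePoint ℂ} {F : ℂ[X]} (hF : F ∈ formSpace e) (h0 : F ≠ 0) :
    ∃ m : ℕ, m ≤ e ∧ ordAt e p F = m := by
  have h := ordAt_le (p := p) hF h0
  obtain ⟨m, hm⟩ := ENat.ne_top_iff_exists.1 (ne_top_of_le_ne_top (ENat.natCast_ne_top e) h)
  exact ⟨m, by rw [← hm] at h; exact_mod_cast h, hm.symm⟩

theorem ordAt_eq_top_iff {e : ℕ} {p : OnePoint ℂ} {F : ℂ[X]} (hF : F ∈ formSpace e) :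
    ordAt e p F = ⊤ ↔ F = 0 := by
  constructor
  · intro h
    by_contra h0
    obtain ⟨m, -, hm⟩ := exists_ordAt_eq (p := p) hF h0
    rw [hm] at h; exact ENat.natCast_ne_top m h
  · rintro rfl; rw [ordAt, map_zero, PowerSeries.order_zero]

theorem exists_ordAt_ne_zero {e : ℕ} {F : ℂ[X]} (hF : F ∈ formSpace (e + 1)) :
    ∃ p, ordAt (e + 1) p F ≠ 0 := by
  simp only [Ne, ordAt_eq_zero_iff, not_not]
  by_cases h : F.coeff (e + 1) = 0
  · exact ⟨OnePoint.infty, by rw [constantCoeff_expansion_infty, h]⟩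
  · obtain ⟨s, hs⟩ := IsAlgClosed.exists_root F (by
      intro h0
      have := le_degree_of_ne_zero h
      rw [h0] at this
      exact absurd (show e + 1 ≤ 0 by exact_mod_cast this) (by omega))
    exact ⟨s, by rw [constantCoeff_expansion_coe hF]; exact hs⟩

/-- Divisibility of binary forms can be tested on vanishing orders. -/
theorem exists_eq_mul_of_ordAt_le {e e' : ℕ} {D F : ℂ[X]} (hD : D ∈ formSpace e) (hD0 : D ≠ 0)
    (hF : F ∈ formSpace (e + e')) (h : ∀ p, ordAt e p D ≤ ordAt (e + e') p F) :
    ∃ G ∈ formSpace e', F = D * G := by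
  induction e generalizing D F with
  | zero =>
    rw [mem_formSpace, Nat.le_zero] at hD
    obtain ⟨c, rfl⟩ : ∃ c, D = C c := ⟨_, eq_C_of_natDegree_eq_zero hD⟩
    have hc : c ≠ 0 := fun h => hD0 (by rw [h, C_0])
    refine ⟨c⁻¹ • F, Submodule.smul_mem _ _ (by simpa using hF), ?_⟩
    rw [smul_eq_C_mul, ← mul_assoc, ← C_mul, mul_inv_cancel₀ hc, C_1, one_mul]
  | succ e ih =>
    obtain ⟨p, hp⟩ := exists_ordAt_ne_zero hD
    obtain ⟨D', hD', rfl⟩ := exists_eq_pointForm_mul hD hp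
    rw [show e + 1 + e' = e + e' + 1 by omega] at hF h
    obtain ⟨F', hF', rfl⟩ := exists_eq_pointForm_mul hF
      (fun h0 => hp (le_antisymm (h0 ▸ h p) (zero_le)))
    obtain ⟨G, hG, rfl⟩ := ih hD' (right_ne_zero_of_mul hD0) hF' (fun q => by
      have := h q
      rw [add_comm e 1, add_comm (e + e') 1, ordAt_mul (pointForm_mem p) hD',
        ordAt_mul (pointForm_mem p) hF'] at this
      refine (ENat.add_le_add_iff_left ?_).1 this
      rw [Ne, ordAt_eq_top_iff (pointForm_mem p)]
      exact pointForm_ne_zero p)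
    exact ⟨G, hG, by ring⟩

/-- There are forms of every order at `p`, with at most one other zero. -/
theorem exists_form_ordAt {e s : ℕ} (hs : s ≤ e) (p : OnePoint ℂ) :
    ∃ F ∈ formSpace e, ordAt e p F = s := by
  obtain ⟨q, hq⟩ := exists_ne p
  have h1 := pow_mem_formSpace (pointForm_mem p) s
  have h2 := pow_mem_formSpace (pointForm_mem q) (e - s)
  have he : e = s * 1 + (e - s) * 1 := by omega
  refine ⟨pointForm p ^ s * pointForm q ^ (e - s), ?_, ?_⟩
  · rw [he]; simpa using mul_mem_formSpace h1 h2
  · conv_lhs => rw [he]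
    rw [show s * 1 + (e - s) * 1 - s = e - s by omega, ordAt_mul h1 h2,
      ordAt_pow (pointForm_mem p), ordAt_pow (pointForm_mem q), ordAt_pointForm_self,
      ordAt_pointForm hq]
    simp

/-! ### Powers of the space of parameterizing forms -/

variable {n d : ℕ}

/-- The `i`-th parameterizing form, dehomogenized. -/
def rowPoly (a : CoeffSpace n d) (i : Fin (n + 1)) : ℂ[X] := ∑ j : Fin (d + 1), C (a (i, j)) * X ^ (j : ℕ)

theorem rowPoly_coeff (a : CoeffSpace n d) (i : Fin (n + 1)) (j : Fin (d + 1)) :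
    (rowPoly a i).coeff j = a (i, j) := by
  rw [rowPoly, finsetSum_coeff, Finset.sum_eq_single j]
  · simp
  · intro b _ hb
    rw [coeff_C_mul, coeff_X_pow, if_neg (fun h => hb (Fin.ext h.symm)), mul_zero]
  · simp

theorem rowPoly_mem (a : CoeffSpace n d) (i : Fin (n + 1)) : rowPoly a i ∈ formSpace d :=
  Submodule.sum_mem _ fun j _ => by
    rw [mem_formSpace]
    exact (natDegree_C_mul_X_pow_le _ _).trans (by omega)

theorem germ_eq_expansion (a : CoeffSpace n d) (p : OnePoint ℂ) (i : Fin (n + 1)) :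
    germ a p i = expansion d p (rowPoly a i) := by
  rw [germ, form, expansion_apply, Finset.sum_range, map_sum]
  refine Finset.sum_congr rfl fun j _ => ?_
  rw [rowPoly_coeff]
  simp [Algebra.smul_def]

/-- The space of forms of degree `N * d` spanned by the monomials of degree `N` in the parameterizing
forms. -/
def monomialSpan (a : CoeffSpace n d) (N : ℕ) : Submodule ℂ ℂ[X] :=
  (Submodule.span ℂ (Set.range (rowPoly a))) ^ N

theorem monomialSpan_le (a : CoeffSpace n d) (N : ℕ) : monomialSpan a N ≤ formSpace (N * d) := by
  induction N with
  | zero =>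
    rw [monomialSpan, pow_zero, Submodule.one_eq_span, Submodule.span_le]
    simp [mem_formSpace]
  | succ N ih =>
    rw [monomialSpan, pow_succ, Submodule.mul_le]
    intro F hF G hG
    rw [add_mul, one_mul]
    refine mul_mem_formSpace (ih hF) ?_
    exact (Submodule.span_le.2 (by rintro _ ⟨i, rfl⟩; exact rowPoly_mem a i)) hG

theorem mul_mem_monomialSpan {a : CoeffSpace n d} {M N : ℕ} {F G : ℂ[X]}
    (hF : F ∈ monomialSpan a M) (hG : G ∈ monomialSpan a N) : F * G ∈ monomialSpan a (M + N) := by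
  rw [monomialSpan, pow_add]; exact Submodule.mul_mem_mul hF hG

theorem pow_mem_monomialSpan {a : CoeffSpace n d} {M : ℕ} {F : ℂ[X]}
    (hF : F ∈ monomialSpan a M) (N : ℕ) : F ^ N ∈ monomialSpan a (N * M) := by
  rw [monomialSpan, mul_comm, pow_mul]; exact Submodule.pow_mem_pow _ hF N

theorem mem_monomialSpan_one {a : CoeffSpace n d} {F : ℂ[X]} :
    F ∈ monomialSpan a 1 ↔ ∃ c : Fin (n + 1) → ℂ, F = ∑ i, c i • rowPoly a i := by
  rw [monomialSpan, pow_one, Submodule.mem_span_range_iff_exists_fun]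
  exact exists_congr fun c => eq_comm

theorem rowPoly_mem_monomialSpan (a : CoeffSpace n d) (i : Fin (n + 1)) :
    rowPoly a i ∈ monomialSpan a 1 := by
  rw [monomialSpan, pow_one]; exact Submodule.subset_span ⟨i, rfl⟩

instance (a : CoeffSpace n d) (N : ℕ) : FiniteDimensional ℂ (monomialSpan a N) :=
  Submodule.finiteDimensional_of_le (monomialSpan_le a N)

theorem mem_vanishingOrders {a : CoeffSpace n d} {p : OnePoint ℂ} {m : ℕ} :
    m ∈ vanishingOrders a p ↔ ∃ F ∈ monomialSpan a 1, ordAt d p F = m := by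
  simp only [mem_monomialSpan_one]
  constructor
  · rintro ⟨c, hc⟩
    refine ⟨_, ⟨c, rfl⟩, ?_⟩
    simpa [ordAt, germ_eq_expansion] using hc
  · rintro ⟨_, ⟨c, rfl⟩, hc⟩
    refine ⟨c, ?_⟩
    simpa [ordAt, germ_eq_expansion] using hc


/-! ### Value semigroups in terms of monomials in the parameterizing forms -/

theorem constantCoeff_localFunction (a : CoeffSpace n d) (p : OnePoint ℂ) (j i : Fin (n + 1)) :
    PowerSeries.constantCoeff (localFunction a p j i) = 0 := by
  simp [localFunction]

theorem hasSubst_localFunction (a : CoeffSpace n d) (p : OnePoint ℂ) (j : Fin (n + 1)) :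
    MvPowerSeries.HasSubst (S := ℂ) (τ := Unit) (localFunction a p j) :=
  MvPowerSeries.hasSubst_of_constantCoeff_zero fun i => constantCoeff_localFunction a p j i

/-- The quotients of monomial forms by powers of the `j`-th form, expanded at `p`. -/
def dehomogenizedAlgebra (a : CoeffSpace n d) (p : OnePoint ℂ) (j : Fin (n + 1)) :
    Subalgebra ℂ (PowerSeries ℂ) where
  carrier := {φ | ∃ M, ∃ F ∈ monomialSpan a M, expansion (M * d) p F = φ * germ a p j ^ M}
  mul_mem' := by
    rintro φ ψ ⟨M, F, hF, h⟩ ⟨N, G, hG, h'⟩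
    refine ⟨M + N, F * G, mul_mem_monomialSpan hF hG, ?_⟩
    rw [add_mul, expansion_mul (monomialSpan_le _ _ hF) (monomialSpan_le _ _ hG), h, h']
    ring
  add_mem' := by
    rintro φ ψ ⟨M, F, hF, h⟩ ⟨N, G, hG, h'⟩
    have hr := rowPoly_mem_monomialSpan a j
    have h1 : F * rowPoly a j ^ N ∈ monomialSpan a (M + N) := by
      simpa using mul_mem_monomialSpan hF (pow_mem_monomialSpan hr N)
    have h2 : G * rowPoly a j ^ M ∈ monomialSpan a (M + N) := by
      rw [add_comm]; simpa using mul_mem_monomialSpan hG (pow_mem_monomialSpan hr M)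
    refine ⟨M + N, _, add_mem h1 h2, ?_⟩
    have e1 := expansion_mul (monomialSpan_le _ _ hF) (pow_mem_formSpace (rowPoly_mem a j) N) p
    have e2 := expansion_mul (monomialSpan_le _ _ hG) (pow_mem_formSpace (rowPoly_mem a j) M) p
    rw [expansion_pow (rowPoly_mem a j)] at e1 e2
    rw [map_add, show (M + N) * d = M * d + N * d by ring, e1, add_comm (M * d), e2, h, h',
      germ_eq_expansion]
    ring
  algebraMap_mem' c := by
    refine ⟨0, C c, ?_, ?_⟩
    · rw [monomialSpan, pow_zero]; exact Submodule.algebraMap_mem c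
    · simp [expansion_apply, PowerSeries.smul_eq_C_mul]

theorem mul_inv_germ {a : CoeffSpace n d} {p : OnePoint ℂ} {j : Fin (n + 1)}
    (hj : valueAt a p j ≠ 0) : germ a p j * (germ a p j)⁻¹ = 1 :=
  PowerSeries.mul_inv_cancel _ hj

theorem localFunction_mem_dehomogenizedAlgebra {a : CoeffSpace n d} {p : OnePoint ℂ}
    {j : Fin (n + 1)} (hj : valueAt a p j ≠ 0) (i : Fin (n + 1)) :
    localFunction a p j i ∈ dehomogenizedAlgebra a p j := by
  refine sub_mem ⟨1, rowPoly a i, rowPoly_mem_monomialSpan a i, ?_⟩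
    ((dehomogenizedAlgebra a p j).algebraMap_mem _)
  rw [one_mul, ← germ_eq_expansion, pow_one, mul_assoc, mul_comm _ (germ a p j), mul_inv_germ hj,
    mul_one]

/-- Divided by the `M`-th power of the `j`-th form, a monomial form becomes a polynomial in the
quotients F_i / F_j, and each of these is a local function plus a constant. -/
theorem expansion_mul_inv_mem_range {a : CoeffSpace n d} {p : OnePoint ℂ} {j : Fin (n + 1)}
    {M : ℕ} {F : ℂ[X]} (hF : F ∈ monomialSpan a M) :
    expansion (M * d) p F * (germ a p j)⁻¹ ^ M ∈
      (MvPowerSeries.substAlgHom (R := ℂ) (hasSubst_localFunction a p j)).range := by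
  set R' : Subalgebra ℂ (PowerSeries ℂ) :=
    (MvPowerSeries.substAlgHom (R := ℂ) (hasSubst_localFunction a p j)).range with hR'
  have hgen : ∀ i, germ a p i * (germ a p j)⁻¹ ∈ R' := by
    intro i
    have h1 : localFunction a p j i ∈ R' :=
      ⟨MvPowerSeries.X i, MvPowerSeries.substAlgHom_X (hasSubst_localFunction a p j) i⟩
    have h2 := R'.add_mem h1 (R'.algebraMap_mem
      (PowerSeries.constantCoeff (germ a p i * (germ a p j)⁻¹)))
    have e : (algebraMap ℂ (PowerSeries ℂ)) (PowerSeries.constantCoeff (germ a p i * (germ a p j)⁻¹))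
      = PowerSeries.C (PowerSeries.constantCoeff (germ a p i * (germ a p j)⁻¹)) := rfl
    rw [e, localFunction, sub_add_cancel] at h2
    exact h2
  have hlin : ∀ G ∈ monomialSpan a 1, expansion d p G * (germ a p j)⁻¹ ∈ R' := by
    intro G hG
    obtain ⟨c, rfl⟩ := mem_monomialSpan_one.1 hG
    rw [map_sum, Finset.sum_mul]
    refine R'.sum_mem fun i _ => ?_
    rw [map_smul, smul_mul_assoc, ← germ_eq_expansion]
    exact R'.smul_mem (hgen i) _
  induction M generalizing F with
  | zero =>
    rw [monomialSpan, pow_zero, Submodule.mem_one] at hF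
    obtain ⟨c, rfl⟩ := hF
    have : expansion (0 * d) p (algebraMap ℂ ℂ[X] c) * (germ a p j)⁻¹ ^ 0 =
        algebraMap ℂ (PowerSeries ℂ) c := by
      simp [expansion_apply, PowerSeries.smul_eq_C_mul]
    rw [this]
    exact R'.algebraMap_mem c
  | succ M ih =>
    rw [monomialSpan, pow_succ] at hF
    induction hF using Submodule.mul_induction_on' with
    | mem_mul_mem G hG H hH =>
      have hH' : H ∈ monomialSpan a 1 := by rwa [monomialSpan, pow_one]
      have hH'' := monomialSpan_le a 1 hH'
      rw [one_mul] at hH''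
      rw [add_mul, one_mul, expansion_mul (monomialSpan_le _ _ hG) hH'', pow_succ]
      have := R'.mul_mem (ih hG) (hlin H hH')
      convert this using 1
      ring
    | add G _ H _ hG hH =>
      rw [map_add, add_mul]; exact R'.add_mem hG hH

/-- The value semigroup consists of the vanishing orders of the forms spanned by monomials of
arbitrary degree in the parameterizing forms. -/
theorem mem_valueSemigroup {a : CoeffSpace n d} {p : OnePoint ℂ} (ha : valueAt a p ≠ 0) {m : ℕ} :
    m ∈ valueSemigroup a p ↔ ∃ M, ∃ F ∈ monomialSpan a M, ordAt (M * d) p F = m := by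
  have hunit : ∀ j, valueAt a p j ≠ 0 → ∀ M, (germ a p j ^ M).order = 0 := fun j hj M => by
    have : (germ a p j).order = 0 := by
      by_contra h
      exact hj (PowerSeries.order_ne_zero_iff_constCoeff_eq_zero.1 h)
    rw [PowerSeries.order_pow, this, smul_zero]
  constructor
  · rintro ⟨j, hj, h, hh⟩
    -- The local functions have no constant term, so the terms of total degree at least `m + 1`
    -- contribute only orders at least `m + 1`. The series may be replaced by a polynomial without
    -- changing the order `m`.
    set P := MvPowerSeries.truncTotal (m + 1) h with hP
    have hS := hasSubst_localFunction a p j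
    have hmem : MvPolynomial.aeval (localFunction a p j) P ∈ dehomogenizedAlgebra a p j := by
      have h1 : MvPolynomial.aeval (localFunction a p j) P ∈
          Algebra.adjoin ℂ (Set.range (localFunction a p j)) := by
        rw [Algebra.adjoin_range_eq_range_aeval]; exact ⟨P, rfl⟩
      refine Algebra.adjoin_le ?_ h1
      rintro _ ⟨i, rfl⟩
      exact localFunction_mem_dehomogenizedAlgebra hj i
    have horder : (MvPolynomial.aeval (localFunction a p j) P).order = (m : ℕ∞) := by
      have hdiff : localMap a p j h = MvPolynomial.aeval (localFunction a p j) P +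
          MvPowerSeries.subst (τ := Unit) (localFunction a p j) (h - (P : MvPowerSeries _ ℂ)) := by
        rw [MvPowerSeries.subst_sub hS, MvPowerSeries.subst_coe, localMap]
        exact (add_sub_cancel _ _).symm
      have hbig : ((m + 1 : ℕ) : ℕ∞) ≤ PowerSeries.order (MvPowerSeries.subst (τ := Unit)
          (localFunction a p j) (h - (P : MvPowerSeries _ ℂ))) := by
        rw [PowerSeries.order_eq_order]
        refine le_trans ?_ (MvPowerSeries.le_order_subst hS _)
        rw [← one_mul ((m + 1 : ℕ) : ℕ∞)]
        refine mul_le_mul' (le_iInf fun i => ?_) (MvPowerSeries.le_order fun x hx => ?_)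
        · rw [← PowerSeries.order_eq_order]
          exact PowerSeries.one_le_order_iff_constCoeff_eq_zero.2
            (constantCoeff_localFunction a p j i)
        · rw [map_sub, MvPolynomial.coeff_coe, hP, MvPowerSeries.coeff_truncTotal _
            (by exact_mod_cast hx), sub_self]
      have hlt : (m : ℕ∞) < ((m + 1 : ℕ) : ℕ∞) := by exact_mod_cast Nat.lt_succ_self m
      rw [eq_sub_of_add_eq hdiff.symm, sub_eq_add_neg, PowerSeries.order_add_of_order_ne, hh,
        PowerSeries.order_neg, inf_eq_left]
      · exact hlt.le.trans hbig
      · rw [hh, PowerSeries.order_neg]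
        exact (hlt.trans_le hbig).ne
    obtain ⟨M, F, hF, e⟩ := hmem
    refine ⟨M, F, hF, ?_⟩
    rw [ordAt, e, PowerSeries.order_mul, horder, hunit j hj, add_zero]
  · rintro ⟨M, F, hF, h⟩
    obtain ⟨j, hj⟩ := Function.ne_iff.1 ha
    obtain ⟨φ, hφ⟩ := expansion_mul_inv_mem_range (p := p) (j := j) hF
    refine ⟨j, hj, φ, ?_⟩
    have e : localMap a p j φ = expansion (M * d) p F * (germ a p j)⁻¹ ^ M := by
      rw [← hφ]
      exact (MvPowerSeries.substAlgHom_apply (hasSubst_localFunction a p j) φ).symm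
    have e2 : localMap a p j φ * germ a p j ^ M = expansion (M * d) p F := by
      rw [e, mul_assoc, ← mul_pow, mul_comm _ (germ a p j), mul_inv_germ hj, one_pow, mul_one]
    rw [ordAt, ← e2, PowerSeries.order_mul, hunit j hj, add_zero] at h
    exact h

/-- The bound `2 * g` does the same as `2 * g + 1`, because `2 * g` is even; it also counts the gaps
in pairs. -/
theorem mem_hyperellipticSemigroup {g m : ℕ} :
    m ∈ hyperellipticSemigroup g ↔ Even m ∨ 2 * g ≤ m := by
  constructor
  · intro h
    induction h using AddSubmonoid.closure_induction with
    | mem x hx =>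
      rcases hx with rfl | rfl
      · exact Or.inl even_two
      · exact Or.inr (by omega)
    | zero => exact Or.inl Even.zero
    | add x y _ _ hx hy =>
      rcases hx with hx | hx
      · rcases hy with hy | hy
        · exact Or.inl (hx.add hy)
        · exact Or.inr (by omega)
      · exact Or.inr (by omega)
  · have h2 : ∀ k, 2 * k ∈ hyperellipticSemigroup g := fun k => by
      rw [mul_comm, ← smul_eq_mul]
      exact AddSubmonoid.nsmul_mem _ (AddSubmonoid.subset_closure (by simp)) k
    have h3 : 2 * g + 1 ∈ hyperellipticSemigroup g := AddSubmonoid.subset_closure (by simp)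
    intro h
    rcases Nat.even_or_odd' m with ⟨k, rfl | rfl⟩
    · exact h2 k
    · have : 2 * g ≤ 2 * k + 1 := by
        rcases h with h | h
        · exact absurd h (by simp)
        · exact h
      rw [show 2 * k + 1 = (2 * g + 1) + 2 * (k - g) by omega]
      exact add_mem h3 (h2 _)

theorem encard_compl_hyperellipticSemigroup (g : ℕ) :
    ((hyperellipticSemigroup g : Set ℕ)ᶜ).encard = g := by
  have : ((hyperellipticSemigroup g : Set ℕ)ᶜ) = (fun k => 2 * k + 1) '' (Finset.range g : Set ℕ) := by
    ext m
    simp only [Set.mem_compl_iff, SetLike.mem_coe, mem_hyperellipticSemigroup, Set.mem_image,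
      Finset.mem_range]
    constructor
    · intro h
      push Not at h
      obtain ⟨k, hk⟩ := Nat.not_even_iff_odd.1 h.1
      exact ⟨k, by omega, hk.symm⟩
    · rintro ⟨k, hk, rfl⟩ h
      rcases h with h | h
      · exact absurd h (by simp)
      · omega
  rw [this, Set.InjOn.encard_image (fun a _ b _ h => by simpa using h), Set.encard_coe_eq_coe_finsetCard]
  simp


/-! ### A criterion for unicuspidality -/

/-- Cancellation of a leading term. Iterated, it is the division algorithm by vanishing orders used
throughout. -/
theorem exists_smul_sub_order {φ ψ : PowerSeries ℂ} {s : ℕ} (hφ : (s : ℕ∞) ≤ φ.order)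
    (hψ : ψ.order = s) : ∃ c : ℂ, ((s + 1 : ℕ) : ℕ∞) ≤ (φ - c • ψ).order := by
  have h0 : PowerSeries.coeff s ψ ≠ 0 := (PowerSeries.order_eq_nat.1 hψ).1
  refine ⟨PowerSeries.coeff s φ / PowerSeries.coeff s ψ, PowerSeries.nat_le_order _ _ fun i hi => ?_⟩
  rcases Nat.lt_succ_iff_lt_or_eq.1 hi with h | rfl
  · rw [map_sub, PowerSeries.coeff_of_lt_order i (lt_of_lt_of_le (by exact_mod_cast h) hφ),
      PowerSeries.coeff_smul, PowerSeries.coeff_of_lt_order i (by rw [hψ]; exact_mod_cast h)]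
    simp
  · rw [map_sub, PowerSeries.coeff_smul, smul_eq_mul, div_mul_cancel₀ _ h0, sub_self]

theorem exists_smul_sub_ordAt {e : ℕ} {p : OnePoint ℂ} {F G : ℂ[X]} {s : ℕ}
    (hF : (s : ℕ∞) ≤ ordAt e p F) (hG : ordAt e p G = s) :
    ∃ c : ℂ, ((s + 1 : ℕ) : ℕ∞) ≤ ordAt e p (F - c • G) := by
  obtain ⟨c, hc⟩ := exists_smul_sub_order hF hG
  exact ⟨c, by rwa [ordAt, map_sub, map_smul]⟩

theorem le_ordAt_add {e : ℕ} {p : OnePoint ℂ} {F G : ℂ[X]} {r : ℕ∞} (hF : r ≤ ordAt e p F)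
    (hG : r ≤ ordAt e p G) : r ≤ ordAt e p (F + G) := by
  rw [ordAt, map_add]
  exact (le_min hF hG).trans (PowerSeries.min_order_le_order_add _ _)

theorem le_ordAt_smul {e : ℕ} {p : OnePoint ℂ} {F : ℂ[X]} {r : ℕ∞} (c : ℂ) (hF : r ≤ ordAt e p F) :
    r ≤ ordAt e p (c • F) := by
  rw [ordAt, map_smul]
  exact hF.trans PowerSeries.le_order_smul

theorem le_ordAt_sub {e : ℕ} {p : OnePoint ℂ} {F G : ℂ[X]} {r : ℕ∞} (hF : r ≤ ordAt e p F)
    (hG : r ≤ ordAt e p G) : r ≤ ordAt e p (F - G) := by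
  rw [sub_eq_add_neg, ← neg_one_smul ℂ G]
  exact le_ordAt_add hF (le_ordAt_smul _ hG)

theorem le_ordAt_sum {ι : Type*} {e : ℕ} {p : OnePoint ℂ} {F : ι → ℂ[X]} {r : ℕ∞} (s : Finset ι)
    (hF : ∀ i ∈ s, r ≤ ordAt e p (F i)) : r ≤ ordAt e p (∑ i ∈ s, F i) := by
  classical
  induction s using Finset.induction_on with
  | empty => simp [ordAt]
  | insert i s hi ih =>
    rw [Finset.sum_insert hi]
    exact le_ordAt_add (hF i (by simp)) (ih fun j hj => hF j (by simp [hj]))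

theorem ordAt_smul_of_ne_zero {e : ℕ} {p : OnePoint ℂ} {F : ℂ[X]} {c : ℂ} (hc : c ≠ 0) :
    ordAt e p (c • F) = ordAt e p F := by
  apply le_antisymm
  · have := le_ordAt_smul (e := e) (p := p) (F := c • F) c⁻¹ le_rfl
    rwa [smul_smul, inv_mul_cancel₀ hc, one_smul] at this
  · exact le_ordAt_smul c le_rfl

/-- The vanishing orders at `p` of the monomial forms lie in the hyperelliptic semigroup, and all
elements of the semigroup occur in some large degree. -/
structure IsHyperellipticAt (g : ℕ) (a : CoeffSpace n d) (p : OnePoint ℂ) : Prop where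
  mem_semigroup : ∀ M, ∀ F ∈ monomialSpan a M, ∀ s : ℕ, ordAt (M * d) p F = s → Even s ∨ 2 * g ≤ s
  exists_form : ∃ N, 2 * g + 2 ≤ N * d ∧ ∀ s : ℕ, s ≤ N * d → (Even s ∨ 2 * g ≤ s) →
    ∃ F ∈ monomialSpan a N, ordAt (N * d) p F = s

/-- Subtracting elements of `W` raises the order step by step; beyond `e` only the zero form is
left. The induction is on a bound `k` for the distance of the order from `e + 1`. -/
theorem mem_of_le_ordAt {W : Submodule ℂ ℂ[X]} {e r : ℕ} {p : OnePoint ℂ}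
    (hW : ∀ s : ℕ, r ≤ s → s ≤ e → ∃ F ∈ W, ordAt e p F = s) (hWe : W ≤ formSpace e) {F : ℂ[X]}
    (hF : F ∈ formSpace e) (h : (r : ℕ∞) ≤ ordAt e p F) : F ∈ W := by
  obtain ⟨k, hk⟩ : ∃ k : ℕ, ((e + 1 : ℕ) : ℕ∞) ≤ ordAt e p F + k :=
    ⟨e + 1, le_add_self⟩
  induction k generalizing F with
  | zero =>
    rcases eq_or_ne F 0 with rfl | h0
    · exact zero_mem _
    obtain ⟨m, hm, hm'⟩ := exists_ordAt_eq (p := p) hF h0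
    rw [hm'] at hk
    have : e + 1 ≤ m + 0 := by exact_mod_cast hk
    omega
  | succ k ih =>
    rcases eq_or_ne F 0 with rfl | h0
    · exact zero_mem _
    obtain ⟨m, hm, hm'⟩ := exists_ordAt_eq (p := p) hF h0
    rw [hm'] at hk h
    obtain ⟨G, hG, hG'⟩ := hW m (by exact_mod_cast h) hm
    obtain ⟨c, hc⟩ := exists_smul_sub_ordAt hm'.ge hG'
    have hk' : e + 1 ≤ m + (k + 1) := by exact_mod_cast hk
    have h1 : F - c • G ∈ W := by
      refine ih (sub_mem hF (Submodule.smul_mem _ _ (hWe hG))) ?_ ?_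
      · refine le_trans ?_ hc
        have : r ≤ m := by exact_mod_cast h
        exact_mod_cast this.trans (Nat.le_succ m)
      · calc ((e + 1 : ℕ) : ℕ∞) ≤ ((m + 1 : ℕ) : ℕ∞) + k := by exact_mod_cast (by omega)
          _ ≤ _ := by gcongr
    have := add_mem h1 (W.smul_mem c hG)
    rwa [sub_add_cancel] at this

theorem expansion_zero_mul_algebraMap (p : OnePoint ℂ) (c : ℂ) :
    expansion (0 * d) p (algebraMap ℂ ℂ[X] c) = PowerSeries.C c := by
  simp [expansion_apply, PowerSeries.smul_eq_C_mul]

/-- Induction on monomial forms. -/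
theorem monomialSpan_induction {a : CoeffSpace n d} {P : ℕ → ℂ[X] → Prop}
    (hconst : ∀ c, P 0 (algebraMap ℂ ℂ[X] c))
    (hmul : ∀ M, ∀ G ∈ monomialSpan a M, ∀ H ∈ monomialSpan a 1, P M G → P (M + 1) (G * H))
    (hadd : ∀ M, ∀ G ∈ monomialSpan a M, ∀ H ∈ monomialSpan a M, P M G → P M H → P M (G + H))
    {M : ℕ} {F : ℂ[X]} (hF : F ∈ monomialSpan a M) : P M F := by
  induction M generalizing F with
  | zero =>
    rw [monomialSpan, pow_zero, Submodule.mem_one] at hF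
    obtain ⟨c, rfl⟩ := hF
    exact hconst c
  | succ M ih =>
    have e : monomialSpan a (M + 1) = monomialSpan a M * monomialSpan a 1 := by
      simp only [monomialSpan, pow_succ, pow_zero, one_mul]
    have hF' := hF
    rw [e] at hF'
    induction hF' using Submodule.mul_induction_on' with
    | mem_mul_mem G hG H hH => exact hmul M G hG H hH (ih hG)
    | add G hG H hH h1 h2 => rw [← e] at hG hH; exact hadd _ G hG H hH (h1 hG) (h2 hH)

theorem mem_formSpace_of_mem_one {a : CoeffSpace n d} {F : ℂ[X]} (hF : F ∈ monomialSpan a 1) :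
    F ∈ formSpace d := by
  simpa using monomialSpan_le a 1 hF

/-- Monomial forms of degree `M` are homogeneous of degree `M` in the parameterizing forms. Hence no
monomial form separates two points with the same image, and with `c = 0` all monomial forms of
positive degree vanish at a base point. -/
theorem constantCoeff_expansion_of_proportional {a : CoeffSpace n d} {q q' : OnePoint ℂ} {c : ℂ}
    (h : valueAt a q = c • valueAt a q') {M : ℕ} {F : ℂ[X]} (hF : F ∈ monomialSpan a M) :
    PowerSeries.constantCoeff (expansion (M * d) q F) =
      c ^ M * PowerSeries.constantCoeff (expansion (M * d) q' F) := by
  refine monomialSpan_induction (P := fun M F => PowerSeries.constantCoeff (expansion (M * d) q F) =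
      c ^ M * PowerSeries.constantCoeff (expansion (M * d) q' F)) ?_ ?_ ?_ hF
  · intro b
    rw [expansion_zero_mul_algebraMap, expansion_zero_mul_algebraMap, pow_zero, one_mul]
  · intro M G hG H hH ih
    have hH' : PowerSeries.constantCoeff (expansion d q H) =
        c * PowerSeries.constantCoeff (expansion d q' H) := by
      obtain ⟨b, rfl⟩ := mem_monomialSpan_one.1 hH
      simp only [map_sum, map_smul, ← germ_eq_expansion]
      rw [Finset.mul_sum]
      refine Finset.sum_congr rfl fun i _ => ?_
      have := congrFun h i
      simp only [valueAt, Pi.smul_apply, smul_eq_mul] at this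
      simp only [PowerSeries.smul_eq_C_mul, map_mul, PowerSeries.constantCoeff_C, this]
      ring
    rw [add_mul, one_mul, expansion_mul (monomialSpan_le _ _ hG) (mem_formSpace_of_mem_one hH),
      expansion_mul (monomialSpan_le _ _ hG) (mem_formSpace_of_mem_one hH), map_mul, map_mul, ih, hH']
    ring
  · intro M G _ H _ h1 h2
    rw [map_add, map_add, map_add, map_add, h1, h2]; ring

theorem ordAt_add_order {a : CoeffSpace n d} {p : OnePoint ℂ} {M N : ℕ} {F G : ℂ[X]} {r s : ℕ}
    (hF : F ∈ monomialSpan a M) (hG : G ∈ monomialSpan a N) (h : ordAt (M * d) p F = r)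
    (h' : ordAt (N * d) p G = s) : ordAt ((M + N) * d) p (F * G) = (r + s : ℕ) := by
  rw [add_mul, ordAt_mul (monomialSpan_le _ _ hF) (monomialSpan_le _ _ hG), h, h']; rfl

/-- In degree `N` every form of order at least `2 * g` at `p` is a monomial form. Since `N * d - 1`
exceeds `2 * g`, this includes the product of the `(N * d - 1)`-st power of the point form of `p`
with the point form of any `q'`. Such forms vanish only at `p` and `q'`; they separate points and
tangent directions away from `p` and rule out base points there. -/
theorem isUnicuspidalAt_of_isHyperellipticAt {g : ℕ} {a : CoeffSpace n d} {p : OnePoint ℂ}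
    (hli : LinearIndependent ℂ (fun (i : Fin (n + 1)) (j : Fin (d + 1)) => a (i, j)))
    (h : IsHyperellipticAt g a p) : IsUnicuspidalAt g (hyperellipticSemigroup g) a p := by
  obtain ⟨N, hN, hform⟩ := h.exists_form
  have hmem : ∀ F ∈ formSpace (N * d), ((2 * g : ℕ) : ℕ∞) ≤ ordAt (N * d) p F →
      F ∈ monomialSpan a N := fun F hF h' =>
    mem_of_le_ordAt (fun s h1 h2 => hform s h2 (Or.inr h1)) (monomialSpan_le a N) hF h'
  have hsep : ∀ q q' : OnePoint ℂ, q ≠ p → ∃ F ∈ monomialSpan a N,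
      (q' ≠ q → ordAt (N * d) q F = 0 ∧ ordAt (N * d) q' F ≠ 0) ∧ (q' = q → ordAt (N * d) q F = 1) := by
    intro q q' hq
    have h1 := pow_mem_formSpace (pointForm_mem p) (N * d - 1)
    have h2 := mul_mem_formSpace h1 (pointForm_mem q')
    have e : (N * d - 1) * 1 + 1 = N * d := by omega
    have ho : ∀ x, ordAt (N * d) x (pointForm p ^ (N * d - 1) * pointForm q') =
        (N * d - 1) • ordAt 1 x (pointForm p) + ordAt 1 x (pointForm q') := fun x => by
      conv_lhs => rw [← e]
      rw [show (N * d - 1) * 1 + 1 - 1 = N * d - 1 by omega, ordAt_mul h1 (pointForm_mem q'),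
        ordAt_pow (pointForm_mem p)]
    refine ⟨_, hmem _ (by rwa [e] at h2) ?_, ?_, ?_⟩
    · rw [ho, ordAt_pointForm_self]
      refine le_trans ?_ le_self_add
      simp only [nsmul_eq_mul, mul_one]
      exact_mod_cast (by omega)
    · intro hqq
      rw [ho, ho, ordAt_pointForm hq.symm, ordAt_pointForm hqq, ordAt_pointForm_self]
      simp
    · rintro rfl
      rw [ho, ordAt_pointForm hq.symm, ordAt_pointForm_self]
      simp
  have hval : ∀ q, (∃ F ∈ monomialSpan a N, ordAt (N * d) q F = 0) → valueAt a q ≠ 0 := by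
    rintro q ⟨F, hF, hF0⟩ h0
    have := constantCoeff_expansion_of_proportional (c := 0) (q := q) (q' := q)
      (by rw [h0]; simp) hF
    rw [ordAt_eq_zero_iff] at hF0
    rw [zero_pow (by rintro rfl; omega), zero_mul] at this
    exact hF0 this
  have hvalall : ∀ q, valueAt a q ≠ 0 := by
    intro q
    apply hval
    by_cases hq : q = p
    · subst hq
      simpa using hform 0 (by omega) (Or.inl Even.zero)
    · obtain ⟨q', hq'⟩ := exists_ne q
      obtain ⟨F, hF, h1, -⟩ := hsep q q' hq
      exact ⟨F, hF, (h1 hq').1⟩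
  refine ⟨⟨⟨hli, hvalall⟩, ?_⟩, ?_, encard_compl_hyperellipticSemigroup g, ?_⟩
  · intro q q' hqq
    by_contra hne
    have key : ∀ q q' : OnePoint ℂ, q ≠ p → q ≠ q' → ∀ c : ℂ, valueAt a q = c • valueAt a q' →
        False := by
      intro q q' hq hqq' c hc
      obtain ⟨F, hF, h1, -⟩ := hsep q q' hq
      have := constantCoeff_expansion_of_proportional hc hF
      have h2 := (h1 hqq'.symm).2
      rw [Ne, ordAt_eq_zero_iff, not_not] at h2
      rw [h2, mul_zero] at this
      exact ordAt_eq_zero_iff.1 (h1 hqq'.symm).1 this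
    obtain ⟨c, hc⟩ := (Projectivization.mk_eq_mk_iff' ℂ _ _ (hvalall q) (hvalall q')).1 hqq
    -- At most one of the two points is `p`, and `key` needs the other one in the first place.
    by_cases hq : q = p
    · have hq' : q' ≠ p := fun e => hne (hq.trans e.symm)
      have hc0 : c ≠ 0 := by
        rintro rfl
        rw [zero_smul] at hc
        exact hvalall q hc.symm
      exact key q' q hq' (Ne.symm hne) c⁻¹ (by rw [← hc, smul_smul, inv_mul_cancel₀ hc0, one_smul])
    · exact key q q' hq hne c hc.symm
  · ext m
    rw [mem_valueSemigroup (hvalall p), SetLike.mem_coe]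
    constructor
    · rintro ⟨M, F, hF, hm⟩
      exact mem_hyperellipticSemigroup.2 (h.mem_semigroup M F hF m hm)
    · intro hm
      induction hm using AddSubmonoid.closure_induction with
      | mem x hx =>
        have hx' : x = 2 ∨ x = 2 * g + 1 := hx
        obtain ⟨F, hF, hF'⟩ := hform x (by omega) (by
          rcases hx' with rfl | rfl
          · exact Or.inl even_two
          · exact Or.inr (by omega))
        exact ⟨N, F, hF, hF'⟩
      | zero =>
        obtain ⟨F, hF, hF'⟩ := hform 0 (by omega) (Or.inl Even.zero)
        exact ⟨N, F, hF, hF'⟩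
      | add x y _ _ hx hy =>
        obtain ⟨M, F, hF, h1⟩ := hx
        obtain ⟨M', G, hG, h2⟩ := hy
        exact ⟨M + M', F * G, mul_mem_monomialSpan hF hG, ordAt_add_order hF hG h1 h2⟩
  · intro q hq
    rw [Set.eq_univ_iff_forall]
    intro m
    rw [mem_valueSemigroup (hvalall q)]
    obtain ⟨F, hF, -, h1⟩ := hsep q q hq
    refine ⟨m * N, F ^ m, pow_mem_monomialSpan hF m, ?_⟩
    rw [mul_assoc, ordAt_pow (monomialSpan_le _ _ hF), h1 rfl]
    simp


/-! ### Monomial forms of large degree on a unicuspidal curve -/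

theorem exists_form_ordAt_zero {a : CoeffSpace n d} {p : OnePoint ℂ} (h : valueAt a p ≠ 0) :
    ∃ G ∈ monomialSpan a 1, ordAt d p G = 0 := by
  obtain ⟨j, hj⟩ := Function.ne_iff.1 h
  refine ⟨rowPoly a j, rowPoly_mem_monomialSpan a j, ?_⟩
  rw [ordAt_eq_zero_iff, ← germ_eq_expansion]
  exact hj

/-- If the linear forms that vanish at `p` vanish there to order at least `r`, then so do the monomial
forms of every degree. -/
theorem ordAt_eq_zero_or_le {a : CoeffSpace n d} {p : OnePoint ℂ} (h : valueAt a p ≠ 0) {r : ℕ}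
    (hr : ∀ G ∈ monomialSpan a 1, ordAt d p G = 0 ∨ (r : ℕ∞) ≤ ordAt d p G) {M : ℕ} {F : ℂ[X]}
    (hF : F ∈ monomialSpan a M) : ordAt (M * d) p F = 0 ∨ (r : ℕ∞) ≤ ordAt (M * d) p F := by
  rcases Nat.eq_zero_or_pos r with rfl | hr0
  · exact Or.inr (by simp)
  obtain ⟨L, hL, hL0⟩ := exists_form_ordAt_zero h
  have hlin : ∀ G ∈ monomialSpan a 1, ∃ c : ℂ, (r : ℕ∞) ≤ ordAt d p (G - c • L) := by
    intro G hG
    obtain ⟨c, hc⟩ := exists_smul_sub_ordAt (s := 0) (e := d) (p := p) (F := G) (G := L)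
      (by simp) (by simpa using hL0)
    refine ⟨c, ((hr _ (sub_mem hG (Submodule.smul_mem _ _ hL))).resolve_left fun h0 => ?_)⟩
    rw [h0] at hc
    simp at hc
  -- Up to order `r` every linear form is a multiple of `L`, so every monomial form of degree `M` is
  -- a multiple of `L ^ M`.
  have key : ∃ c : ℂ, (r : ℕ∞) ≤ ordAt (M * d) p (F - c • L ^ M) := by
    refine monomialSpan_induction
      (P := fun M F => ∃ c : ℂ, (r : ℕ∞) ≤ ordAt (M * d) p (F - c • L ^ M)) ?_ ?_ ?_ hF
    · intro b
      refine ⟨b, ?_⟩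
      rw [pow_zero, Algebra.algebraMap_eq_smul_one, sub_self, ordAt, map_zero]
      simp
    · rintro M G hG H hH ⟨c, hc⟩
      obtain ⟨b, hb⟩ := hlin H hH
      have hLM : L ^ M ∈ monomialSpan a M := by simpa using pow_mem_monomialSpan hL M
      refine ⟨c * b, ?_⟩
      have e : G * H - (c * b) • L ^ (M + 1) =
          (G - c • L ^ M) * H + c • (L ^ M * (H - b • L)) := by
        simp only [smul_eq_C_mul, C_mul]; ring
      have m1 := monomialSpan_le _ _ (sub_mem hG (Submodule.smul_mem _ c hLM))
      have m2 := mem_formSpace_of_mem_one (sub_mem hH (Submodule.smul_mem _ b hL))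
      rw [e, add_mul, one_mul]
      refine le_ordAt_add ?_ (le_ordAt_smul _ ?_)
      · rw [ordAt_mul m1 (mem_formSpace_of_mem_one hH)]
        exact hc.trans le_self_add
      · rw [ordAt_mul (monomialSpan_le _ _ hLM) m2]
        exact hb.trans le_add_self
    · rintro M G _ H _ ⟨c, hc⟩ ⟨b, hb⟩
      refine ⟨c + b, ?_⟩
      rw [add_smul, add_sub_add_comm]
      exact le_ordAt_add hc hb
  obtain ⟨c, hc⟩ := key
  rcases eq_or_ne c 0 with rfl | hc0
  · right; simpa using hc
  · left
    have hLM := ordAt_pow (mem_formSpace_of_mem_one hL) p M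
    rw [hL0, smul_zero] at hLM
    rw [ordAt_eq_zero_iff] at hLM ⊢
    have h0 : PowerSeries.constantCoeff (expansion (M * d) p (F - c • L ^ M)) = 0 := by
      by_contra h0
      rw [← ne_eq, ← ordAt_eq_zero_iff] at h0
      rw [h0] at hc
      have : r ≤ 0 := by exact_mod_cast hc
      omega
    rw [map_sub, map_smul, map_sub, sub_eq_zero, PowerSeries.smul_eq_C_mul, map_mul,
      PowerSeries.constantCoeff_C] at h0
    rw [h0]
    exact mul_ne_zero hc0 hLM

/-- A priori only a monomial form of high degree has order one. But if every linear form had order 0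
or at least 2, the same would hold in every degree. -/
theorem exists_form_ordAt_one {a : CoeffSpace n d} {q : OnePoint ℂ} (h : valueAt a q ≠ 0)
    (hq : valueSemigroup a q = Set.univ) : ∃ G ∈ monomialSpan a 1, ordAt d q G = 1 := by
  by_contra hno
  push Not at hno
  have h1 : 1 ∈ valueSemigroup a q := by rw [hq]; trivial
  obtain ⟨M, F, hF, hF1⟩ := (mem_valueSemigroup h).1 h1
  have := ordAt_eq_zero_or_le (r := 2) h (fun G hG => ?_) hF
  · rw [hF1] at this
    norm_num at this
  · by_cases h0 : ordAt d q G = 0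
    · exact Or.inl h0
    · right
      by_contra hlt
      push Not at hlt
      have hne := hno G hG
      generalize ordAt d q G = x at *
      have hx : x ≠ ⊤ := hlt.ne_top
      lift x to ℕ using hx
      norm_cast at *
      omega

/-- Distinct images make some 2 × 2 minor of the two value vectors nonzero. This minor is the value
at `q` of a linear form that vanishes at `q'`. -/
theorem exists_form_separating {a : CoeffSpace n d} (ha : a ∈ morphismSpace n d)
    (hinj : Function.Injective (toProj a ha)) {q q' : OnePoint ℂ} (hne : q ≠ q') :
    ∃ G ∈ monomialSpan a 1, ordAt d q G = 0 ∧ 1 ≤ ordAt d q' G := by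
  have hminor : ∃ i j, valueAt a q' j * valueAt a q i ≠ valueAt a q' i * valueAt a q j := by
    by_contra hall
    push Not at hall
    obtain ⟨j, hj⟩ := Function.ne_iff.1 (ha.2 q')
    refine hne (hinj ((Projectivization.mk_eq_mk_iff' ℂ _ _ (ha.2 q) (ha.2 q')).2
      ⟨valueAt a q j / valueAt a q' j, ?_⟩))
    ext i
    have := hall i j
    simp only [Pi.smul_apply, smul_eq_mul]
    rw [div_mul_eq_mul_div, div_eq_iff hj]
    linear_combination -this
  obtain ⟨i, j, hij⟩ := hminor
  have hc : ∀ x, PowerSeries.constantCoeff (expansion d x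
      (valueAt a q' j • rowPoly a i - valueAt a q' i • rowPoly a j)) =
      valueAt a q' j * valueAt a x i - valueAt a q' i * valueAt a x j := fun x => by
    simp only [map_sub, map_smul, ← germ_eq_expansion, PowerSeries.smul_eq_C_mul, map_mul,
      PowerSeries.constantCoeff_C]
    rfl
  refine ⟨_, sub_mem (Submodule.smul_mem _ (valueAt a q' j) (rowPoly_mem_monomialSpan a i))
    (Submodule.smul_mem _ (valueAt a q' i) (rowPoly_mem_monomialSpan a j)), ?_, ?_⟩
  · rw [ordAt_eq_zero_iff, hc]; exact sub_ne_zero.2 hij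
  · rw [Order.one_le_iff_ne_zero, Ne, ordAt_eq_zero_iff, not_not, hc]
    ring

theorem finite_setOf_ordAt_ne_zero {e : ℕ} {D : ℂ[X]} (hD : D ∈ formSpace e) (h0 : D ≠ 0) :
    {q | ordAt e q D ≠ 0}.Finite := by
  induction e generalizing D with
  | zero =>
    convert Set.finite_empty
    rw [Set.eq_empty_iff_forall_notMem]
    intro q hq
    exact hq (le_antisymm (by simpa using ordAt_le (p := q) hD h0) zero_le)
  | succ e ih =>
    obtain ⟨p, hp⟩ := exists_ordAt_ne_zero hD
    obtain ⟨D', hD', rfl⟩ := exists_eq_pointForm_mul hD hp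
    refine ((ih hD' (right_ne_zero_of_mul h0)).insert p).subset fun q hq => ?_
    by_cases hqp : q = p
    · exact Or.inl hqp
    · right
      rw [Set.mem_ofPred_eq, add_comm e 1, ordAt_mul (pointForm_mem p) hD',
        ordAt_pointForm (Ne.symm hqp), zero_add] at hq
      exact hq

/-- The form is a product: `i` factors of order one at `q`, and for each point of `W` the `e`-th
power of a linear form that vanishes there but not at `q`. The bound on `N` is the number of
factors, filled up with a form not vanishing at `q`. -/
theorem exists_form_killing {a : CoeffSpace n d} (ha : a ∈ morphismSpace n d)
    (hinj : Function.Injective (toProj a ha)) (W : Finset (OnePoint ℂ)) (e : ℕ) {q : OnePoint ℂ}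
    (hq : valueSemigroup a q = Set.univ) {N : ℕ} (hN : W.card * e + e ≤ N) {i : ℕ} (hi : i ≤ e) :
    ∃ F ∈ monomialSpan a N, ordAt (N * d) q F = i ∧
      ∀ q' ∈ W, q' ≠ q → (e : ℕ∞) ≤ ordAt (N * d) q' F := by
  classical
  induction W using Finset.induction_on generalizing N with
  | empty =>
    obtain ⟨L, hL, hL0⟩ := exists_form_ordAt_zero (ha.2 q)
    obtain ⟨G, hG, hG1⟩ := exists_form_ordAt_one (ha.2 q) hq
    have h1 : L ^ (N - i) ∈ monomialSpan a (N - i) := by simpa using pow_mem_monomialSpan hL (N - i)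
    have h2 : G ^ i ∈ monomialSpan a i := by simpa using pow_mem_monomialSpan hG i
    have hNi : N = (N - i) + i := by simp at hN; omega
    refine ⟨L ^ (N - i) * G ^ i, ?_, ?_, by simp⟩
    · have := mul_mem_monomialSpan h1 h2
      rwa [← hNi] at this
    · have e1 : ordAt ((N - i) * d) q (L ^ (N - i)) = (0 : ℕ) := by
        rw [ordAt_pow (mem_formSpace_of_mem_one hL), hL0]; simp
      have e2 : ordAt (i * d) q (G ^ i) = i := by
        rw [ordAt_pow (mem_formSpace_of_mem_one hG), hG1]; simp
      have := ordAt_add_order h1 h2 e1 e2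
      rwa [← hNi, zero_add] at this
  | insert q' W hq' ih =>
    rw [Finset.card_insert_of_notMem hq', add_mul, one_mul] at hN
    obtain ⟨F, hF, hFi, hFW⟩ := ih (N := N - e) (by omega)
    have hNe : N = (N - e) + e := by omega
    have hex : ∃ G ∈ monomialSpan a 1, ordAt d q G = 0 ∧ (q' ≠ q → 1 ≤ ordAt d q' G) := by
      by_cases h : q' = q
      · obtain ⟨L, hL, hL0⟩ := exists_form_ordAt_zero (ha.2 q)
        exact ⟨L, hL, hL0, fun h' => absurd h h'⟩
      · obtain ⟨G, hG, h1, h2⟩ := exists_form_separating ha hinj (Ne.symm h)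
        exact ⟨G, hG, h1, fun _ => h2⟩
    obtain ⟨G, hG, hG0, hG1⟩ := hex
    have h2 : G ^ e ∈ monomialSpan a e := by simpa using pow_mem_monomialSpan hG e
    have ho : ∀ x, ordAt (N * d) x (F * G ^ e) = ordAt ((N - e) * d) x F + e • ordAt d x G := by
      intro x
      conv_lhs => rw [hNe, add_mul]
      rw [ordAt_mul _ (pow_mem_formSpace (mem_formSpace_of_mem_one hG) e),
        ordAt_pow (mem_formSpace_of_mem_one hG)]
      exact monomialSpan_le _ _ hF
    refine ⟨F * G ^ e, ?_, ?_, ?_⟩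
    · have := mul_mem_monomialSpan hF h2
      rwa [← hNe] at this
    · rw [ho, hFi, hG0]; simp
    · intro x hx hxq
      rw [ho]
      rcases Finset.mem_insert.1 hx with rfl | hx
      · refine le_trans ?_ le_add_self
        rw [nsmul_eq_mul]
        calc (e : ℕ∞) = e * 1 := (mul_one _).symm
          _ ≤ _ := by gcongr; exact hG1 hxq
      · exact (hFW x hx hxq).trans le_self_add

/-- Away from `p`, monomial forms of large degree have arbitrary residues modulo a fixed form. -/
theorem exists_form_add_mul {a : CoeffSpace n d} (ha : a ∈ morphismSpace n d)
    (hinj : Function.Injective (toProj a ha)) {p : OnePoint ℂ}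
    (hsmooth : ∀ q ≠ p, valueSemigroup a q = Set.univ) {e : ℕ} {D : ℂ[X]} (hD : D ∈ formSpace e)
    (hD0 : D ≠ 0) : ∃ N₀, ∀ N, N₀ ≤ N → e ≤ N * d → ∀ F ∈ formSpace (N * d),
      ordAt e p D ≤ ordAt (N * d) p F →
      ∃ G ∈ monomialSpan a N, ∃ H ∈ formSpace (N * d - e), F = G + D * H := by
  classical
  set Z := (finite_setOf_ordAt_ne_zero hD hD0).toFinset with hZ
  -- The point `p` is included so that the corrections made at the other zeros of `D` vanish to
  -- order `e` at `p`, where nothing but the hypothesis on `F` is available.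
  set W := insert p Z with hW
  refine ⟨W.card * e + e, fun N hN heN F hF hFp => ?_⟩
  have hkill : ∀ q ∈ Z.erase p, ∃ G ∈ monomialSpan a N, (e : ℕ∞) ≤ ordAt (N * d) q (F - G) ∧
      ∀ q' ∈ W, q' ≠ q → (e : ℕ∞) ≤ ordAt (N * d) q' G := by
    intro q hq
    have hqp : q ≠ p := (Finset.mem_erase.1 hq).1
    have hstep : ∀ i ≤ e, ∃ G ∈ monomialSpan a N, (i : ℕ∞) ≤ ordAt (N * d) q (F - G) ∧
        ∀ q' ∈ W, q' ≠ q → (e : ℕ∞) ≤ ordAt (N * d) q' G := by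
      intro i
      induction i with
      | zero => exact fun _ => ⟨0, zero_mem _, by simp, fun q' _ _ => by simp [ordAt]⟩
      | succ i ih =>
        intro hi
        obtain ⟨G, hG, h1, h2⟩ := ih (by omega)
        obtain ⟨E, hE, hEi, hEW⟩ := exists_form_killing ha hinj W e (hsmooth q hqp) hN
          (show i ≤ e by omega)
        obtain ⟨c, hc⟩ := exists_smul_sub_ordAt h1 hEi
        refine ⟨G + c • E, add_mem hG (Submodule.smul_mem _ _ hE), ?_, fun q' hq' hne =>
          le_ordAt_add (h2 q' hq' hne) (le_ordAt_smul _ (hEW q' hq' hne))⟩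
        rwa [← sub_sub]
    exact hstep e le_rfl
  choose! G hG hG1 hG2 using hkill
  have hGsum : ∑ q ∈ Z.erase p, G q ∈ monomialSpan a N := Submodule.sum_mem _ hG
  have heq : e + (N * d - e) = N * d := by omega
  -- After all corrections the difference vanishes everywhere at least as much as `D`, hence is
  -- divisible by it.
  obtain ⟨H, hH, hFH⟩ := exists_eq_mul_of_ordAt_le (e' := N * d - e) hD hD0
    (F := F - ∑ q ∈ Z.erase p, G q)
    (by rw [heq]; exact sub_mem hF (monomialSpan_le _ _ hGsum)) (fun q => by
      rw [heq]
      by_cases hqp : q = p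
      · subst hqp
        refine le_ordAt_sub hFp ((ordAt_le hD hD0).trans (le_ordAt_sum _ fun q' hq' => ?_))
        exact hG2 q' hq' q (by simp [hW]) (Finset.mem_erase.1 hq').1.symm
      · by_cases hq0 : ordAt e q D = 0
        · rw [hq0]; exact zero_le
        · have hqZ : q ∈ Z.erase p := by simp [hZ, hqp, hq0]
          refine (ordAt_le hD hD0).trans ?_
          rw [← Finset.add_sum_erase _ _ hqZ, ← sub_sub]
          refine le_ordAt_sub (hG1 q hqZ) (le_ordAt_sum _ fun q' hq' => ?_)
          have hq'' := Finset.mem_erase.1 hq'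
          exact hG2 q' hq''.2 q (by simp [hW, hZ, hq0]) hq''.1.symm)
  exact ⟨_, hGsum, H, hH, by rw [← hFH]; ring⟩


/-- The codimension of the monomial forms is bounded, and some monomial form multiplies all forms into
monomial forms. -/
theorem exists_conductor {a : CoeffSpace n d} (ha : a ∈ morphismSpace n d) (hd : 0 < d)
    (hinj : Function.Injective (toProj a ha)) {p : OnePoint ℂ}
    (hsmooth : ∀ q ≠ p, valueSemigroup a q = Set.univ) :
    ∃ M, ∃ D ∈ monomialSpan a M, D ≠ 0 ∧ ∃ N₀, ∀ N, N₀ ≤ N → ∀ F ∈ formSpace (N * d),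
      D * F ∈ monomialSpan a (M + N) := by
  obtain ⟨L, hL, hL0⟩ := exists_form_ordAt_zero (ha.2 p)
  have hLne : L ≠ 0 := by
    rintro rfl
    simp [ordAt] at hL0
  obtain ⟨N₁, hN₁⟩ := exists_form_add_mul ha hinj hsmooth (mem_formSpace_of_mem_one hL) hLne
  -- Repeated division by `L`, which does not vanish at `p`, leaves a remainder in the fixed degree
  -- `N₁ * d`. So the codimension of the monomial forms is at most `c`, independently of `j`.
  have hsurj : ∀ j, ∀ F ∈ formSpace ((N₁ + j) * d), ∃ G ∈ monomialSpan a (N₁ + j),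
      ∃ H ∈ formSpace (N₁ * d), F = G + L ^ j * H := by
    intro j
    induction j with
    | zero => exact fun F hF => ⟨0, zero_mem _, F, hF, by simp⟩
    | succ j ih =>
      intro F hF
      have hdle : d ≤ (N₁ + (j + 1)) * d := Nat.le_mul_of_pos_left d (by omega)
      obtain ⟨G, hG, H, hH, rfl⟩ := hN₁ (N₁ + (j + 1)) (by omega) hdle F hF (by rw [hL0]; exact zero_le)
      rw [show (N₁ + (j + 1)) * d - d = (N₁ + j) * d by
        rw [← add_assoc, add_mul _ 1, one_mul, Nat.add_sub_cancel]] at hH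
      obtain ⟨G', hG', H', hH', rfl⟩ := ih H hH
      refine ⟨G + L * G', add_mem hG ?_, H', hH', by ring⟩
      have := mul_mem_monomialSpan hL hG'
      rwa [show 1 + (N₁ + j) = N₁ + (j + 1) by omega] at this
  set c := N₁ * d + 1 with hc
  have hdim : ∀ j, (N₁ + j) * d + 1 ≤ Module.finrank ℂ (monomialSpan a (N₁ + j)) + c := by
    intro j
    have hle : formSpace ((N₁ + j) * d) ≤ monomialSpan a (N₁ + j) ⊔
        (formSpace (N₁ * d)).map (LinearMap.mulLeft ℂ (L ^ j)) := by
      intro F hF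
      obtain ⟨G, hG, H, hH, rfl⟩ := hsurj j F hF
      exact Submodule.add_mem_sup hG ⟨H, hH, rfl⟩
    have h1 := Submodule.finrank_mono hle
    have h2 := Submodule.finrank_add_le_finrank_add_finrank (monomialSpan a (N₁ + j))
      ((formSpace (N₁ * d)).map (LinearMap.mulLeft ℂ (L ^ j)))
    have h3 := Submodule.finrank_map_le (LinearMap.mulLeft ℂ (L ^ j)) (formSpace (N₁ * d))
    rw [finrank_formSpace] at h1 h3
    omega
  -- Multiplication by the `c` powers of `X` that span the forms of degree `N₁ * d` maps
  -- `monomialSpan a M` to a product of `c` quotients of dimension at most `c`. A source of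
  -- dimension greater than `c * c` has an element `D` in the kernel.
  obtain ⟨j, hj⟩ : ∃ j, c * c + c < (N₁ + j) * d + 1 :=
    ⟨c * c + c, by nlinarith⟩
  set M := N₁ + j with hM
  set T' := formSpace ((M + N₁) * d)
  set S' := (monomialSpan a (M + N₁)).comap T'.subtype with hS'
  have hmulmem : ∀ (D : monomialSpan a M) (i : Fin c), (D : ℂ[X]) * X ^ (i : ℕ) ∈ T' := by
    intro D i
    have h2 : (X : ℂ[X]) ^ (i : ℕ) ∈ formSpace (N₁ * d) := by
      rw [mem_formSpace, natDegree_X_pow]; omega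
    have := mul_mem_formSpace (monomialSpan_le _ _ D.2) h2
    rwa [← add_mul] at this
  let mulX : Fin c → monomialSpan a M →ₗ[ℂ] T' := fun i =>
    ((LinearMap.mulRight ℂ ((X : ℂ[X]) ^ (i : ℕ))).comp (monomialSpan a M).subtype).codRestrict T'
      (fun D => hmulmem D i)
  let Φ : monomialSpan a M →ₗ[ℂ] (Fin c → T' ⧸ S') := LinearMap.pi fun i => S'.mkQ.comp (mulX i)
  have hquot : Module.finrank ℂ (T' ⧸ S') ≤ c := by
    have h1 := Submodule.finrank_quotient_add_finrank S'
    have h2 : Module.finrank ℂ S' = Module.finrank ℂ (monomialSpan a (M + N₁)) :=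
      (Submodule.comapSubtypeEquivOfLe (monomialSpan_le a (M + N₁))).finrank_eq
    have h3 := hdim (j + N₁)
    rw [show N₁ + (j + N₁) = M + N₁ by omega] at h3
    rw [h2, finrank_formSpace] at h1
    omega
  have hker : LinearMap.ker Φ ≠ ⊥ := by
    apply LinearMap.ker_ne_bot_of_finrank_lt
    rw [Module.finrank_pi_fintype, Finset.sum_const, Finset.card_univ, Fintype.card_fin, smul_eq_mul]
    have h1 := hdim j
    rw [← hM] at h1
    have h2 : c * Module.finrank ℂ (T' ⧸ S') ≤ c * c := Nat.mul_le_mul_left _ hquot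
    omega
  obtain ⟨D, hDker, hD0⟩ := Submodule.exists_mem_ne_zero_of_ne_bot hker
  have hDX : ∀ i : Fin c, (D : ℂ[X]) * X ^ (i : ℕ) ∈ monomialSpan a (M + N₁) := by
    intro i
    have := congrFun (LinearMap.mem_ker.1 hDker) i
    have h2 : S'.mkQ (mulX i D) = 0 := this
    rw [Submodule.mkQ_apply, Submodule.Quotient.mk_eq_zero] at h2
    exact h2
  have hDF : ∀ F ∈ formSpace (N₁ * d), (D : ℂ[X]) * F ∈ monomialSpan a (M + N₁) := by
    intro F hF
    rw [formSpace_eq_sum hF, Finset.mul_sum]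
    refine Submodule.sum_mem _ fun i hi => ?_
    rw [mul_smul_comm]
    exact Submodule.smul_mem _ _ (hDX ⟨i, Finset.mem_range.1 hi⟩)
  -- Larger degrees follow from degree `N₁ * d` by `hsurj`.
  refine ⟨M, D, D.2, by simpa using hD0, N₁, fun N hN F hF => ?_⟩
  obtain ⟨k, rfl⟩ := Nat.exists_eq_add_of_le hN
  obtain ⟨G, hG, H, hH, rfl⟩ := hsurj k F hF
  rw [mul_add]
  refine add_mem (mul_mem_monomialSpan D.2 hG) ?_
  have h1 : L ^ k ∈ monomialSpan a k := by simpa using pow_mem_monomialSpan hL k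
  have := mul_mem_monomialSpan (hDF H hH) h1
  rw [add_assoc] at this
  convert this using 1
  ring

/-- Let `D` be a conductor, of order `r` at `p`. The orders below `r` are finitely many and are
reached one by one, then moved to a common degree by powers of a form not vanishing at `p`. An
arbitrary form `F` of order at least `r` can be written as `G + D * H`, and both summands are
monomial forms. -/
theorem isHyperellipticAt_of_isUnicuspidalAt {g : ℕ} {a : CoeffSpace n d} {p : OnePoint ℂ}
    (h : IsUnicuspidalAt g (hyperellipticSemigroup g) a p) : IsHyperellipticAt g a p := by
  obtain ⟨⟨ha, hinj⟩, hS, -, hsmooth⟩ := h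
  have hmem : ∀ m : ℕ, (Even m ∨ 2 * g ≤ m) ↔ ∃ M, ∃ F ∈ monomialSpan a M, ordAt (M * d) p F = m := by
    intro m
    rw [← mem_valueSemigroup (ha.2 p), hS, SetLike.mem_coe, mem_hyperellipticSemigroup]
  have hd : 0 < d := by
    rcases Nat.eq_zero_or_pos d with rfl | hd
    · exfalso
      obtain ⟨M, F, hF, h2⟩ := (hmem 2).1 (Or.inl even_two)
      have hF0 : F ≠ 0 := by
        rintro rfl
        rw [ordAt, map_zero, PowerSeries.order_zero] at h2
        exact absurd h2 (by simp)
      have := ordAt_le (p := p) (monomialSpan_le _ _ hF) hF0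
      rw [h2, mul_zero] at this
      exact absurd this (by norm_num)
    · exact hd
  refine ⟨fun M F hF s hs => (hmem s).2 ⟨M, F, hF, hs⟩, ?_⟩
  obtain ⟨L, hL, hL0⟩ := exists_form_ordAt_zero (ha.2 p)
  obtain ⟨M, D, hD, hD0, N₀, hDF⟩ := exists_conductor ha hd hinj hsmooth
  obtain ⟨N₁, hN₁⟩ := exists_form_add_mul ha hinj hsmooth (monomialSpan_le _ _ hD) hD0
  obtain ⟨r, -, hr⟩ := exists_ordAt_eq (p := p) (monomialSpan_le _ _ hD) hD0
  have hsmall : ∀ s : ℕ, ∃ K, (Even s ∨ 2 * g ≤ s) → ∃ F ∈ monomialSpan a K, ordAt (K * d) p F = s := by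
    intro s
    by_cases hs : Even s ∨ 2 * g ≤ s
    · obtain ⟨K, hK⟩ := (hmem s).1 hs
      exact ⟨K, fun _ => hK⟩
    · exact ⟨0, fun h => absurd h hs⟩
  choose K hK using hsmall
  -- Above both thresholds, with room for `D` and for the bound on `N * d`, and at least each `K s`
  -- with `s < r`.
  set N := (N₁ + (N₀ + M) + (2 * g + 2)) + ∑ s ∈ Finset.range r, K s with hN
  have hNK : ∀ s < r, K s ≤ N := fun s hs =>
    (Finset.single_le_sum (f := K) (fun _ _ => Nat.zero_le _) (Finset.mem_range.2 hs)).trans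
      (Nat.le_add_left _ _)
  refine ⟨N, ?_, fun s hs hsS => ?_⟩
  · calc 2 * g + 2 ≤ N := by omega
      _ ≤ N * d := Nat.le_mul_of_pos_right _ hd
  by_cases hsr : s < r
  · obtain ⟨F, hF, hFs⟩ := hK s hsS
    have h1 : L ^ (N - K s) ∈ monomialSpan a (N - K s) := by
      simpa using pow_mem_monomialSpan hL (N - K s)
    have hNs := hNK s hsr
    have e : K s + (N - K s) = N := by omega
    have e1 : ordAt ((N - K s) * d) p (L ^ (N - K s)) = (0 : ℕ) := by
      rw [ordAt_pow (mem_formSpace_of_mem_one hL), hL0]; simp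
    refine ⟨F * L ^ (N - K s), ?_, ?_⟩
    · have := mul_mem_monomialSpan hF h1
      rwa [e] at this
    · have := ordAt_add_order hF h1 hFs e1
      rwa [e, add_zero] at this
  · obtain ⟨F, hF, hFs⟩ := exists_form_ordAt hs p
    refine ⟨F, ?_, hFs⟩
    obtain ⟨G, hG, H, hH, rfl⟩ := hN₁ N (by omega) (Nat.mul_le_mul_right _ (by omega)) F hF (by
      rw [hr, hFs]; exact_mod_cast not_lt.1 hsr)
    refine add_mem hG ?_
    rw [← Nat.sub_mul] at hH
    have := hDF (N - M) (by omega) H hH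
    rwa [show M + (N - M) = N by omega] at this


/-! ### Counting vanishing orders -/

/-- If `s` were not attained, the coefficients at the other elements of `O` would determine every
element of `W`, and the dimension would be less than the cardinality of `O`. -/
theorem exists_ordAt_eq_of_card_le {W : Submodule ℂ ℂ[X]} {e : ℕ} (hW : W ≤ formSpace e)
    {p : OnePoint ℂ} {O : Finset ℕ} (hO : ∀ F ∈ W, ∀ s : ℕ, ordAt e p F = s → s ∈ O)
    (hcard : O.card ≤ Module.finrank ℂ W) {s : ℕ} (hs : s ∈ O) : ∃ F ∈ W, ordAt e p F = s := by
  classical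
  by_contra hno
  push Not at hno
  have : FiniteDimensional ℂ W := Submodule.finiteDimensional_of_le hW
  let φ : W →ₗ[ℂ] ({r // r ∈ O.erase s} → ℂ) := LinearMap.pi fun r =>
    (PowerSeries.coeff (r : ℕ)).comp ((expansion e p).comp W.subtype)
  have hφ : Function.Injective φ := by
    rw [← LinearMap.ker_eq_bot, Submodule.eq_bot_iff]
    intro F hF
    by_contra hF0
    have hF0' : (F : ℂ[X]) ≠ 0 := fun h => hF0 (Subtype.ext h)
    obtain ⟨m, -, hm⟩ := exists_ordAt_eq (p := p) (hW F.2) hF0'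
    have hmO : m ∈ O.erase s :=
      Finset.mem_erase.2 ⟨fun h => hno F F.2 (h ▸ hm), hO F F.2 m hm⟩
    have h1 : PowerSeries.coeff m (expansion e p (F : ℂ[X])) = 0 :=
      congrFun (LinearMap.mem_ker.1 hF) ⟨m, hmO⟩
    exact (PowerSeries.order_eq_nat.1 hm).1 h1
  have h1 := LinearMap.finrank_le_finrank_of_injective hφ
  rw [Module.finrank_fintype_fun_eq_card, Fintype.card_coe] at h1
  have := Finset.card_erase_lt_of_mem hs
  omega

theorem linearIndependent_of_strictMono_ordAt {m e : ℕ} {p : OnePoint ℂ} {k : Fin m → ℕ}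
    (hk : StrictMono k) {F : Fin m → ℂ[X]} (hF : ∀ i, ordAt e p (F i) = k i) :
    LinearIndependent ℂ F := by
  rw [Fintype.linearIndependent_iff]
  intro c hc
  by_contra! hne
  obtain ⟨i, hi, hmin⟩ := exists_minimal_of_wellFoundedLT (fun i => c i ≠ 0) hne
  have h1 := congrArg (fun G => PowerSeries.coeff (k i) (expansion e p G)) hc
  simp only [map_sum, map_smul, map_zero] at h1
  rw [Finset.sum_eq_single i] at h1
  · exact (mul_ne_zero hi (PowerSeries.order_eq_nat.1 (hF i)).1) h1
  · intro j _ hj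
    by_cases hcj : c j = 0
    · simp [hcj]
    · rw [PowerSeries.coeff_of_lt_order, smul_zero]
      change _ < ordAt e p (F j)
      rw [hF j]
      have hij : i < j := lt_of_le_of_ne (not_lt.1 fun h => absurd (hmin hcj h.le) (not_le.2 h)) hj.symm
      exact_mod_cast hk hij
  · simp

theorem card_le_finrank_of_strictMono_ordAt {W : Submodule ℂ ℂ[X]} {e : ℕ} (hW : W ≤ formSpace e)
    {p : OnePoint ℂ} {m : ℕ} {k : Fin m → ℕ} (hk : StrictMono k)
    (h : ∀ i, ∃ F ∈ W, ordAt e p F = k i) : m ≤ Module.finrank ℂ W := by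
  have : FiniteDimensional ℂ W := Submodule.finiteDimensional_of_le hW
  choose F hF hFk using h
  have hli := linearIndependent_of_strictMono_ordAt hk hFk
  have hli' : LinearIndependent ℂ (fun i => (⟨F i, hF i⟩ : W)) :=
    LinearIndependent.of_comp W.subtype hli
  simpa using hli'.fintype_card_le_finrank

theorem card_filter_semigroup {g E : ℕ} (hE : 2 * g ≤ E + 1) :
    ((Finset.range (E + 1)).filter (fun s => Even s ∨ 2 * g ≤ s)).card = E + 1 - g := by
  have h1 := Finset.card_filter_add_card_filter_not (s := Finset.range (E + 1))
    (fun s => Even s ∨ 2 * g ≤ s)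
  have h2 : (Finset.range (E + 1)).filter (fun s => ¬ (Even s ∨ 2 * g ≤ s)) =
      (Finset.range g).image (fun k => 2 * k + 1) := by
    ext m
    simp only [Finset.mem_filter, Finset.mem_range, Finset.mem_image]
    constructor
    · rintro ⟨-, h⟩
      push Not at h
      obtain ⟨k, hk⟩ := Nat.not_even_iff_odd.1 h.1
      exact ⟨k, by omega, hk.symm⟩
    · rintro ⟨k, hk, rfl⟩
      refine ⟨by omega, ?_⟩
      push Not
      exact ⟨by simp, by omega⟩
  rw [h2, Finset.card_image_of_injective _ (fun a b h => by simpa using h), Finset.card_range,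
    Finset.card_range] at h1
  omega

/-- There are exactly `N * d + 1 - g` admissible orders up to `N * d`, so a space of that dimension
attains them all. This turns the existence condition into a rank condition, which is open. -/
theorem isHyperellipticAt_of_le_finrank {g : ℕ} {a : CoeffSpace n d} {p : OnePoint ℂ}
    (hmem : ∀ M, ∀ F ∈ monomialSpan a M, ∀ s : ℕ, ordAt (M * d) p F = s → Even s ∨ 2 * g ≤ s)
    {N : ℕ} (hN : 2 * g + 2 ≤ N * d) (hfin : N * d + 1 - g ≤ Module.finrank ℂ (monomialSpan a N)) :
    IsHyperellipticAt g a p := by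
  refine ⟨hmem, N, hN, fun s hs hsS => ?_⟩
  refine exists_ordAt_eq_of_card_le (monomialSpan_le a N)
    (O := (Finset.range (N * d + 1)).filter (fun s => Even s ∨ 2 * g ≤ s)) ?_ ?_ ?_
  · intro F hF s hs
    have hF0 : F ≠ 0 := by
      rintro rfl
      rw [ordAt, map_zero, PowerSeries.order_zero] at hs
      exact absurd hs (by simp)
    have := ordAt_le (p := p) (monomialSpan_le _ _ hF) hF0
    rw [hs] at this
    have h' : s ≤ N * d := by exact_mod_cast this
    simp only [Finset.mem_filter, Finset.mem_range]
    exact ⟨by omega, hmem N F hF s hs⟩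
  · rwa [card_filter_semigroup (by omega)]
  · simp only [Finset.mem_filter, Finset.mem_range]
    exact ⟨by omega, hsS⟩

theorem IsHyperellipticAt.exists_finrank_ge {g : ℕ} {a : CoeffSpace n d} {p : OnePoint ℂ}
    (h : IsHyperellipticAt g a p) : ∃ N, 2 * g + 2 ≤ N * d ∧
      N * d + 1 - g ≤ Module.finrank ℂ (monomialSpan a N) := by
  obtain ⟨N, hN, hform⟩ := h.exists_form
  refine ⟨N, hN, ?_⟩
  set O := (Finset.range (N * d + 1)).filter (fun s => Even s ∨ 2 * g ≤ s)
  have hcard : O.card = N * d + 1 - g := card_filter_semigroup (by omega)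
  refine card_le_finrank_of_strictMono_ordAt (monomialSpan_le a N)
    (k := O.orderEmbOfFin hcard) (p := p) (OrderEmbedding.strictMono _) fun i => ?_
  obtain ⟨h1, h2⟩ := Finset.mem_filter.1 (O.orderEmbOfFin_mem hcard i)
  exact hform _ (by have := Finset.mem_range.1 h1; omega) h2

/-! ### The rank of the space of monomial forms is lower semicontinuous -/

/-- The generic parameterizing form. -/
def genericRow (n d : ℕ) (i : Fin (n + 1)) : (MvPolynomial (Fin (n + 1) × Fin (d + 1)) ℂ)[X] :=
  ∑ j : Fin (d + 1), C (MvPolynomial.X (i, j)) * X ^ (j : ℕ)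

theorem map_genericRow (a : CoeffSpace n d) (i : Fin (n + 1)) :
    (genericRow n d i).map (MvPolynomial.eval a) = rowPoly a i := by
  simp [genericRow, rowPoly, Polynomial.map_sum]

theorem monomialSpan_eq_span (a : CoeffSpace n d) (N : ℕ) : monomialSpan a N =
    Submodule.span ℂ (Set.range fun w : Fin N → Fin (n + 1) => ∏ k, rowPoly a (w k)) := by
  apply le_antisymm
  · intro F hF
    refine monomialSpan_induction (P := fun N F => F ∈
      Submodule.span ℂ (Set.range fun w : Fin N → Fin (n + 1) => ∏ k, rowPoly a (w k))) ?_ ?_ ?_ hF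
    · intro c
      rw [Algebra.algebraMap_eq_smul_one]
      exact Submodule.smul_mem _ _ (Submodule.subset_span ⟨Fin.elim0, by simp⟩)
    · intro M G hGM H hH hG
      clear hGM
      obtain ⟨c, rfl⟩ := mem_monomialSpan_one.1 hH
      rw [Finset.mul_sum]
      refine Submodule.sum_mem _ fun i _ => ?_
      rw [mul_smul_comm]
      refine Submodule.smul_mem _ _ ?_
      induction hG using Submodule.span_induction with
      | mem x hx =>
        obtain ⟨w, rfl⟩ := hx
        refine Submodule.subset_span ⟨Fin.snoc w i, ?_⟩
        simp [Fin.prod_univ_castSucc]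
      | zero => rw [zero_mul]; exact zero_mem _
      | add x y _ _ hx hy => rw [add_mul]; exact add_mem hx hy
      | smul c x _ hx => rw [smul_mul_assoc]; exact Submodule.smul_mem _ _ hx
    · intro M G _ H _ h1 h2
      exact add_mem h1 h2
  · rw [Submodule.span_le]
    rintro _ ⟨w, rfl⟩
    have h : ∀ N (w : Fin N → Fin (n + 1)), ∏ k, rowPoly a (w k) ∈ monomialSpan a N := by
      intro N
      induction N with
      | zero =>
        intro w
        rw [monomialSpan, pow_zero]
        have : ∏ k, rowPoly a (w k) = 1 := by simp
        rw [this]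
        exact Submodule.one_le.1 le_rfl
      | succ N ih =>
        intro w
        rw [Fin.prod_univ_castSucc]
        exact mul_mem_monomialSpan (ih fun k => w k.castSucc) (rowPoly_mem_monomialSpan a _)
    exact h N w

/-- The condition that the monomial forms of degree `N` span a space of dimension at least `R` is
open. -/
theorem exists_certificate (z : CoeffSpace n d) {N R : ℕ}
    (hR : R ≤ Module.finrank ℂ (monomialSpan z N)) :
    ∃ Q : MvPolynomial (Fin (n + 1) × Fin (d + 1)) ℂ, MvPolynomial.eval z Q ≠ 0 ∧
      ∀ a : CoeffSpace n d, MvPolynomial.eval a Q ≠ 0 → R ≤ Module.finrank ℂ (monomialSpan a N) := by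
  classical
  have hw : ∃ w : Fin R → (Fin N → Fin (n + 1)),
      LinearIndependent ℂ fun i => ∏ k, rowPoly z (w i k) := by
    rw [monomialSpan_eq_span] at hR
    obtain ⟨b, hbsub, hbspan, hbli⟩ := exists_linearIndependent ℂ
      (Set.range fun w : Fin N → Fin (n + 1) => ∏ k, rowPoly z (w k))
    have hfin : b.Finite := (Set.finite_range _).subset hbsub
    have : Fintype b := hfin.fintype
    rw [← hbspan] at hR
    have hcard := finrank_span_set_eq_card hbli
    rw [hcard, Set.toFinset_card] at hR
    obtain ⟨f⟩ : Nonempty (Fin R ↪ b) := Function.Embedding.nonempty_of_card_le (by simpa using hR)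
    have hli := hbli.comp f f.injective
    choose w hw using fun i => hbsub (f i).2
    refine ⟨w, ?_⟩
    have e : (fun i => ∏ k, rowPoly z (w i k)) = Subtype.val ∘ f := funext hw
    rw [e]
    exact hli
  obtain ⟨w, hw⟩ := hw
  have hinj : LinearMap.ker (Fintype.linearCombination ℂ fun i => ∏ k, rowPoly z (w i k)) = ⊥ := by
    rw [LinearMap.ker_eq_bot']
    intro c hc
    ext i
    exact Fintype.linearIndependent_iff.1 hw c (by rwa [Fintype.linearCombination_apply] at hc) i
  -- A left inverse chosen at `z` condenses the linear independence of the selected monomials into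
  -- one determinant, polynomial in the coefficients and equal to 1 at `z`.
  obtain ⟨φ, hφ⟩ := LinearMap.exists_leftInverse_of_injective _ hinj
  set A : Matrix (Fin R) (Fin R) (MvPolynomial (Fin (n + 1) × Fin (d + 1)) ℂ) := Matrix.of fun i j =>
    ∑ m ∈ Finset.range (N * d + 1), MvPolynomial.C (φ (X ^ m) i) *
      (∏ k, genericRow n d (w j k)).coeff m with hA
  have hAeval : ∀ a : CoeffSpace n d, A.map (MvPolynomial.eval a) =
      Matrix.of fun i j => φ (∏ k, rowPoly a (w j k)) i := by
    intro a
    ext i j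
    have hmem : ∏ k, rowPoly a (w j k) ∈ formSpace (N * d) := by
      refine monomialSpan_le a N ?_
      rw [monomialSpan_eq_span]
      exact Submodule.subset_span ⟨w j, rfl⟩
    rw [Matrix.of_apply]
    conv_rhs => rw [formSpace_eq_sum hmem]
    simp only [Matrix.map_apply, hA, Matrix.of_apply, map_sum, map_mul, MvPolynomial.eval_C, map_smul,
      Finset.sum_apply, Pi.smul_apply, smul_eq_mul]
    refine Finset.sum_congr rfl fun m _ => ?_
    have : (∏ k, rowPoly a (w j k)) = (∏ k, genericRow n d (w j k)).map (MvPolynomial.eval a) := by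
      simp [Polynomial.map_prod, map_genericRow]
    rw [this, coeff_map]
    ring
  have hdet : ∀ a : CoeffSpace n d, MvPolynomial.eval a A.det = (A.map (MvPolynomial.eval a)).det :=
    fun a => RingHom.map_det _ _
  refine ⟨A.det, ?_, fun a ha => ?_⟩
  · rw [hdet, hAeval]
    have : (Matrix.of fun i j => φ (∏ k, rowPoly z (w j k)) i) = (1 : Matrix (Fin R) (Fin R) ℂ) := by
      ext i j
      have h1 := congrFun (LinearMap.congr_fun hφ (Pi.single j 1)) i
      simp only [LinearMap.comp_apply, Fintype.linearCombination_apply_single, one_smul,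
        LinearMap.id_apply] at h1
      rw [Matrix.of_apply, h1, Matrix.one_apply, Pi.single_apply]
    rw [this, Matrix.det_one]
    exact one_ne_zero
  · rw [hdet, hAeval] at ha
    have hli : LinearIndependent ℂ fun j => ∏ k, rowPoly a (w j k) := by
      rw [Fintype.linearIndependent_iff]
      intro c hc
      have h1 : Matrix.mulVec (Matrix.of fun i j => φ (∏ k, rowPoly a (w j k)) i) c = 0 := by
        ext i
        have h2 := congrFun (congrArg φ hc) i
        simp only [map_sum, map_smul, Finset.sum_apply, Pi.smul_apply, smul_eq_mul, map_zero, Pi.zero_apply] at h2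
        simp only [Matrix.mulVec, dotProduct, Matrix.of_apply, Pi.zero_apply]
        rw [← h2]
        exact Finset.sum_congr rfl fun j _ => mul_comm _ _
      exact congrFun (Matrix.eq_zero_of_mulVec_eq_zero ha h1)
    have hmem : ∀ j, ∏ k, rowPoly a (w j k) ∈ monomialSpan a N := fun j => by
      rw [monomialSpan_eq_span]
      exact Submodule.subset_span ⟨w j, rfl⟩
    have hli' : LinearIndependent ℂ (fun j => (⟨_, hmem j⟩ : monomialSpan a N)) :=
      LinearIndependent.of_comp (monomialSpan a N).subtype hli
    simpa using hli'.fintype_card_le_finrank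

theorem linearIndependent_iff_finrank {a : CoeffSpace n d} :
    LinearIndependent ℂ (fun (i : Fin (n + 1)) (j : Fin (d + 1)) => a (i, j)) ↔
      n + 1 ≤ Module.finrank ℂ (monomialSpan a 1) := by
  have h1 : LinearIndependent ℂ (fun (i : Fin (n + 1)) (j : Fin (d + 1)) => a (i, j)) ↔
      LinearIndependent ℂ (rowPoly a) := by
    rw [Fintype.linearIndependent_iff, Fintype.linearIndependent_iff]
    refine forall_congr' fun c => ?_
    have : (∑ i, c i • (fun (j : Fin (d + 1)) => a (i, j))) = 0 ↔ ∑ i, c i • rowPoly a i = 0 := by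
      constructor
      · intro h
        rw [formSpace_eq_sum (Submodule.sum_mem _ fun i _ => Submodule.smul_mem _ (c i)
          (rowPoly_mem a i)), Finset.sum_range]
        refine Finset.sum_eq_zero fun j _ => ?_
        have h2 := congrFun h j
        simp only [Finset.sum_apply, Pi.smul_apply, Pi.zero_apply] at h2
        rw [finsetSum_coeff]
        simp only [coeff_smul, rowPoly_coeff]
        rw [h2, zero_smul]
      · intro h
        ext j
        have h2 := congrArg (fun F => F.coeff (j : ℕ)) h
        simp only [finsetSum_coeff, coeff_smul, rowPoly_coeff, coeff_zero] at h2
        simpa using h2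
    rw [this]
  rw [h1, linearIndependent_iff_card_le_finrank_span, Fintype.card_fin, monomialSpan, pow_one]
  rfl


/-! ### Slices: normal forms of unicuspidal curves -/

section ring

variable {R R' : Type*} [CommRing R] [CommRing R']

/-- Truncation of a polynomial. -/
def cut (N : ℕ) (F : R[X]) : R[X] := ∑ m ∈ Finset.range N, monomial m (F.coeff m)

theorem coeff_cut (N : ℕ) (F : R[X]) (m : ℕ) : (cut N F).coeff m = if m < N then F.coeff m else 0 := by
  simp [cut, finsetSum_coeff, coeff_monomial]

theorem map_cut (φ : R →+* R') (N : ℕ) (F : R[X]) : (cut N F).map φ = cut N (F.map φ) := by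
  ext m; rw [coeff_map, coeff_cut, coeff_cut, coeff_map]; split_ifs <;> simp

/-- The elements of a basis, adapted to vanishing orders, of the forms on a curve with a hyperelliptic
cusp: `f u ^ r`, truncated, and then powers of the local parameter. -/
def colPoly (g : ℕ) (f u : R[X]) (r : ℕ) : R[X] :=
  if r < g then cut (2 * g) (f * u ^ r) else X ^ (r + g)

theorem map_colPoly (φ : R →+* R') (g : ℕ) (f u : R[X]) (r : ℕ) :
    (colPoly g f u r).map φ = colPoly g (f.map φ) (u.map φ) r := by
  rw [colPoly, colPoly]; split_ifs
  · rw [map_cut, Polynomial.map_mul, Polynomial.map_pow]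
  · rw [Polynomial.map_pow, map_X]

/-- A linear combination of the adapted basis. -/
def sliceRow (g D : ℕ) (f u : R[X]) (v : ℕ → R) : R[X] :=
  ∑ r ∈ Finset.range D, C (v r) * colPoly g f u r

theorem map_sliceRow (φ : R →+* R') (g D : ℕ) (f u : R[X]) (v : ℕ → R) :
    (sliceRow g D f u v).map φ = sliceRow g D (f.map φ) (u.map φ) (fun r => φ (v r)) := by
  simp [sliceRow, Polynomial.map_sum, map_colPoly]

/-- The part of the adapted basis expansion that involves powers of `u`. -/
def headPoly (g : ℕ) (u : R[X]) (v : ℕ → R) : R[X] := ∑ r ∈ Finset.range g, C (v r) * u ^ r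

theorem map_headPoly (φ : R →+* R') (g : ℕ) (u : R[X]) (v : ℕ → R) :
    (headPoly g u v).map φ = headPoly g (u.map φ) (fun r => φ (v r)) := by
  simp [headPoly, Polynomial.map_sum]

/-- Below t^(2g) the truncation is invisible and the tail columns, powers of t from t^(2g) on, do
not contribute. -/
theorem coeff_sliceRow_of_lt {g D : ℕ} (hD : g ≤ D) (f u : R[X]) (v : ℕ → R) {m : ℕ}
    (hm : m < 2 * g) : (sliceRow g D f u v).coeff m = (f * headPoly g u v).coeff m := by
  rw [sliceRow, headPoly, Finset.mul_sum, finsetSum_coeff, finsetSum_coeff,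
    ← Finset.sum_subset (Finset.range_mono hD)]
  · refine Finset.sum_congr rfl fun r hr => ?_
    rw [coeff_C_mul, colPoly, if_pos (Finset.mem_range.1 hr), coeff_cut, if_pos hm,
      mul_left_comm, coeff_C_mul]
  · intro r _ hr
    rw [Finset.mem_range] at hr
    rw [coeff_C_mul, colPoly, if_neg hr, coeff_X_pow, if_neg (by omega), mul_zero]

theorem coeff_sliceRow_of_ge {g D : ℕ} (f u : R[X]) (v : ℕ → R) {m : ℕ}
    (hm : 2 * g ≤ m) : (sliceRow g D f u v).coeff m = if m - g < D then v (m - g) else 0 := by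
  rw [sliceRow, finsetSum_coeff]
  have : ∀ r ∈ Finset.range D, (C (v r) * colPoly g f u r).coeff m =
      if m - g = r then v r else 0 := by
    intro r _
    rw [coeff_C_mul, colPoly]
    split_ifs with h1 h2 h2
    · omega
    · rw [coeff_cut, if_neg (by omega), mul_zero]
    · rw [coeff_X_pow, if_pos (by omega), mul_one]
    · rw [coeff_X_pow, if_neg (by omega), mul_zero]
  rw [Finset.sum_congr rfl this, Finset.sum_ite_eq]
  simp

theorem sliceRow_add (g D : ℕ) (f u : R[X]) (v w : ℕ → R) :
    sliceRow g D f u (v + w) = sliceRow g D f u v + sliceRow g D f u w := by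
  simp [sliceRow, add_mul, Finset.sum_add_distrib]

theorem sliceRow_smul (g D : ℕ) (f u : R[X]) (c : R) (v : ℕ → R) :
    sliceRow g D f u (c • v) = c • sliceRow g D f u v := by
  simp only [sliceRow, Pi.smul_apply, smul_eq_mul, smul_eq_C_mul, C_mul, Finset.mul_sum, mul_assoc]

theorem sliceRow_sum {ι : Type*} (s : Finset ι) (g D : ℕ) (f u : R[X]) (c : ι → R) (v : ι → ℕ → R) :
    sliceRow g D f u (fun r => ∑ i ∈ s, c i * v i r) = ∑ i ∈ s, c i • sliceRow g D f u (v i) := by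
  simp only [sliceRow, Finset.smul_sum, map_sum, Finset.sum_mul]
  rw [Finset.sum_comm]
  refine Finset.sum_congr rfl fun i _ => Finset.sum_congr rfl fun r _ => ?_
  rw [smul_eq_C_mul, C_mul, mul_assoc]

/-- A local parameter of the cusp: a series of order two, normalized. -/
structure IsCuspParameter (u : R[X]) : Prop where
  coeff_zero : u.coeff 0 = 0
  coeff_one : u.coeff 1 = 0
  coeff_two : u.coeff 2 = 1

theorem IsCuspParameter.exists_eq {u : R[X]} (hu : IsCuspParameter u) :
    ∃ w : R[X], u = X ^ 2 * w ∧ w.coeff 0 = 1 := by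
  obtain ⟨w, rfl⟩ : X ^ 2 ∣ u := X_pow_dvd_iff.2 fun m hm => by
    interval_cases m
    · exact hu.coeff_zero
    · exact hu.coeff_one
  refine ⟨w, rfl, ?_⟩
  have := hu.coeff_two
  rwa [show 2 = 0 + 2 from rfl, mul_comm, coeff_mul_X_pow] at this

theorem IsCuspParameter.map {u : R[X]} (hu : IsCuspParameter u) (φ : R →+* R') :
    IsCuspParameter (u.map φ) :=
  ⟨by simp [hu.coeff_zero], by simp [hu.coeff_one], by simp [hu.coeff_two]⟩

theorem IsCuspParameter.coeff_pow {u : R[X]} (hu : IsCuspParameter u) {r m : ℕ} (h : m ≤ 2 * r) :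
    (u ^ r).coeff m = if m = 2 * r then 1 else 0 := by
  obtain ⟨w, rfl, hw⟩ := hu.exists_eq
  rw [mul_pow, ← pow_mul, mul_comm]
  split_ifs with h'
  · rw [h', coeff_mul_X_pow', if_pos le_rfl, Nat.sub_self, coeff_zero_eq_eval_zero, eval_pow,
      ← coeff_zero_eq_eval_zero, hw, one_pow]
  · rw [coeff_mul_X_pow', if_neg (by omega)]

/-- Since u^r starts with t^(2r), the even coefficients of the head determine the coordinates by a
unitriangular system. -/
theorem IsCuspParameter.coeff_headPoly {u : R[X]} (hu : IsCuspParameter u) {g : ℕ} (v : ℕ → R)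
    {r : ℕ} (hr : r < g) : (headPoly g u v).coeff (2 * r) =
      v r + ∑ r' ∈ Finset.range r, v r' * (u ^ r').coeff (2 * r) := by
  rw [headPoly, finsetSum_coeff, ← Finset.sum_subset (Finset.range_mono (show r + 1 ≤ g from hr)),
    Finset.sum_range_succ, add_comm]
  · simp only [coeff_C_mul]
    rw [hu.coeff_pow le_rfl, if_pos rfl, mul_one]
  · intro r' _ h'
    rw [Finset.mem_range] at h'
    rw [coeff_C_mul, hu.coeff_pow (by omega), if_neg (by omega), mul_zero]

theorem IsCuspParameter.coeff_headPoly_of_lt {u : R[X]} (hu : IsCuspParameter u) {g : ℕ} {v : ℕ → R}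
    {r : ℕ} (hv : ∀ r' < r, v r' = 0) {m : ℕ} (hm : m < 2 * r) : (headPoly g u v).coeff m = 0 := by
  rw [headPoly, finsetSum_coeff]
  refine Finset.sum_eq_zero fun r' _ => ?_
  by_cases h : r' < r
  · simp [hv r' h]
  · rw [coeff_C_mul, hu.coeff_pow (by omega), if_neg (by omega), mul_zero]

end ring

/-- The vanishing order of the `r`-th element of the adapted basis. -/
def colOrder (g r : ℕ) : ℕ := if r < g then 2 * r else r + g

theorem colOrder_strictMono (g : ℕ) : StrictMono (colOrder g) := by
  intro r s h
  simp only [colOrder]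
  split_ifs <;> omega

/-- The columns have strictly increasing orders, so the first nonzero coordinate determines the
order of the row. The leading coefficient of a column is f(0) in the head and 1 in the tail. -/
theorem coeff_sliceRow_colOrder {R : Type*} [CommRing R] {g D : ℕ} (hD : g ≤ D) {f u : R[X]}
    (hu : IsCuspParameter u) {v : ℕ → R} {r : ℕ} (hr : r < D) (hv : ∀ r' < r, v r' = 0) :
    (∀ m < colOrder g r, (sliceRow g D f u v).coeff m = 0) ∧
    (sliceRow g D f u v).coeff (colOrder g r) = (if r < g then f.coeff 0 else 1) * v r := by
  have hlow : ∀ m, m < 2 * g → m < 2 * r → (sliceRow g D f u v).coeff m = 0 := by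
    intro m hm hmr
    rw [coeff_sliceRow_of_lt hD _ _ _ hm, coeff_mul]
    refine Finset.sum_eq_zero fun x hx => ?_
    rw [Finset.HasAntidiagonal.mem_antidiagonal] at hx
    rw [hu.coeff_headPoly_of_lt hv (by omega), mul_zero]
  by_cases hrg : r < g
  · simp only [colOrder, if_pos hrg]
    refine ⟨fun m hm => hlow m (by omega) hm, ?_⟩
    rw [coeff_sliceRow_of_lt hD _ _ _ (by omega), coeff_mul,
      Finset.sum_eq_single (0, 2 * r)]
    · rw [hu.coeff_headPoly v hrg, Finset.sum_eq_zero, add_zero]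
      intro r' hr'
      rw [hv r' (Finset.mem_range.1 hr'), zero_mul]
    · intro x hx hne
      rw [Finset.HasAntidiagonal.mem_antidiagonal] at hx
      rw [hu.coeff_headPoly_of_lt hv, mul_zero]
      have : x.1 ≠ 0 := fun h0 => hne (Prod.ext h0 (by simp; omega))
      omega
    · simp
  · simp only [colOrder, if_neg hrg]
    refine ⟨fun m hm => ?_, ?_⟩
    · by_cases hm2 : m < 2 * g
      · exact hlow m hm2 (by omega)
      · rw [coeff_sliceRow_of_ge _ _ _ (by omega), hv _ (by omega)]; simp
    · rw [coeff_sliceRow_of_ge _ _ _ (by omega), Nat.add_sub_cancel, if_pos hr, one_mul]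

/-! ### Expansions at a finite point -/

theorem expansion_coe {e : ℕ} {F : ℂ[X]} (hF : F ∈ formSpace e) (s : ℂ) :
    expansion e (s : OnePoint ℂ) F = ((taylor s F : ℂ[X]) : PowerSeries ℂ) := by
  rw [expansion_apply, localCoords_coe]
  conv_rhs => rw [formSpace_eq_sum hF]
  simp only [map_sum, map_smul, taylor_X_pow, Matrix.cons_val_zero, Matrix.cons_val_one, one_pow,
    mul_one]
  rw [← Polynomial.coeToPowerSeries.ringHom_apply, map_sum]
  refine Finset.sum_congr rfl fun j _ => ?_
  rw [smul_eq_C_mul, PowerSeries.smul_eq_C_mul]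
  simp [add_comm]

theorem ordAt_coe_eq_iff {e : ℕ} {F : ℂ[X]} (hF : F ∈ formSpace e) {s : ℂ} {m : ℕ} :
    ordAt e (s : OnePoint ℂ) F = m ↔
      (taylor s F).coeff m ≠ 0 ∧ ∀ i < m, (taylor s F).coeff i = 0 := by
  rw [ordAt, expansion_coe hF, PowerSeries.order_eq_nat]
  simp

theorem le_ordAt_coe_iff {e : ℕ} {F : ℂ[X]} (hF : F ∈ formSpace e) {s : ℂ} {m : ℕ} :
    (m : ℕ∞) ≤ ordAt e (s : OnePoint ℂ) F ↔ ∀ i < m, (taylor s F).coeff i = 0 := by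
  rw [ordAt, expansion_coe hF]
  constructor
  · intro h i hi
    have := PowerSeries.coeff_of_lt_order i (lt_of_lt_of_le (by exact_mod_cast hi) h)
    simpa using this
  · intro h
    exact PowerSeries.nat_le_order _ _ fun i hi => by simpa using h i hi

/-- The vanishing orders of the monomial forms of a curve given by a slice are in the hyperelliptic
semigroup. -/
theorem mem_semigroup_of_slice {g D : ℕ} (hD : g ≤ D) {a : CoeffSpace n d} {s : ℂ} {f u : ℂ[X]}
    (hf : f.coeff 0 ≠ 0) (hu : IsCuspParameter u) {v : Fin (n + 1) → ℕ → ℂ}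
    (hrow : ∀ i, taylor s (rowPoly a i) = sliceRow g D f u (v i)) (M : ℕ) (F : ℂ[X])
    (hF : F ∈ monomialSpan a M) (m : ℕ) (hm : ordAt (M * d) (s : OnePoint ℂ) F = m) :
    Even m ∨ 2 * g ≤ m := by
  -- Modulo t^(2g) a monomial form of degree `M` is f^M times a polynomial in u. As f is a unit and
  -- u has order 2, an order below 2g is twice the order of `P` at zero.
  have key : ∃ P : ℂ[X], X ^ (2 * g) ∣ taylor s F - f ^ M * P.comp u := by
    refine monomialSpan_induction
      (P := fun M F => ∃ P : ℂ[X], X ^ (2 * g) ∣ taylor s F - f ^ M * P.comp u) ?_ ?_ ?_ hF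
    · intro c
      refine ⟨C c, ?_⟩
      simp
    · rintro M G _ H hH ⟨P, hP⟩
      obtain ⟨c, rfl⟩ := mem_monomialSpan_one.1 hH
      have hlin : X ^ (2 * g) ∣ taylor s (∑ i, c i • rowPoly a i) -
          f * (∑ i, c i • ∑ r ∈ Finset.range g, C (v i r) * X ^ r : ℂ[X]).comp u := by
        rw [map_sum, sum_comp, Finset.mul_sum, ← Finset.sum_sub_distrib]
        refine Finset.dvd_sum fun i _ => ?_
        rw [map_smul, smul_comp, mul_smul_comm, ← smul_sub, smul_eq_C_mul]
        refine Dvd.dvd.mul_left (X_pow_dvd_iff.2 fun m hm => ?_) _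
        rw [coeff_sub, hrow, coeff_sliceRow_of_lt hD _ _ _ hm, headPoly, sub_eq_zero]
        congr 2
        rw [sum_comp]
        simp
      refine ⟨P * ∑ i, c i • ∑ r ∈ Finset.range g, C (v i r) * X ^ r, ?_⟩
      set H := ∑ i, c i • rowPoly a i
      set T := (∑ i, c i • ∑ r ∈ Finset.range g, C (v i r) * X ^ r : ℂ[X])
      have e : taylor s (G * H) - f ^ (M + 1) * (P * T).comp u =
          (taylor s G - f ^ M * P.comp u) * taylor s H +
            f ^ M * P.comp u * (taylor s H - f * T.comp u) := by
        rw [taylor_mul, mul_comp]; ring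
      rw [e]
      exact dvd_add (Dvd.dvd.mul_right hP _) (Dvd.dvd.mul_left hlin _)
    · rintro M G _ H _ ⟨P, hP⟩ ⟨Q, hQ⟩
      refine ⟨P + Q, ?_⟩
      rw [map_add, add_comp, mul_add, add_sub_add_comm]
      exact dvd_add hP hQ
  obtain ⟨P, hP⟩ := key
  rw [or_iff_not_imp_right]
  intro hmg
  have hm' := (ordAt_coe_eq_iff (monomialSpan_le _ _ hF)).1 hm
  have hco : ∀ i < 2 * g, (taylor s F).coeff i = (f ^ M * P.comp u).coeff i := fun i hi => by
    have := X_pow_dvd_iff.1 hP i hi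
    rwa [coeff_sub, sub_eq_zero] at this
  have hP0 : P ≠ 0 := by
    rintro rfl
    refine hm'.1 ?_
    rw [hco m (by omega)]; simp
  obtain ⟨w, hw, hw0⟩ := hu.exists_eq
  obtain ⟨Q, hPQ, hQ⟩ := exists_eq_pow_rootMultiplicity_mul_and_not_dvd P hP0 0
  rw [C_0, sub_zero] at hPQ hQ
  set k := rootMultiplicity 0 P
  rw [X_dvd_iff] at hQ
  have hfac : f ^ M * P.comp u = (f ^ M * w ^ k * Q.comp u) * X ^ (2 * k) := by
    conv_lhs => rw [hPQ]
    rw [mul_comp, X_pow_comp]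
    conv_lhs => rw [show u ^ k = X ^ (2 * k) * w ^ k by rw [hw, mul_pow, ← pow_mul]]
    ring
  have hc0 : (f ^ M * w ^ k * Q.comp u).coeff 0 ≠ 0 := by
    rw [coeff_zero_eq_eval_zero, eval_mul, eval_mul, eval_pow, eval_pow, eval_comp,
      ← coeff_zero_eq_eval_zero, ← coeff_zero_eq_eval_zero, ← coeff_zero_eq_eval_zero,
      hu.coeff_zero, hw0, ← coeff_zero_eq_eval_zero]
    simp [hf, hQ]
  have h2k : m = 2 * k := by
    rcases lt_trichotomy m (2 * k) with h | h | h
    · exfalso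
      apply hm'.1
      rw [hco m (by omega), hfac, coeff_mul_X_pow', if_neg (by omega)]
    · exact h
    · exfalso
      have := hm'.2 (2 * k) h
      rw [hco _ (by omega), hfac, coeff_mul_X_pow', if_pos le_rfl, Nat.sub_self] at this
      exact hc0 this
  rw [h2k]
  exact even_two_mul k


/-! ### Recovering the parameters of a slice -/

/-- The normalization of the first two rows of a slice. -/
structure IsNormalSlice {R : Type*} [CommRing R] (g : ℕ) (u : R[X]) (v₀ w : ℕ → R) : Prop where
  cusp : IsCuspParameter u
  zero_zero : v₀ 0 = 1
  zero_of_lt : ∀ r, 0 < r → r < g → v₀ r = 0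
  one_zero : w 0 = 0
  one_of_lt : ∀ r, 2 ≤ r → r < g → w r = 0

section

variable {R R' : Type*} [CommRing R] [CommRing R'] {g : ℕ} {u : R[X]} {v₀ w : ℕ → R}

theorem IsNormalSlice.map (h : IsNormalSlice g u v₀ w) (φ : R →+* R') :
    IsNormalSlice g (u.map φ) (fun r => φ (v₀ r)) (fun r => φ (w r)) :=
  ⟨h.cusp.map φ, by simp [h.zero_zero], fun r h1 h2 => by simp [h.zero_of_lt r h1 h2],
    by simp [h.one_zero], fun r h1 h2 => by simp [h.one_of_lt r h1 h2]⟩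

/-- The meaning of the normalization: modulo t^(2g) the first row is f itself, and for `2 ≤ g` the
row `w` is a constant times f u. -/
theorem IsNormalSlice.headPoly_zero (h : IsNormalSlice g u v₀ w) (hg : 0 < g) :
    headPoly g u v₀ = 1 := by
  rw [headPoly, Finset.sum_eq_single 0]
  · simp [h.zero_zero]
  · intro r hr h0
    rw [h.zero_of_lt r (Nat.pos_of_ne_zero h0) (Finset.mem_range.1 hr), C_0, zero_mul]
  · simp [hg.ne']

theorem IsNormalSlice.headPoly_one (h : IsNormalSlice g u v₀ w) (hg : 2 ≤ g) :
    headPoly g u w = C (w 1) * u := by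
  rw [headPoly, Finset.sum_eq_single 1]
  · simp
  · intro r hr h0
    rcases Nat.eq_zero_or_pos r with rfl | h'
    · rw [h.one_zero, C_0, zero_mul]
    · rw [h.one_of_lt r (by omega) (Finset.mem_range.1 hr), C_0, zero_mul]
  · simp; omega

/-- Column 1 has order 2 also for `g = 1`, where it is the power t^2 of the tail rather than f u;
hence the two leading coefficients. -/
theorem IsNormalSlice.coeff_sliceRow_one (h : IsNormalSlice g u v₀ w) {D : ℕ} (hD : g ≤ D)
    (hD1 : 1 < D) (hg : 0 < g) (f : R[X]) :
    (sliceRow g D f u w).coeff 0 = 0 ∧ (sliceRow g D f u w).coeff 1 = 0 ∧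
    (sliceRow g D f u w).coeff 2 = (if 1 < g then f.coeff 0 else 1) * w 1 := by
  have key := coeff_sliceRow_colOrder (f := f) hD h.cusp (v := w) hD1 fun r' hr' => by
    obtain rfl : r' = 0 := by omega
    exact h.one_zero
  have h2 : colOrder g 1 = 2 := by rw [colOrder]; split_ifs <;> omega
  rw [h2] at key
  exact ⟨key.1 0 (by omega), key.1 1 (by omega), key.2⟩

end

section field

variable {L : Type*} [Field L]

theorem exists_map_subtype {K : Subfield L} {F : L[X]} (h : ∀ j, F.coeff j ∈ K) :
    ∃ F' : K[X], F'.map K.subtype = F := by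
  have : F ∈ lifts K.subtype := (lifts_iff_coeff_lifts F).2 fun j => ⟨⟨_, h j⟩, rfl⟩
  exact (mem_lifts F).1 this

theorem coeff_taylor_mem {K : Subfield L} {F : L[X]} (h : ∀ j, F.coeff j ∈ K) {p : L} (hp : p ∈ K)
    (j : ℕ) : (taylor p F).coeff j ∈ K := by
  obtain ⟨F', rfl⟩ := exists_map_subtype h
  rw [show p = K.subtype ⟨p, hp⟩ from rfl, ← map_taylor, coeff_map]
  exact SetLike.coe_mem _

theorem coeff_mul_mem {K : Subfield L} {F G : L[X]} {N : ℕ} (hF : ∀ j < N, F.coeff j ∈ K)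
    (hG : ∀ j < N, G.coeff j ∈ K) : ∀ j < N, (F * G).coeff j ∈ K := by
  intro j hj
  rw [coeff_mul]
  refine sum_mem fun x hx => ?_
  rw [Finset.HasAntidiagonal.mem_antidiagonal] at hx
  exact mul_mem (hF _ (by omega)) (hG _ (by omega))

theorem coeff_pow_mem {K : Subfield L} {F : L[X]} {N : ℕ} (hF : ∀ j < N, F.coeff j ∈ K) (r : ℕ) :
    ∀ j < N, (F ^ r).coeff j ∈ K := by
  induction r with
  | zero =>
    intro j _
    rw [pow_zero, coeff_one]; split_ifs
    exacts [one_mem _, zero_mem _]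
  | succ r ih =>
    rw [pow_succ]
    exact coeff_mul_mem ih hF

/-- Division of power series only inverts the constant term. -/
theorem coeff_mem_of_mul {K : Subfield L} {F G : L[X]} {N : ℕ} (hF : ∀ j < N, F.coeff j ∈ K)
    (hF0 : F.coeff 0 ≠ 0) (hFG : ∀ j < N, (F * G).coeff j ∈ K) : ∀ j < N, G.coeff j ∈ K := by
  intro j
  induction j using Nat.strong_induction_on with
  | _ j ih =>
    intro hj
    have h := hFG j hj
    rw [coeff_mul, ← Finset.add_sum_erase _ _ (a := (0, j)) (by simp)] at h
    have h2 : ∑ x ∈ (Finset.HasAntidiagonal.antidiagonal j).erase (0, j), F.coeff x.1 * G.coeff x.2 ∈ K := by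
      refine sum_mem fun x hx => ?_
      rw [Finset.mem_erase, Finset.HasAntidiagonal.mem_antidiagonal] at hx
      have : x.1 ≠ 0 := fun h0 => hx.1 (Prod.ext h0 (by simp; omega))
      exact mul_mem (hF _ (by omega)) (ih _ (by omega) (by omega))
    have h3 := sub_mem h h2
    rw [add_sub_cancel_right] at h3
    have h4 := mul_mem (inv_mem (hF 0 (by omega))) h3
    rwa [inv_mul_cancel_left₀ hF0] at h4

theorem taylor_derivative_comm (p : L) (F : L[X]) :
    taylor p (derivative F) = derivative (taylor p F) := by
  rw [taylor_apply, taylor_apply, derivative_comp]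
  simp

/-- The cusp is a simple zero of the Wronskian of the first two forms. -/
theorem mem_of_wronskian {K : Subfield L} [CharZero L] (hK : ∀ x : L, IsAlgebraic K x → x ∈ K)
    {G₀ H : L[X]} {p c : L} (h0 : G₀.coeff 0 ≠ 0) (hH0 : H.coeff 0 = 0) (hH1 : H.coeff 1 = 0)
    (hH2 : H.coeff 2 ≠ 0) (hG₀ : ∀ j, (taylor (-p) G₀).coeff j ∈ K)
    (hG₁ : ∀ j, (taylor (-p) (c • G₀ + H)).coeff j ∈ K) : p ∈ K := by
  obtain ⟨A, hA⟩ := exists_map_subtype hG₀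
  obtain ⟨B, hB⟩ := exists_map_subtype hG₁
  set W : K[X] := A * derivative B - B * derivative A with hW
  have hmap : W.map K.subtype = taylor (-p) (G₀ * derivative H - H * derivative G₀) := by
    have e1 : (derivative A).map K.subtype = taylor (-p) (derivative G₀) := by
      rw [← derivative_map, hA, taylor_derivative_comm]
    have e2 : (derivative B).map K.subtype = taylor (-p) (derivative (c • G₀ + H)) := by
      rw [← derivative_map, hB, taylor_derivative_comm]
    -- The Wronskian does not see the multiple of `G₀` in the second form, so `c` need not be known
    -- yet.
    have e3 : G₀ * derivative H - H * derivative G₀ =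
        G₀ * derivative (c • G₀ + H) - (c • G₀ + H) * derivative G₀ := by
      rw [derivative_add, derivative_smul, smul_eq_C_mul, smul_eq_C_mul]
      ring
    rw [hW, Polynomial.map_sub, Polynomial.map_mul, Polynomial.map_mul, hA, hB, e1, e2, e3,
      map_sub, taylor_mul, taylor_mul]
  have hc0 : (G₀ * derivative H - H * derivative G₀).coeff 0 = 0 := by
    rw [coeff_sub, mul_coeff_zero, mul_coeff_zero, hH0, coeff_derivative, hH1]; simp
  -- The linear coefficient is twice the product of the leading coefficients of `G₀` and `H`. So `W`
  -- is a nonzero polynomial over `K`, and `p` is one of its roots.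
  have hc1 : (G₀ * derivative H - H * derivative G₀).coeff 1 ≠ 0 := by
    rw [coeff_sub, coeff_mul, coeff_mul, Finset.Nat.antidiagonal_succ]
    simp [coeff_derivative, hH0, hH1]
    exact ⟨h0, hH2⟩
  refine hK p ⟨W, ?_, ?_⟩
  · intro h
    rw [h, Polynomial.map_zero] at hmap
    rw [(taylor_injective (-p)) (hmap.symm.trans (map_zero _).symm)] at hc1
    simp at hc1
  · have : aeval p W = (W.map K.subtype).eval p := by
      rw [aeval_def, eval_map]; rfl
    rw [this, hmap, taylor_eval, add_neg_cancel, ← coeff_zero_eq_eval_zero, hc0]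

/-- Division by f gives the head, whose coordinates solve a unitriangular system; the tail
coordinates are coefficients of the row. -/
theorem slice_coeff_mem {K : Subfield L} {g D : ℕ} (hD : g ≤ D) {f u : L[X]}
    (hu : IsCuspParameter u) (hf : f.coeff 0 ≠ 0) (hfK : ∀ m < 2 * g, f.coeff m ∈ K)
    (huK : ∀ m < 2 * g, u.coeff m ∈ K) {v : ℕ → L}
    (hv : ∀ j, (sliceRow g D f u v).coeff j ∈ K) : ∀ r < D, v r ∈ K := by
  have hhead : ∀ m < 2 * g, (headPoly g u v).coeff m ∈ K :=
    coeff_mem_of_mul hfK hf fun j hj => by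
      rw [← coeff_sliceRow_of_lt hD _ _ _ hj]; exact hv j
  intro r
  induction r using Nat.strong_induction_on with
  | _ r ih =>
    intro hr
    by_cases hrg : r < g
    · have h := hhead (2 * r) (by omega)
      rw [hu.coeff_headPoly v hrg] at h
      have h2 : ∑ r' ∈ Finset.range r, v r' * (u ^ r').coeff (2 * r) ∈ K :=
        sum_mem fun r' hr' => by
          rw [Finset.mem_range] at hr'
          exact mul_mem (ih r' hr' (by omega)) (coeff_pow_mem huK r' _ (by omega))
      simpa using sub_mem h h2
    · have h := hv (r + g)
      rwa [coeff_sliceRow_of_ge _ _ _ (by omega), Nat.add_sub_cancel, if_pos hr] at h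

/-- The order of recovery: the cusp from the Wronskian, f as the first row moved to the cusp, `c`
from the constant term of the second row, then `w 1` and u from what remains of that row, and
finally the coordinates. -/
theorem slice_parameters_mem {K : Subfield L} [CharZero L] (hK : ∀ x : L, IsAlgebraic K x → x ∈ K)
    {g D : ℕ} (hg : 0 < g) (hD : g ≤ D) (hD1 : 1 < D) {f u : L[X]} {v₀ w : ℕ → L} {p c : L}
    (h : IsNormalSlice g u v₀ w) (hf : f.coeff 0 ≠ 0) (hw : w 1 ≠ 0)
    (h0 : ∀ j, (taylor (-p) (sliceRow g D f u v₀)).coeff j ∈ K)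
    (h1 : ∀ j, (taylor (-p) (sliceRow g D f u (c • v₀ + w))).coeff j ∈ K) :
    p ∈ K ∧ (∀ m < 2 * g, f.coeff m ∈ K) ∧ (∀ m < 2 * g, u.coeff m ∈ K) ∧ c ∈ K ∧
      (∀ r < D, v₀ r ∈ K) ∧ ∀ r < D, w r ∈ K := by
  obtain ⟨hw0, hw1, hw2⟩ := h.coeff_sliceRow_one hD hD1 hg f
  have hfs : ∀ m < 2 * g, (sliceRow g D f u v₀).coeff m = f.coeff m := fun m hm => by
    rw [coeff_sliceRow_of_lt hD _ _ _ hm, h.headPoly_zero hg, mul_one]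
  have hp : p ∈ K := by
    rw [sliceRow_add, sliceRow_smul] at h1
    refine mem_of_wronskian hK ?_ hw0 hw1 ?_ h0 h1
    · rwa [hfs 0 (by omega)]
    · rw [hw2]
      refine mul_ne_zero ?_ hw
      split_ifs
      exacts [hf, one_ne_zero]
  have tt : ∀ F : L[X], taylor p (taylor (-p) F) = F := fun F => by
    rw [taylor_taylor, add_neg_cancel, taylor_zero]
  have g0 : ∀ j, (sliceRow g D f u v₀).coeff j ∈ K := fun j => by
    simpa only [tt] using coeff_taylor_mem h0 hp j
  have g1 : ∀ j, (sliceRow g D f u (c • v₀ + w)).coeff j ∈ K := fun j => by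
    simpa only [tt] using coeff_taylor_mem h1 hp j
  have hfK : ∀ m < 2 * g, f.coeff m ∈ K := fun m hm => by rw [← hfs m hm]; exact g0 m
  have hc : c ∈ K := by
    have h3 := g1 0
    rw [sliceRow_add, sliceRow_smul, coeff_add, hw0, add_zero, coeff_smul, smul_eq_mul,
      hfs 0 (by omega)] at h3
    have := mul_mem h3 (inv_mem (hfK 0 (by omega)))
    rwa [mul_inv_cancel_right₀ hf] at this
  have gw : ∀ j, (sliceRow g D f u w).coeff j ∈ K := fun j => by
    have := sub_mem (g1 j) (mul_mem hc (g0 j))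
    rwa [sliceRow_add, sliceRow_smul, coeff_add, coeff_smul, smul_eq_mul, add_sub_cancel_left]
      at this
  have huK : ∀ m < 2 * g, u.coeff m ∈ K := by
    -- For `g = 1` only the coefficients of 1 and t are asked for, and they vanish.
    by_cases hg2 : 2 ≤ g
    · have hw1K : w 1 ∈ K := by
        have h3 := gw 2
        rw [hw2, if_pos (by omega)] at h3
        have := mul_mem (inv_mem (hfK 0 (by omega))) h3
        rwa [inv_mul_cancel_left₀ hf] at this
      have hhead : ∀ m < 2 * g, (headPoly g u w).coeff m ∈ K :=
        coeff_mem_of_mul hfK hf fun j hj => by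
          rw [← coeff_sliceRow_of_lt hD _ _ _ hj]; exact gw j
      intro m hm
      have h3 := hhead m hm
      rw [h.headPoly_one hg2, coeff_C_mul] at h3
      have := mul_mem (inv_mem hw1K) h3
      rwa [inv_mul_cancel_left₀ hw] at this
    · intro m hm
      have : m = 0 ∨ m = 1 := by omega
      rcases this with rfl | rfl
      · rw [h.cusp.coeff_zero]; exact zero_mem _
      · rw [h.cusp.coeff_one]; exact zero_mem _
  exact ⟨hp, hfK, huK, hc, slice_coeff_mem hD h.cusp hf hfK huK g0,
    slice_coeff_mem hD h.cusp hf hfK huK gw⟩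

theorem mulVec_mem {K : Subfield L} {m : ℕ} {A : Matrix (Fin m) (Fin m) L} (hA : A.det ≠ 0)
    (hAK : ∀ i j, A i j ∈ K) {x : Fin m → L} (hx : ∀ i, ∑ j, A i j * x j ∈ K) : ∀ j, x j ∈ K := by
  set A' : Matrix (Fin m) (Fin m) K := Matrix.of fun i j => ⟨A i j, hAK i j⟩
  set y' : Fin m → K := fun i => ⟨_, hx i⟩
  have hAA : A = K.subtype.mapMatrix A' := by ext i j; rfl
  have hy : A.mulVec x = fun i => (y' i : L) := by ext i; rfl
  intro j
  have hdet : A.det ∈ K := by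
    rw [hAA, ← RingHom.map_det]; exact SetLike.coe_mem _
  have h1 : A.adjugate.mulVec (A.mulVec x) = A.det • x := by
    rw [Matrix.mulVec_mulVec, Matrix.adjugate_mul, Matrix.smul_mulVec, Matrix.one_mulVec]
  have h2 : A.det * x j ∈ K := by
    have h3 := congrFun h1 j
    rw [Pi.smul_apply, smul_eq_mul] at h3
    rw [← h3, hy, hAA, ← RingHom.map_adjugate]
    change ∑ i, (A'.adjugate j i : L) * (y' i : L) ∈ K
    exact sum_mem fun i _ => mul_mem (SetLike.coe_mem _) (SetLike.coe_mem _)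
  have := mul_mem (inv_mem hdet) h2
  rwa [inv_mul_cancel_left₀ hA] at this

end field


/-! ### The slice data of a unicuspidal curve in general position -/

theorem sliceRow_congr {R : Type*} [CommRing R] {g D : ℕ} {f u : R[X]} {v w : ℕ → R}
    (h : ∀ r < D, v r = w r) : sliceRow g D f u v = sliceRow g D f u w :=
  Finset.sum_congr rfl fun r hr => by rw [h r (Finset.mem_range.1 hr)]

theorem headPoly_congr {R : Type*} [CommRing R] {g : ℕ} {u : R[X]} {v w : ℕ → R}
    (h : ∀ r < g, v r = w r) : headPoly g u v = headPoly g u w :=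
  Finset.sum_congr rfl fun r hr => by rw [h r (Finset.mem_range.1 hr)]

/-- Only the coefficients below t^(2g) are constrained; the others become the tail coordinates. The
truncated subtraction makes the tail empty if `d + 1 ≤ 2 * g`. -/
theorem exists_eq_sliceRow {R : Type*} [CommRing R] {g : ℕ} {G f u : R[X]} (hG : G.natDegree ≤ d)
    {v : ℕ → R} (h : ∀ m < 2 * g, G.coeff m = (f * headPoly g u v).coeff m) :
    ∃ v' : ℕ → R, (∀ r < g, v' r = v r) ∧ G = sliceRow g (g + (d + 1 - 2 * g)) f u v' := by
  refine ⟨fun r => if r < g then v r else G.coeff (r + g), fun r hr => if_pos hr, ?_⟩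
  ext m
  by_cases hm : m < 2 * g
  · rw [coeff_sliceRow_of_lt (by omega) _ _ _ hm, h m hm]
    congr 2
    exact (headPoly_congr fun r hr => if_pos hr).symm
  · rw [coeff_sliceRow_of_ge _ _ _ (by omega)]
    split_ifs
    · omega
    · rw [Nat.sub_add_cancel (by omega)]
    · exact coeff_eq_zero_of_natDegree_lt (by omega)

/-- f is invertible modulo t^(2g); the quotient H / f has order 2, and u is this quotient, truncated
and divided by its leading coefficient `e`. The condition `3 ≤ m` protects the coefficient of t^2
when `g = 1`. -/
theorem exists_cuspParameter {g : ℕ} (hg : 0 < g) {f H : ℂ[X]} (hf : f.coeff 0 ≠ 0)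
    (hH0 : H.coeff 0 = 0) (hH1 : H.coeff 1 = 0) (hH2 : H.coeff 2 ≠ 0) :
    ∃ (u : ℂ[X]) (e : ℂ), e ≠ 0 ∧ IsCuspParameter u ∧ (∀ m, 3 ≤ m → 2 * g ≤ m → u.coeff m = 0) ∧
      X ^ (2 * g) ∣ H - C e * (f * u) := by
  have hcop : IsCoprime (X ^ (2 * g)) f := by
    refine IsCoprime.pow_left ?_
    rw [prime_X.irreducible.coprime_iff_not_dvd, X_dvd_iff]
    exact hf
  obtain ⟨a, b, hab⟩ := hcop
  obtain ⟨H', rfl⟩ : X ^ 2 ∣ H := X_pow_dvd_iff.2 fun m hm => by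
    interval_cases m
    · exact hH0
    · exact hH1
  have hb0 : b.coeff 0 * f.coeff 0 = 1 := by
    have := congrArg (fun F => coeff F 0) hab
    simpa [mul_coeff_zero, coeff_X_pow, hg.ne'] using this
  set u₀ := X ^ 2 * (b * H') with hu₀
  have hu00 : u₀.coeff 0 = 0 := by simp [hu₀, mul_coeff_zero]
  have hu01 : u₀.coeff 1 = 0 := by
    rw [hu₀, mul_comm, coeff_mul_X_pow', if_neg (by omega)]
  have hu02 : u₀.coeff 2 ≠ 0 := by
    rw [mul_comm, coeff_mul_X_pow', if_pos le_rfl, Nat.sub_self] at hH2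
    rw [hu₀, mul_comm, coeff_mul_X_pow', if_pos le_rfl, Nat.sub_self, mul_coeff_zero]
    exact mul_ne_zero (left_ne_zero_of_mul_eq_one hb0) hH2
  set e := u₀.coeff 2
  set u : ℂ[X] := X ^ 2 + ∑ m ∈ Finset.Ico 3 (2 * g), monomial m (e⁻¹ * u₀.coeff m)
  have hu : ∀ m, u.coeff m = if m = 2 then 1 else
      if m ∈ Finset.Ico 3 (2 * g) then e⁻¹ * u₀.coeff m else 0 := by
    intro m
    simp only [u, coeff_add, coeff_X_pow, finsetSum_coeff, coeff_monomial, Finset.sum_ite_eq']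
    split_ifs with h1 h2
    · simp at h2; omega
    all_goals simp
  refine ⟨u, e, hu02, ⟨?_, ?_, ?_⟩, ?_, ?_⟩
  · rw [hu]; simp
  · rw [hu]; simp
  · rw [hu]; simp
  · intro m h3 hm
    rw [hu, if_neg (by omega), if_neg (by simp; omega)]
  · have e1 : X ^ 2 * H' - C e * (f * u) =
        X ^ (2 * g) * (a * (X ^ 2 * H')) + f * (u₀ - C e * u) := by
      linear_combination (-(X ^ 2 * H')) * hab
    rw [e1]
    refine dvd_add (dvd_mul_right _ _) (Dvd.dvd.mul_left (X_pow_dvd_iff.2 fun m hm => ?_) _)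
    rw [coeff_sub, coeff_C_mul, hu]
    split_ifs with h1 h2
    · subst h1; simp [e]
    · rw [mul_inv_cancel_left₀ hu02, sub_self]
    · have : m = 0 ∨ m = 1 := by simp at h2; omega
      rcases this with rfl | rfl <;> simp [hu00, hu01]

theorem natDegree_taylor_le_of_mem {F : ℂ[X]} (hF : F ∈ formSpace d) (s : ℂ) :
    (taylor s F).natDegree ≤ d := by
  rw [natDegree_taylor]; exact mem_formSpace.1 hF

/-- On a curve with a hyperelliptic cusp every linear form has an adapted expansion. -/
theorem IsHyperellipticAt.exists_sliceRow {g : ℕ} (hg : 0 < g) {a : CoeffSpace n d} {s : ℂ}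
    (h : IsHyperellipticAt g a (s : OnePoint ℂ)) {R H F : ℂ[X]} (hR : R ∈ monomialSpan a 1)
    (hH : H ∈ monomialSpan a 1) (hF : F ∈ monomialSpan a 1) (hR0 : ordAt d (s : OnePoint ℂ) R = 0)
    (hH2 : ordAt d (s : OnePoint ℂ) H = 2) {f u : ℂ[X]} {e : ℂ}
    (hf : X ^ (2 * g) ∣ taylor s R - f) (hu : X ^ (2 * g) ∣ taylor s H - C e * (f * u)) :
    ∃ v : ℕ → ℂ, taylor s F = sliceRow g (g + (d + 1 - 2 * g)) f u v := by
  -- Cancelling the term of order `2 * j` leaves an order greater than `2 * j`. It lies in the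
  -- semigroup, so for `j < g` it is at least `2 * j + 2`.
  have key : ∀ j ≤ g, ∃ c : ℕ → ℂ, ((2 * j : ℕ) : ℕ∞) ≤ ordAt (g * d) (s : OnePoint ℂ)
      (F * R ^ (g - 1) - ∑ r ∈ Finset.range j, c r • (H ^ r * R ^ (g - r))) := by
    intro j
    induction j with
    | zero => exact fun _ => ⟨0, by simp⟩
    | succ j ih =>
      intro hj
      obtain ⟨c, hc⟩ := ih (by omega)
      have hmon : ∀ r ≤ g, H ^ r * R ^ (g - r) ∈ monomialSpan a g := fun r hr => by
        have := mul_mem_monomialSpan (pow_mem_monomialSpan hH r) (pow_mem_monomialSpan hR (g - r))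
        rwa [mul_one, mul_one, Nat.add_sub_cancel' hr] at this
      have hmonF : F * R ^ (g - 1) ∈ monomialSpan a g := by
        have := mul_mem_monomialSpan hF (pow_mem_monomialSpan hR (g - 1))
        rwa [mul_one, Nat.add_sub_cancel' hg] at this
      have hord : ordAt (g * d) (s : OnePoint ℂ) (H ^ j * R ^ (g - j)) = (2 * j : ℕ) := by
        have := ordAt_mul (pow_mem_formSpace (mem_formSpace_of_mem_one hH) j)
          (pow_mem_formSpace (mem_formSpace_of_mem_one hR) (g - j)) (s : OnePoint ℂ)
        rw [← add_mul, Nat.add_sub_cancel' (by omega), ordAt_pow (mem_formSpace_of_mem_one hH),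
          ordAt_pow (mem_formSpace_of_mem_one hR), hR0, hH2] at this
        rw [this]; simp [mul_comm]
      obtain ⟨c', hc'⟩ := exists_smul_sub_ordAt hc hord
      refine ⟨fun r => if r = j then c' else c r, ?_⟩
      rw [Finset.sum_range_succ, ← sub_sub]
      beta_reduce
      rw [if_pos rfl, Finset.sum_congr rfl (g := fun r =>
        c r • (H ^ r * R ^ (g - r))) (fun r hr => by
          rw [if_neg (Finset.mem_range.1 hr).ne])]
      set T := F * R ^ (g - 1) - ∑ r ∈ Finset.range j, c r • (H ^ r * R ^ (g - r)) -
        c' • (H ^ j * R ^ (g - j))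
      have hT : T ∈ monomialSpan a g :=
        sub_mem (sub_mem hmonF (sum_mem fun r hr => Submodule.smul_mem _ _ (hmon r (by
          rw [Finset.mem_range] at hr; omega)))) (Submodule.smul_mem _ _ (hmon j (by omega)))
      rcases eq_or_ne T 0 with h0 | h0
      · rw [(ordAt_eq_top_iff (monomialSpan_le _ _ hT)).2 h0]; exact le_top
      · obtain ⟨m, -, hm⟩ := exists_ordAt_eq (p := (s : OnePoint ℂ)) (monomialSpan_le _ _ hT) h0
        rw [hm] at hc' ⊢
        have h1 : 2 * j + 1 ≤ m := by exact_mod_cast hc'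
        have h2 := h.mem_semigroup g T hT m hm
        have : 2 * (j + 1) ≤ m := by
          rcases h2 with ⟨l, rfl⟩ | h2 <;> omega
        exact_mod_cast this
  obtain ⟨c, hc⟩ := key g le_rfl
  have hmem : F * R ^ (g - 1) - ∑ r ∈ Finset.range g, c r • (H ^ r * R ^ (g - r)) ∈
      formSpace (g * d) := by
    refine sub_mem ?_ (sum_mem fun r hr => Submodule.smul_mem _ _ ?_)
    · have := mul_mem_formSpace (mem_formSpace_of_mem_one hF)
        (pow_mem_formSpace (mem_formSpace_of_mem_one hR) (g - 1))
      rwa [add_comm, ← Nat.succ_mul, Nat.succ_eq_add_one, Nat.sub_add_cancel hg] at this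
    · have := mul_mem_formSpace (pow_mem_formSpace (mem_formSpace_of_mem_one hH) r)
        (pow_mem_formSpace (mem_formSpace_of_mem_one hR) (g - r))
      rwa [← add_mul, Nat.add_sub_cancel' (Finset.mem_range.1 hr).le] at this
  rw [le_ordAt_coe_iff hmem, ← X_pow_dvd_iff] at hc
  have hf0 : ¬ (X : ℂ[X]) ∣ f := by
    intro hX
    have h1 : X ∣ taylor s R - f := (dvd_pow_self X (by omega)).trans hf
    have h2 : X ∣ taylor s R := by simpa using dvd_add h1 hX
    exact ((ordAt_coe_eq_iff (m := 0) (mem_formSpace_of_mem_one hR)).1 hR0).1 (X_dvd_iff.1 h2)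
  -- Modulo t^(2g) the forms `R` and `H` are f and e f u. The power f^(g-1), which came from `R ^ (g
  -- - 1)`, is a unit there and cancels.
  have hdvd : X ^ (2 * g) ∣ f ^ (g - 1) * (taylor s F - f * headPoly g u fun r => c r * e ^ r) := by
    have hmod : ∀ {A B : ℂ[X]}, X ^ (2 * g) ∣ A - B ↔
        Ideal.Quotient.mk (Ideal.span {(X : ℂ[X]) ^ (2 * g)}) A = Ideal.Quotient.mk _ B := by
      intro A B
      rw [Ideal.Quotient.eq, Ideal.mem_span_singleton]
    have hR' := hmod.1 hf
    have hH' := hmod.1 hu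
    rw [← sub_zero (taylor s (F * _ - _)), hmod] at hc
    rw [← sub_zero (f ^ _ * _), hmod, ← hc]
    simp only [map_sub, map_sum, map_mul, map_pow, taylor_mul, taylor_pow, taylor_C, smul_eq_C_mul,
      headPoly, hR', hH']
    rw [mul_sub, mul_comm (Ideal.Quotient.mk _ f ^ _), Finset.mul_sum, Finset.mul_sum]
    congr 1
    refine Finset.sum_congr rfl fun r hr => ?_
    rw [Finset.mem_range] at hr
    obtain ⟨k, rfl⟩ : ∃ k, g = r + k + 1 := ⟨g - r - 1, by omega⟩
    rw [show r + k + 1 - 1 = r + k by omega, show r + k + 1 - r = k + 1 by omega]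
    ring
  have hdvd' := prime_X.pow_dvd_of_dvd_mul_left _ (fun hh => hf0 (prime_X.dvd_of_dvd_pow hh)) hdvd
  obtain ⟨v', -, hv'⟩ := exists_eq_sliceRow (g := g)
    (natDegree_taylor_le_of_mem (mem_formSpace_of_mem_one hF) s)
    (fun m hm => sub_eq_zero.1 (by rw [← coeff_sub]; exact X_pow_dvd_iff.1 hdvd' m hm))
  exact ⟨v', hv'⟩


theorem finrank_monomialSpan_one_le (a : CoeffSpace n d) :
    Module.finrank ℂ (monomialSpan a 1) ≤ n + 1 := by
  rw [monomialSpan, pow_one]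
  exact (finrank_range_le_card _).trans (by simp)

/-- Order 1 is excluded by the semigroup. If order 2 did not occur either, the linear forms that
vanish at `p` would have order at least 3, and then order 2 would be missing in every degree. -/
theorem IsHyperellipticAt.exists_form_two {g : ℕ} (hg : 0 < g) {a : CoeffSpace n d} {p : OnePoint ℂ}
    (h : IsHyperellipticAt g a p) (ha : valueAt a p ≠ 0) :
    ∃ H ∈ monomialSpan a 1, ordAt d p H = 2 := by
  by_contra hcon
  push Not at hcon
  obtain ⟨N, hN, hN'⟩ := h.exists_form
  obtain ⟨F, hF, hF2⟩ := hN' 2 (by omega) (Or.inl even_two)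
  have := ordAt_eq_zero_or_le ha (r := 3) (fun G hG => ?_) hF
  · rw [hF2] at this
    rcases this with h0 | h0
    · norm_num at h0
    · exact absurd h0 (by exact_mod_cast (by norm_num : ¬ 3 ≤ 2))
  · rcases eq_or_ne G 0 with h0 | h0
    · right
      rw [(ordAt_eq_top_iff (mem_formSpace_of_mem_one hG)).2 h0]; exact le_top
    · obtain ⟨m, -, hm⟩ := exists_ordAt_eq (p := p) (mem_formSpace_of_mem_one hG) h0
      have h2 := hcon G hG
      have h1 := h.mem_semigroup 1 G hG m (by rw [one_mul]; exact hm)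
      rw [hm] at h2 ⊢
      have h2' : m ≠ 2 := fun hh => h2 (by rw [hh]; rfl)
      have : m = 0 ∨ 3 ≤ m := by
        rcases h1 with ⟨l, rfl⟩ | h1 <;> omega
      rcases this with rfl | h3
      · left; rfl
      · right; exact_mod_cast h3

theorem exists_colOrder_eq {g s : ℕ} (h : Even s ∨ 2 * g ≤ s) (hs : s ≤ d) :
    ∃ r < g + (d + 1 - 2 * g), colOrder g r = s := by
  by_cases h2 : 2 * g ≤ s
  · exact ⟨s - g, by omega, by rw [colOrder, if_neg (by omega)]; omega⟩
  · obtain ⟨l, rfl⟩ := h.resolve_right h2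
    exact ⟨l, by omega, by rw [colOrder, if_pos (by omega)]; omega⟩

theorem eq_zero_of_coeff_sliceRow {R : Type*} [CommRing R] [IsDomain R] {g D : ℕ} (hD : g ≤ D)
    {f u : R[X]} (hf : f.coeff 0 ≠ 0) (hu : IsCuspParameter u) {v : ℕ → R} {r : ℕ} (hr : r ≤ D)
    (h : ∀ m < colOrder g r, (sliceRow g D f u v).coeff m = 0) : ∀ r' < r, v r' = 0 := by
  intro r'
  induction r' using Nat.strong_induction_on with
  | _ r' ih =>
    intro hr'
    have h1 := (coeff_sliceRow_colOrder (f := f) hD hu (v := v) (r := r') (by omega)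
      fun i hi => ih i hi (hi.trans hr')).2
    rw [h _ (colOrder_strictMono g hr')] at h1
    refine (mul_eq_zero.1 h1.symm).resolve_left ?_
    split_ifs
    exacts [hf, one_ne_zero]

/-- The first form does not vanish at the cusp, and the second one is independent of the first to
second order. -/
def InGeneralPosition (a : CoeffSpace (n + 1) d) (s : ℂ) : Prop :=
  ordAt d (s : OnePoint ℂ) (rowPoly a 0) = 0 ∧
    ∃ c : ℂ, ordAt d (s : OnePoint ℂ) (rowPoly a 1 - c • rowPoly a 0) = 2

/-- Data that put a curve into the normal form used in the parameterizations of the strata. -/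
structure SliceData (n d g : ℕ) (ρ : Fin (n + 2) → ℕ) (R : Type*) [CommRing R] where
  s : R
  f : R[X]
  u : R[X]
  v₀ : ℕ → R
  w : ℕ → R
  c : R
  V : Fin n → ℕ → R
  A₀ : Fin n → R
  A₁ : Fin n → R
  A : Fin n → Fin n → R

namespace SliceData

variable {m g : ℕ} {ρ : Fin (m + 2) → ℕ} {R R' : Type*} [CommRing R] [CommRing R']

/-- The coefficients of the rows with respect to the adapted basis. -/
def rows (x : SliceData m d g ρ R) : Fin (m + 2) → ℕ → R :=
  Fin.cases x.v₀ (Fin.cases (x.c • x.v₀ + x.w)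
    fun j r => x.A₀ j * x.v₀ r + x.A₁ j * x.w r + ∑ l, x.A j l * x.V l r)

/-- The `i`-th row, in the local parameter. -/
def row (x : SliceData m d g ρ R) (i : Fin (m + 2)) : R[X] :=
  sliceRow g (g + (d + 1 - 2 * g)) x.f x.u (x.rows i)

def map (φ : R →+* R') (x : SliceData m d g ρ R) : SliceData m d g ρ R' where
  s := φ x.s
  f := x.f.map φ
  u := x.u.map φ
  v₀ r := φ (x.v₀ r)
  w r := φ (x.w r)
  c := φ x.c
  V l r := φ (x.V l r)
  A₀ j := φ (x.A₀ j)
  A₁ j := φ (x.A₁ j)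
  A j l := φ (x.A j l)

theorem rows_map (φ : R →+* R') (x : SliceData m d g ρ R) (i : Fin (m + 2)) (r : ℕ) :
    (x.map φ).rows i r = φ (x.rows i r) := by
  refine Fin.cases ?_ (fun i => Fin.cases ?_ (fun j => ?_) i) i
  · rfl
  · change φ x.c * φ (x.v₀ r) + φ (x.w r) = φ (x.c * x.v₀ r + x.w r)
    simp
  · simp [rows, map]

theorem row_map (φ : R →+* R') (x : SliceData m d g ρ R) (i : Fin (m + 2)) :
    (x.map φ).row i = (x.row i).map φ := by
  rw [row, row, map_sliceRow]
  congr 1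
  ext r
  exact x.rows_map φ i r

/-- The first two rows and the pivots are normalized, and the forms have degree at most `d`. -/
structure IsNormal (x : SliceData m d g ρ R) : Prop where
  slice : IsNormalSlice g x.u x.v₀ x.w
  pivot : ∀ l i, x.V l (ρ i) = if i = l.succ.succ then 1 else 0
  degree_zero : (sliceRow g (g + (d + 1 - 2 * g)) x.f x.u x.v₀).natDegree ≤ d
  degree_one : (sliceRow g (g + (d + 1 - 2 * g)) x.f x.u x.w).natDegree ≤ d
  degree_succ : ∀ l, (sliceRow g (g + (d + 1 - 2 * g)) x.f x.u (x.V l)).natDegree ≤ d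

theorem row_one (x : SliceData m d g ρ R) :
    x.row 1 = sliceRow g (g + (d + 1 - 2 * g)) x.f x.u (x.c • x.v₀ + x.w) := rfl

/-- The vectors `v₀`, `w` and `V l` describe the space of linear forms in echelon form, while `A₀`,
`A₁` and `A` describe the chosen tuple within it. -/
theorem row_succ_eq (x : SliceData m d g ρ R) (j : Fin m) :
    x.row j.succ.succ = x.A₀ j • sliceRow g (g + (d + 1 - 2 * g)) x.f x.u x.v₀ +
      x.A₁ j • sliceRow g (g + (d + 1 - 2 * g)) x.f x.u x.w +
      ∑ l, x.A j l • sliceRow g (g + (d + 1 - 2 * g)) x.f x.u (x.V l) := by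
  rw [← sliceRow_sum, ← sliceRow_smul, ← sliceRow_smul, ← sliceRow_add, ← sliceRow_add]
  rfl

theorem IsNormal.natDegree_row_le {x : SliceData m d g ρ R} (hx : x.IsNormal) (i : Fin (m + 2)) :
    (x.row i).natDegree ≤ d := by
  refine Fin.cases ?_ (fun i => Fin.cases ?_ (fun j => ?_) i) i
  · exact hx.degree_zero
  · change (x.row 1).natDegree ≤ d
    rw [row_one, sliceRow_add, sliceRow_smul]
    exact natDegree_add_le_of_degree_le ((natDegree_smul_le _ _).trans hx.degree_zero) hx.degree_one
  · rw [row_succ_eq]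
    refine natDegree_add_le_of_degree_le (natDegree_add_le_of_degree_le
      ((natDegree_smul_le _ _).trans hx.degree_zero) ((natDegree_smul_le _ _).trans hx.degree_one)) ?_
    exact natDegree_sum_le_of_forall_le _ _ fun l _ =>
      (natDegree_smul_le _ _).trans (hx.degree_succ l)

/-- The coefficients of the curve. -/
def coeffs (x : SliceData m d g ρ R) (q : Fin (m + 2) × Fin (d + 1)) : R :=
  (taylor (-x.s) (x.row q.1)).coeff q.2

theorem coeffs_map (φ : R →+* R') (x : SliceData m d g ρ R) (q : Fin (m + 2) × Fin (d + 1)) :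
    (x.map φ).coeffs q = φ (x.coeffs q) := by
  rw [coeffs, coeffs, row_map, ← coeff_map, map_taylor, map_neg]
  rfl

theorem rowPoly_coeffs {x : SliceData m d g ρ ℂ} (hx : ∀ i, (x.row i).natDegree ≤ d)
    (i : Fin (m + 2)) : rowPoly (n := m + 1) x.coeffs i = taylor (-x.s) (x.row i) := by
  ext j
  by_cases hj : j < d + 1
  · have := rowPoly_coeff (n := m + 1) x.coeffs i ⟨j, hj⟩
    exact this
  · rw [coeff_eq_zero_of_natDegree_lt, coeff_eq_zero_of_natDegree_lt]
    · rw [natDegree_taylor]; have := hx i; omega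
    · have := mem_formSpace.1 (rowPoly_mem (n := m + 1) x.coeffs i); omega

theorem taylor_rowPoly_coeffs {x : SliceData m d g ρ ℂ} (hx : ∀ i, (x.row i).natDegree ≤ d)
    (i : Fin (m + 2)) : taylor x.s (rowPoly (n := m + 1) x.coeffs i) = x.row i := by
  rw [rowPoly_coeffs hx, taylor_taylor, add_neg_cancel, taylor_zero]

theorem coeffs_eq {x : SliceData m d g ρ ℂ} {a : CoeffSpace (m + 1) d}
    (h : ∀ i, taylor x.s (rowPoly a i) = x.row i) : x.coeffs = a := by
  ext q
  rw [coeffs, ← h, taylor_taylor, neg_add_cancel, taylor_zero, rowPoly_coeff]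

end SliceData

/-- A curve in general position has slice data. -/
theorem exists_sliceData {m g : ℕ} (hg : 0 < g) {ρ : Fin (m + 2) → ℕ} (hρ : StrictMono ρ)
    (hρ0 : ρ 0 = 0) (hρ1 : ρ 1 = 1) (hρD : ∀ i, ρ i < g + (d + 1 - 2 * g))
    {a : CoeffSpace (m + 1) d} {s : ℂ} (h : IsHyperellipticAt g a (s : OnePoint ℂ))
    (hvan : Set.range (fun i => colOrder g (ρ i)) = vanishingOrders a (s : OnePoint ℂ))
    (hpos : InGeneralPosition a s) :
    ∃ x : SliceData m d g ρ ℂ, x.coeffs = a ∧ x.IsNormal ∧ x.s = s ∧ x.f.coeff 0 ≠ 0 ∧ x.w 1 ≠ 0 ∧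
      (∀ j, 2 * g ≤ j → x.f.coeff j = 0) ∧ (∀ j, 3 ≤ j → 2 * g ≤ j → x.u.coeff j = 0) ∧
      ∀ l, ∀ r < ρ l.succ.succ, x.V l r = 0 := by
  obtain ⟨hpos0, c, hpos1⟩ := hpos
  set D := g + (d + 1 - 2 * g) with hDdef
  have hD : g ≤ D := by omega
  have hD1 : 1 < D := hρ1 ▸ hρD 1
  set R₀ := rowPoly a 0 with hR₀
  set H := rowPoly a 1 - c • R₀ with hH
  have hR₀m : R₀ ∈ monomialSpan a 1 := rowPoly_mem_monomialSpan a 0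
  have hHm : H ∈ monomialSpan a 1 :=
    sub_mem (rowPoly_mem_monomialSpan a 1) (Submodule.smul_mem _ _ hR₀m)
  have hRc := (ordAt_coe_eq_iff (m := 0) (mem_formSpace_of_mem_one hR₀m)).1 hpos0
  have hHc := (ordAt_coe_eq_iff (m := 2) (mem_formSpace_of_mem_one hHm)).1 hpos1
  set f := cut (2 * g) (taylor s R₀) with hfdef
  have hfc : ∀ j < 2 * g, (taylor s R₀).coeff j = f.coeff j := fun j hj => by
    rw [hfdef, coeff_cut, if_pos hj]
  have hfd : X ^ (2 * g) ∣ taylor s R₀ - f := X_pow_dvd_iff.2 fun j hj => by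
    rw [coeff_sub, hfc j hj, sub_self]
  have hf0 : f.coeff 0 ≠ 0 := by rw [← hfc 0 (by omega)]; exact hRc.1
  obtain ⟨u, e, he, hu, hu', hud⟩ := exists_cuspParameter hg hf0 (hHc.2 0 (by omega))
    (hHc.2 1 (by omega)) hHc.1
  obtain ⟨v₀, hv₀, hv₀'⟩ := exists_eq_sliceRow (d := d) (g := g) (G := taylor s R₀) (f := f) (u := u)
    (v := fun r => if r = 0 then 1 else 0)
    (natDegree_taylor_le_of_mem (mem_formSpace_of_mem_one hR₀m) s) (fun j hj => by
      have : headPoly g u (fun r => if r = 0 then 1 else 0) = 1 := by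
        rw [headPoly, Finset.sum_eq_single 0]
        · simp
        · intro r _ h0; simp [h0]
        · simp [hg.ne']
      rw [this, mul_one, hfc j hj])
  obtain ⟨w, hw, hw'⟩ := exists_eq_sliceRow (d := d) (g := g) (G := taylor s H) (f := f) (u := u)
    (v := fun r => if r = 1 then e else 0)
    (natDegree_taylor_le_of_mem (mem_formSpace_of_mem_one hHm) s) (fun j hj => by
      by_cases hg2 : 2 ≤ g
      · have : headPoly g u (fun r => if r = 1 then e else 0) = C e * u := by
          rw [headPoly, Finset.sum_eq_single 1]
          · simp
          · intro r _ h0; simp [h0]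
          · simp; omega
        rw [this, mul_left_comm]
        exact sub_eq_zero.1 (by rw [← coeff_sub]; exact X_pow_dvd_iff.1 hud j hj)
      · have : headPoly g u (fun r => if r = 1 then e else 0) = 0 := by
          rw [headPoly]
          refine Finset.sum_eq_zero fun r hr => ?_
          rw [Finset.mem_range] at hr
          rw [if_neg (by omega), C_0, zero_mul]
        rw [this, mul_zero, coeff_zero]
        exact hHc.2 j (by omega))
  have hslice : IsNormalSlice g u v₀ w :=
    ⟨hu, by rw [hv₀ 0 hg]; simp, fun r h1 h2 => by rw [hv₀ r h2, if_neg h1.ne'],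
      by rw [hw 0 hg]; simp, fun r h1 h2 => by rw [hw r h2, if_neg (by omega)]⟩
  have hw1 : w 1 ≠ 0 := by
    have h2 := (hslice.coeff_sliceRow_one hD hD1 hg f).2.2
    rw [← hw'] at h2
    exact right_ne_zero_of_mul (h2 ▸ hHc.1)
  have hE : ∀ i, ∃ E ∈ monomialSpan a 1, ordAt d (s : OnePoint ℂ) E = colOrder g (ρ i) := fun i =>
    mem_vanishingOrders.1 (hvan ▸ Set.mem_range_self i)
  choose E hEm hEo using hE
  have hv : ∀ i, ∃ v : ℕ → ℂ, taylor s (E i) = sliceRow g D f u v := fun i =>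
    h.exists_sliceRow hg hR₀m hHm (hEm i) hpos0 hpos1 hfd hud
  choose v hv using hv
  have hvlow : ∀ i, ∀ r < ρ i, v i r = 0 := fun i =>
    eq_zero_of_coeff_sliceRow hD hf0 hu (hρD i).le fun j hj => by
      rw [← hv]
      exact ((ordAt_coe_eq_iff (mem_formSpace_of_mem_one (hEm i))).1 (hEo i)).2 j hj
  have hvpiv : ∀ i, v i (ρ i) ≠ 0 := fun i h0 => by
    apply ((ordAt_coe_eq_iff (mem_formSpace_of_mem_one (hEm i))).1 (hEo i)).1
    rw [hv, (coeff_sliceRow_colOrder hD hu (hρD i) (hvlow i)).2, h0, mul_zero]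
  -- The pivot columns of a basis adapted to the orders form a triangular matrix with nonzero
  -- diagonal. Its inverse, again triangular, brings the basis to reduced echelon form without
  -- introducing entries to the left of the pivots.
  set M : Matrix (Fin (m + 2)) (Fin (m + 2)) ℂ := Matrix.of fun i l => v i (ρ l) with hM
  have hMtri : M.BlockTriangular id := fun i l hil => hvlow i _ (hρ hil)
  have hMdet : IsUnit M.det := by
    rw [Matrix.det_of_isUpperTriangular hMtri, isUnit_iff_ne_zero]
    exact Finset.prod_ne_zero_iff.2 fun i _ => hvpiv i
  have hMinv : M⁻¹.BlockTriangular id := by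
    have := M.invertibleOfIsUnitDet hMdet
    exact Matrix.blockTriangular_inv_of_blockTriangular hMtri
  set V : Fin m → ℕ → ℂ := fun l r => ∑ j, M⁻¹ l.succ.succ j * v j r with hV
  have hVpiv : ∀ l i, V l (ρ i) = if i = l.succ.succ then 1 else 0 := fun l i => by
    have h1 := congrFun (congrFun (M.nonsing_inv_mul hMdet) l.succ.succ) i
    rw [Matrix.mul_apply, Matrix.one_apply] at h1
    rw [show V l (ρ i) = ∑ j, M⁻¹ l.succ.succ j * M j i from rfl, h1]
    simp only [eq_comm]
  have hVlow : ∀ l, ∀ r < ρ l.succ.succ, V l r = 0 := fun l r hr =>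
    Finset.sum_eq_zero fun j _ => by
      by_cases hj : j < l.succ.succ
      · have h0 : M⁻¹ l.succ.succ j = 0 := hMinv hj
        rw [h0, zero_mul]
      · rw [hvlow j r (hr.trans_le (hρ.monotone (not_lt.1 hj))), mul_zero]
  -- The first two basis elements are replaced by the first form and by `H`. They have the same
  -- orders 0 and 2, so the result is still a basis.
  set E' : Fin (m + 2) → ℂ[X] :=
    Fin.cases R₀ (Fin.cases H fun l => ∑ j, M⁻¹ l.succ.succ j • E j) with hE'
  set V' : Fin (m + 2) → ℕ → ℂ := Fin.cases v₀ (Fin.cases w V) with hV'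
  have hE'm : ∀ i, E' i ∈ monomialSpan a 1 := by
    refine fun i => Fin.cases hR₀m (fun i => Fin.cases hHm (fun l => ?_) i) i
    change ∑ j, M⁻¹ l.succ.succ j • E j ∈ monomialSpan a 1
    exact sum_mem fun j _ => Submodule.smul_mem _ _ (hEm j)
  have hE't : ∀ i, taylor s (E' i) = sliceRow g D f u (V' i) := by
    refine fun i => Fin.cases hv₀' (fun i => Fin.cases hw' (fun l => ?_) i) i
    change taylor s (∑ j, M⁻¹ l.succ.succ j • E j) = sliceRow g D f u (V l)
    rw [hV, sliceRow_sum, map_sum]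
    exact Finset.sum_congr rfl fun j _ => by rw [map_smul, hv]
  have hV'low : ∀ i, ∀ r < ρ i, V' i r = 0 := by
    refine fun i => Fin.cases ?_ (fun i => Fin.cases ?_ (fun l => hVlow l) i) i
    · intro r hr; rw [hρ0] at hr; omega
    · intro r hr
      change r < ρ 1 at hr
      obtain rfl : r = 0 := by omega
      exact hslice.one_zero
  have hV'piv : ∀ i, V' i (ρ i) ≠ 0 := by
    refine fun i => Fin.cases ?_ (fun i => Fin.cases ?_ (fun l => ?_) i) i
    · change v₀ (ρ 0) ≠ 0
      rw [hρ0, hslice.zero_zero]; exact one_ne_zero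
    · change w (ρ 1) ≠ 0
      rwa [hρ1]
    · change V l (ρ l.succ.succ) ≠ 0
      rw [hVpiv, if_pos rfl]; exact one_ne_zero
  have hE'o : ∀ i, ordAt d (s : OnePoint ℂ) (E' i) = colOrder g (ρ i) := fun i => by
    rw [ordAt_coe_eq_iff (mem_formSpace_of_mem_one (hE'm i)), hE't]
    have := coeff_sliceRow_colOrder (f := f) hD hu (hρD i) (hV'low i)
    refine ⟨?_, this.1⟩
    rw [this.2]
    refine mul_ne_zero ?_ (hV'piv i)
    split_ifs
    exacts [hf0, one_ne_zero]
  have hli : LinearIndependent ℂ E' :=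
    linearIndependent_of_strictMono_ordAt ((colOrder_strictMono g).comp hρ) hE'o
  have hspan : Submodule.span ℂ (Set.range E') = monomialSpan a 1 := by
    refine Submodule.eq_of_le_of_finrank_le (Submodule.span_le.2 ?_) ?_
    · rintro _ ⟨i, rfl⟩; exact hE'm i
    · rw [finrank_span_eq_card hli, Fintype.card_fin]
      exact finrank_monomialSpan_one_le a
  have hA : ∀ j : Fin m, ∃ b : Fin (m + 2) → ℂ, ∑ i, b i • E' i = rowPoly a j.succ.succ := fun j =>
    (Submodule.mem_span_range_iff_exists_fun ℂ).1 (hspan ▸ rowPoly_mem_monomialSpan a _)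
  choose B hB using hA
  let x : SliceData m d g ρ ℂ :=
    { s := s, f := f, u := u, v₀ := v₀, w := w, c := c, V := V, A₀ := fun j => B j 0
      A₁ := fun j => B j 1, A := fun j l => B j l.succ.succ }
  refine ⟨x, SliceData.coeffs_eq ?_, ⟨hslice, hVpiv, ?_, ?_, ?_⟩, rfl, hf0, hw1, ?_, hu', hVlow⟩
  · refine fun i => Fin.cases hv₀' (fun i => Fin.cases ?_ (fun j => ?_) i) i
    · change taylor s (rowPoly a 1) = sliceRow g D f u (c • v₀ + w)
      rw [sliceRow_add, sliceRow_smul, ← hv₀', ← hw', ← map_smul, ← map_add, hH, add_sub_cancel]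
    · rw [SliceData.row_succ_eq]
      change taylor s _ = B j 0 • sliceRow g D f u v₀ + B j 1 • sliceRow g D f u w +
        ∑ l : Fin m, B j l.succ.succ • sliceRow g D f u (V l)
      rw [← hB j, Fin.sum_univ_succ, Fin.sum_univ_succ, ← add_assoc]
      simp only [map_add, map_smul, map_sum, hE't]
      rfl
  · change (sliceRow g D f u v₀).natDegree ≤ d
    rw [← hv₀']; exact natDegree_taylor_le_of_mem (mem_formSpace_of_mem_one hR₀m) s
  · change (sliceRow g D f u w).natDegree ≤ d
    rw [← hw']; exact natDegree_taylor_le_of_mem (mem_formSpace_of_mem_one hHm) s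
  · intro l
    change (sliceRow g D f u (V l)).natDegree ≤ d
    rw [← show taylor s (E' l.succ.succ) = sliceRow g D f u (V l) from hE't l.succ.succ]
    exact natDegree_taylor_le_of_mem (mem_formSpace_of_mem_one (hE'm _)) s
  · intro j hj
    change f.coeff j = 0
    rw [hfdef, coeff_cut, if_neg (by omega)]


/-! ### Families of slices -/

theorem mem_range_of_ordAt {W : Submodule ℂ ℂ[X]} {e N : ℕ} (hW : W ≤ formSpace e)
    {p : OnePoint ℂ} {k : Fin N → ℕ} (hk : StrictMono k) (h : ∀ i, ∃ F ∈ W, ordAt e p F = k i)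
    (hfin : Module.finrank ℂ W ≤ N) {F : ℂ[X]} (hF : F ∈ W) {s : ℕ} (hs : ordAt e p F = s) :
    s ∈ Set.range k := by
  by_contra hcon
  set O : Finset ℕ := insert s (Finset.univ.image k)
  have hO : O.card = N + 1 := by
    rw [Finset.card_insert_of_notMem (by simpa using hcon),
      Finset.card_image_of_injective _ hk.injective, Finset.card_univ, Fintype.card_fin]
  have := card_le_finrank_of_strictMono_ordAt hW (p := p) (O.orderEmbOfFin hO).strictMono fun i => by
    have hi := O.orderEmbOfFin_mem hO i
    rcases Finset.mem_insert.1 hi with h1 | h1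
    · exact ⟨F, hF, by rw [hs, h1]⟩
    · obtain ⟨j, -, hj⟩ := Finset.mem_image.1 h1
      rw [← hj]; exact h j
  omega

namespace SliceData

variable {m g : ℕ} {ρ : Fin (m + 2) → ℕ}

theorem IsNormal.map {R R' : Type*} [CommRing R] [CommRing R'] {x : SliceData m d g ρ R}
    (hx : x.IsNormal) (φ : R →+* R') : (x.map φ).IsNormal where
  slice := hx.slice.map φ
  pivot l i := by
    change φ (x.V l (ρ i)) = _
    rw [hx.pivot]; split_ifs <;> simp
  degree_zero := by
    have := (natDegree_map_le (f := φ)).trans hx.degree_zero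
    rwa [map_sliceRow] at this
  degree_one := by
    have := (natDegree_map_le (f := φ)).trans hx.degree_one
    rwa [map_sliceRow] at this
  degree_succ l := by
    have := (natDegree_map_le (f := φ)).trans (hx.degree_succ l)
    rwa [map_sliceRow] at this

/-- All parameters of a normalized slice can be computed from the coefficients of the curve. -/
theorem IsNormal.parameters_mem {L : Type*} [Field L] [CharZero L] {K : Subfield L}
    (hK : ∀ y : L, IsAlgebraic K y → y ∈ K) (hg : 0 < g) {x : SliceData m d g ρ L}
    (hx : x.IsNormal) (hρ0 : ρ 0 = 0) (hρ1 : ρ 1 = 1) (hρD : ∀ i, ρ i < g + (d + 1 - 2 * g))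
    (hf : x.f.coeff 0 ≠ 0) (hw : x.w 1 ≠ 0) (hA : (Matrix.of x.A).det ≠ 0)
    (hc : ∀ q, x.coeffs q ∈ K) :
    x.s ∈ K ∧ (∀ j < 2 * g, x.f.coeff j ∈ K) ∧ (∀ j < 2 * g, x.u.coeff j ∈ K) ∧ x.c ∈ K ∧
      (∀ r < g + (d + 1 - 2 * g), x.v₀ r ∈ K ∧ x.w r ∈ K ∧ ∀ l, x.V l r ∈ K) ∧
      ∀ j, x.A₀ j ∈ K ∧ x.A₁ j ∈ K ∧ ∀ l, x.A j l ∈ K := by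
  set D := g + (d + 1 - 2 * g)
  have hD : g ≤ D := by omega
  have hD1 : 1 < D := hρ1 ▸ hρD 1
  have hrow : ∀ i j, (taylor (-x.s) (x.row i)).coeff j ∈ K := by
    intro i j
    by_cases hj : j < d + 1
    · exact hc (i, ⟨j, hj⟩)
    · rw [coeff_eq_zero_of_natDegree_lt]
      · exact zero_mem _
      · rw [natDegree_taylor]; have := hx.natDegree_row_le i; omega
  obtain ⟨hs, hfK, huK, hcK, hv₀, hwK⟩ := slice_parameters_mem hK hg hD hD1 hx.slice hf hw
    (hrow 0) (hrow 1)
  have hrow' : ∀ i j, (x.row i).coeff j ∈ K := fun i j => by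
    have := coeff_taylor_mem (hrow i) hs j
    rwa [taylor_taylor, add_neg_cancel, taylor_zero] at this
  have hr : ∀ j, ∀ r < D, x.A₀ j * x.v₀ r + x.A₁ j * x.w r + ∑ l, x.A j l * x.V l r ∈ K := fun j =>
    slice_coeff_mem hD hx.slice.cusp hf hfK huK (hrow' j.succ.succ)
  have hpiv : ∀ j i, ∑ l, x.A j l * x.V l (ρ i) =
      ∑ l : Fin m, if i = l.succ.succ then x.A j l else 0 := fun j i =>
    Finset.sum_congr rfl fun l _ => by rw [hx.pivot]; split_ifs <;> simp
  -- In the pivot columns the echelon form isolates the entries of the matrix: column 0 gives `A₀`,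
  -- column 1 gives `A₁`, and the others give `A`. The free entries of `V` follow because `A` is
  -- invertible.
  have hA₀ : ∀ j, x.A₀ j ∈ K := fun j => by
    have h1 := hr j (ρ 0) (hρD 0)
    rw [hpiv, hρ0, hx.slice.zero_zero, hx.slice.one_zero, Finset.sum_eq_zero] at h1
    · simpa using h1
    · intro l _; rw [if_neg (Fin.succ_ne_zero _).symm]
  have hA₁ : ∀ j, x.A₁ j ∈ K := fun j => by
    have h1 := hr j (ρ 1) (hρD 1)
    rw [hpiv, hρ1, Finset.sum_eq_zero, add_zero] at h1
    · have h2 := sub_mem h1 (mul_mem (hA₀ j) (hv₀ 1 hD1))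
      rw [add_sub_cancel_left] at h2
      have h3 := mul_mem h2 (inv_mem (hwK 1 hD1))
      rwa [mul_inv_cancel_right₀ hw] at h3
    · intro l _
      rw [if_neg]
      intro h
      exact Fin.succ_ne_zero l (Fin.succ_injective _ (h.symm.trans rfl))
  have hAV : ∀ j, ∀ r < D, ∑ l, x.A j l * x.V l r ∈ K := fun j r hrD => by
    have h2 := sub_mem (hr j r hrD)
      (add_mem (mul_mem (hA₀ j) (hv₀ r hrD)) (mul_mem (hA₁ j) (hwK r hrD)))
    rwa [add_sub_cancel_left] at h2
  have hAK : ∀ j l, x.A j l ∈ K := fun j l => by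
    have h1 := hAV j (ρ l.succ.succ) (hρD _)
    rw [hpiv, Finset.sum_eq_single l] at h1
    · simpa using h1
    · intro l' _ hl'
      rw [if_neg]
      intro h
      exact hl' (Fin.succ_injective _ (Fin.succ_injective _ h)).symm
    · simp
  exact ⟨hs, hfK, huK, hcK, fun r hrD => ⟨hv₀ r hrD, hwK r hrD,
    mulVec_mem hA hAK fun j => hAV j r hrD⟩, fun j => ⟨hA₀ j, hA₁ j, hAK j⟩⟩

/-- The vanishing orders of a curve given by slice data in echelon form. -/
theorem IsNormal.range_eq_vanishingOrders {x : SliceData m d g ρ ℂ} (hx : x.IsNormal)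
    (hρ : StrictMono ρ) (hρ0 : ρ 0 = 0) (hρ1 : ρ 1 = 1) (hρD : ∀ i, ρ i < g + (d + 1 - 2 * g))
    (hf : x.f.coeff 0 ≠ 0) (hw : x.w 1 ≠ 0) (hV : ∀ l, ∀ r < ρ l.succ.succ, x.V l r = 0)
    (hfin : m + 2 ≤ Module.finrank ℂ (monomialSpan (n := m + 1) x.coeffs 1)) :
    Set.range (fun i => colOrder g (ρ i)) = vanishingOrders (n := m + 1) x.coeffs (x.s : OnePoint ℂ) := by
  set D := g + (d + 1 - 2 * g) with hDdef
  have hD : g ≤ D := by omega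
  set v : Fin (m + 2) → ℕ → ℂ := Fin.cases x.v₀ (Fin.cases x.w x.V) with hv
  have hvdeg : ∀ i, (sliceRow g D x.f x.u (v i)).natDegree ≤ d :=
    fun i => Fin.cases hx.degree_zero (fun i => Fin.cases hx.degree_one (fun l => hx.degree_succ l) i) i
  have hvlow : ∀ i, ∀ r < ρ i, v i r = 0 := by
    refine fun i => Fin.cases ?_ (fun i => Fin.cases ?_ (fun l => hV l) i) i
    · intro r hr; rw [hρ0] at hr; omega
    · intro r hr
      change r < ρ 1 at hr
      obtain rfl : r = 0 := by omega
      exact hx.slice.one_zero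
  have hvpiv : ∀ i, v i (ρ i) ≠ 0 := by
    refine fun i => Fin.cases ?_ (fun i => Fin.cases ?_ (fun l => ?_) i) i
    · change x.v₀ (ρ 0) ≠ 0
      rw [hρ0, hx.slice.zero_zero]; exact one_ne_zero
    · change x.w (ρ 1) ≠ 0
      rwa [hρ1]
    · change x.V l (ρ l.succ.succ) ≠ 0
      rw [hx.pivot, if_pos rfl]; exact one_ne_zero
  set E : Fin (m + 2) → ℂ[X] := fun i => taylor (-x.s) (sliceRow g D x.f x.u (v i)) with hE
  have hEt : ∀ i, taylor x.s (E i) = sliceRow g D x.f x.u (v i) := fun i => by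
    rw [hE, taylor_taylor, add_neg_cancel, taylor_zero]
  have hEm : ∀ i, E i ∈ formSpace d := fun i => by
    rw [mem_formSpace, natDegree_taylor]; exact hvdeg i
  have hEo : ∀ i, ordAt d (x.s : OnePoint ℂ) (E i) = colOrder g (ρ i) := fun i => by
    rw [ordAt_coe_eq_iff (hEm i), hEt]
    have := coeff_sliceRow_colOrder (f := x.f) hD hx.slice.cusp (hρD i) (hvlow i)
    refine ⟨?_, this.1⟩
    rw [this.2]
    refine mul_ne_zero ?_ (hvpiv i)
    split_ifs
    exacts [hf, one_ne_zero]
  have hk : StrictMono fun i => colOrder g (ρ i) := (colOrder_strictMono g).comp hρ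
  have hli : LinearIndependent ℂ E := linearIndependent_of_strictMono_ordAt hk hEo
  -- The rows lie in the span of `E`, which has dimension `m + 2`; the rank hypothesis forces
  -- equality.
  have hspan : monomialSpan (n := m + 1) x.coeffs 1 = Submodule.span ℂ (Set.range E) := by
    have := FiniteDimensional.span_of_finite ℂ (Set.finite_range E)
    refine Submodule.eq_of_le_of_finrank_le ?_ ?_
    · rw [monomialSpan, pow_one, Submodule.span_le]
      rintro _ ⟨i, rfl⟩
      have hE0 : ∀ i, E i ∈ Submodule.span ℂ (Set.range E) := fun i =>
        Submodule.subset_span ⟨i, rfl⟩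
      change rowPoly (n := m + 1) x.coeffs i ∈ Submodule.span ℂ (Set.range E)
      rw [rowPoly_coeffs hx.natDegree_row_le]
      refine Fin.cases (hE0 0) (fun i => Fin.cases ?_ (fun j => ?_) i) i
      · change taylor _ (x.row 1) ∈ _
        rw [row_one, sliceRow_add, sliceRow_smul, map_add, map_smul]
        exact add_mem (Submodule.smul_mem _ _ (hE0 0)) (hE0 1)
      · rw [row_succ_eq, map_add, map_add, map_smul, map_smul, map_sum]
        refine add_mem (add_mem (Submodule.smul_mem _ _ (hE0 0)) (Submodule.smul_mem _ _ (hE0 1)))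
          (sum_mem fun l _ => ?_)
        rw [map_smul]
        exact Submodule.smul_mem _ _ (hE0 l.succ.succ)
    · rw [finrank_span_eq_card hli, Fintype.card_fin]; exact hfin
  have hat : ∀ i, ∃ F ∈ monomialSpan (n := m + 1) x.coeffs 1,
      ordAt d (x.s : OnePoint ℂ) F = colOrder g (ρ i) := fun i =>
    ⟨E i, hspan ▸ Submodule.subset_span ⟨i, rfl⟩, hEo i⟩
  ext s
  rw [mem_vanishingOrders]
  constructor
  · rintro ⟨i, rfl⟩
    exact hat i
  · rintro ⟨F, hF, hFs⟩
    exact mem_range_of_ordAt (fun F hF => mem_formSpace_of_mem_one hF) hk hat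
      (finrank_monomialSpan_one_le _) hF hFs

/-- In a family of slices, being unicuspidal is an open condition. -/
theorem IsNormal.exists_open {τ : Type} {x : SliceData m d g ρ (MvPolynomial τ ℂ)}
    (hx : x.IsNormal) {y₀ : τ → ℂ} (hf : MvPolynomial.eval y₀ (x.f.coeff 0) ≠ 0)
    (hw : MvPolynomial.eval y₀ (x.w 1) ≠ 0)
    (h : IsUnicuspidalAt (n := m + 1) g (hyperellipticSemigroup g)
      (x.map (MvPolynomial.eval y₀)).coeffs ((x.map (MvPolynomial.eval y₀)).s : OnePoint ℂ)) :
    ∃ q : MvPolynomial τ ℂ, MvPolynomial.eval y₀ q ≠ 0 ∧ ∀ y, MvPolynomial.eval y q ≠ 0 →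
      MvPolynomial.eval y (x.f.coeff 0) ≠ 0 ∧ MvPolynomial.eval y (x.w 1) ≠ 0 ∧
      m + 2 ≤ Module.finrank ℂ (monomialSpan (n := m + 1) (x.map (MvPolynomial.eval y)).coeffs 1) ∧
      IsUnicuspidalAt (n := m + 1) g (hyperellipticSemigroup g)
        (x.map (MvPolynomial.eval y)).coeffs ((x.map (MvPolynomial.eval y)).s : OnePoint ℂ) := by
  have hev : ∀ y, (x.map (MvPolynomial.eval y)).coeffs =
      fun q => MvPolynomial.eval y (x.coeffs q) := fun y => funext fun q => x.coeffs_map _ q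
  have hhyp := isHyperellipticAt_of_isUnicuspidalAt h
  obtain ⟨⟨ha, -⟩, -⟩ := h
  obtain ⟨N, hN, hNfin⟩ := hhyp.exists_finrank_ge
  obtain ⟨Q, hQ, hQ'⟩ := exists_certificate _ hNfin
  obtain ⟨Q₁, hQ₁, hQ₁'⟩ := exists_certificate _ (linearIndependent_iff_finrank.1 ha.1)
  have hb : ∀ (P : MvPolynomial (Fin (m + 2) × Fin (d + 1)) ℂ) (y : τ → ℂ),
      MvPolynomial.eval y (MvPolynomial.bind₁ x.coeffs P) =
        MvPolynomial.eval (x.map (MvPolynomial.eval y)).coeffs P := by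
    intro P y
    rw [hev, MvPolynomial.eval, MvPolynomial.eval₂Hom_bind₁]
    rfl
  -- Besides the two leading coefficients, the factors are the rank certificates in degree `N` and
  -- in degree 1 (nondegeneracy), pulled back to the parameters. That the orders lie in the
  -- semigroup is automatic for slices.
  refine ⟨x.f.coeff 0 * x.w 1 * MvPolynomial.bind₁ x.coeffs Q * MvPolynomial.bind₁ x.coeffs Q₁,
    ?_, ?_⟩
  · rw [map_mul, map_mul, map_mul, hb, hb]
    exact mul_ne_zero (mul_ne_zero (mul_ne_zero hf hw) hQ) hQ₁
  · intro y hy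
    rw [map_mul, map_mul, map_mul, hb, hb] at hy
    have hfy := left_ne_zero_of_mul (left_ne_zero_of_mul (left_ne_zero_of_mul hy))
    have hwy := right_ne_zero_of_mul (left_ne_zero_of_mul (left_ne_zero_of_mul hy))
    have h1 := hQ₁' _ (right_ne_zero_of_mul hy)
    refine ⟨hfy, hwy, h1, isUnicuspidalAt_of_isHyperellipticAt
      (linearIndependent_iff_finrank.2 h1) (isHyperellipticAt_of_le_finrank ?_ hN
        (hQ' _ (right_ne_zero_of_mul (left_ne_zero_of_mul hy))))⟩
    have hxy := hx.map (MvPolynomial.eval y)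
    refine mem_semigroup_of_slice (g := g) (D := g + (d + 1 - 2 * g)) (by omega)
      (f := (x.map (MvPolynomial.eval y)).f) ?_ hxy.slice.cusp
      (taylor_rowPoly_coeffs hxy.natDegree_row_le)
    change (x.f.map _).coeff 0 ≠ 0
    rwa [coeff_map]

end SliceData


/-! ### The degree condition on slices -/

section

variable {m g : ℕ} {ρ : Fin (m + 2) → ℕ} {R R' : Type*} [CommRing R] [CommRing R']

/-- The low order coefficients of the adapted basis at the pivots. -/
def pivotMatrix (g : ℕ) (ρ : Fin (m + 2) → ℕ) (u : R[X]) (v : Fin (m + 2) → ℕ → R) :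
    Matrix (Fin (m + 2)) (Fin (m + 2)) R :=
  Matrix.of fun i l => (headPoly g u (v i)).coeff (2 * ρ l)

/-- If `d = 2 g - 2`, a modification of `y` that makes the coefficients of `t ^ (2 g - 1)` in the
products with the adapted basis vanish. -/
def corrected (d g : ℕ) (ρ : Fin (m + 2) → ℕ) (u : R[X]) (v : Fin (m + 2) → ℕ → R) (y : R[X]) :
    R[X] :=
  if d + 1 < 2 * g then
    C (pivotMatrix g ρ u v).det * y - ∑ l, monomial (2 * g - 1 - 2 * ρ l)
      (((pivotMatrix g ρ u v).adjugate.mulVec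
        fun i => (y * headPoly g u (v i)).coeff (2 * g - 1)) l)
  else y

theorem map_pivotMatrix (φ : R →+* R') (g : ℕ) (ρ : Fin (m + 2) → ℕ) (u : R[X])
    (v : Fin (m + 2) → ℕ → R) :
    φ.mapMatrix (pivotMatrix g ρ u v) = pivotMatrix g ρ (u.map φ) fun i r => φ (v i r) := by
  ext i l
  simp only [pivotMatrix, RingHom.mapMatrix_apply, Matrix.map_apply, Matrix.of_apply]
  rw [← coeff_map, map_headPoly]

theorem map_corrected (φ : R →+* R') (d g : ℕ) (ρ : Fin (m + 2) → ℕ) (u : R[X])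
    (v : Fin (m + 2) → ℕ → R) (y : R[X]) :
    (corrected d g ρ u v y).map φ =
      corrected d g ρ (u.map φ) (fun i r => φ (v i r)) (y.map φ) := by
  rw [corrected, corrected]
  split_ifs
  · rw [Polynomial.map_sub, Polynomial.map_mul, map_C, RingHom.map_det, Polynomial.map_sum]
    congr 1
    · rw [map_pivotMatrix]
    · refine Finset.sum_congr rfl fun l _ => ?_
      rw [map_monomial, RingHom.map_mulVec]
      congr 2
      rw [← map_pivotMatrix, ← RingHom.map_adjugate]
      congr 1
      ext i
      simp only [Function.comp]
      rw [← coeff_map, Polynomial.map_mul, map_headPoly]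
  · rfl

theorem coeff_monomial_mul_of_le {k N : ℕ} (hk : k ≤ N) (c : R) (F : R[X]) :
    (monomial k c * F).coeff N = c * F.coeff (N - k) := by
  rw [← C_mul_X_pow_eq_monomial, mul_assoc, coeff_C_mul, mul_comm (X ^ k), coeff_mul_X_pow',
    if_pos hk]

/-- The exponents are chosen so that the coefficient of t^(2ρ_l) of the head is shifted to t^(2g-1).
-/
theorem coeff_sum_pivots_mul (hρ : ∀ i, ρ i < g) (u : R[X]) (v : Fin (m + 2) → ℕ → R)
    (c : Fin (m + 2) → R) (i : Fin (m + 2)) :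
    ((∑ l, monomial (2 * g - 1 - 2 * ρ l) (c l)) * headPoly g u (v i)).coeff (2 * g - 1) =
      (pivotMatrix g ρ u v).mulVec c i := by
  rw [Finset.sum_mul, finsetSum_coeff, Matrix.mulVec, dotProduct]
  refine Finset.sum_congr rfl fun l _ => ?_
  have := hρ l
  rw [coeff_monomial_mul_of_le (by omega), mul_comm, pivotMatrix, Matrix.of_apply]
  congr 2
  omega

/-- Cramer's rule with the adjugate, scaled by the determinant instead of divided by it, so that it
applies over polynomial rings. -/
theorem coeff_corrected_mul (hd : d + 1 < 2 * g) (hρ : ∀ i, ρ i < g) (u : R[X])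
    (v : Fin (m + 2) → ℕ → R) (y : R[X]) (i : Fin (m + 2)) :
    (corrected d g ρ u v y * headPoly g u (v i)).coeff (2 * g - 1) = 0 := by
  rw [corrected, if_pos hd, sub_mul, coeff_sub, coeff_sum_pivots_mul hρ, Matrix.mulVec_mulVec,
    Matrix.mul_adjugate, Matrix.smul_mulVec, Matrix.one_mulVec, mul_assoc, coeff_C_mul]
  simp

/-- Since `2 * g ≤ d + 2`, the only head coefficient that can exceed the degree is that of t^(2g-1),
and only if `d = 2 * g - 2`. -/
theorem natDegree_sliceRow_le (hd : 2 * g ≤ d + 2) {f u : R[X]} {v : ℕ → R}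
    (h : d + 1 < 2 * g → (f * headPoly g u v).coeff (2 * g - 1) = 0) :
    (sliceRow g (g + (d + 1 - 2 * g)) f u v).natDegree ≤ d := by
  rw [natDegree_le_iff_coeff_eq_zero]
  intro j hj
  by_cases hjg : j < 2 * g
  · have : j = 2 * g - 1 := by omega
    rw [coeff_sliceRow_of_lt (by omega) _ _ _ hjg, this]
    exact h (by omega)
  · rw [coeff_sliceRow_of_ge _ _ _ (by omega), if_neg (by omega)]

theorem coeff_eq_zero_of_natDegree_sliceRow (hg : 0 < g) (hd : d + 1 < 2 * g) {f u : R[X]}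
    {v : ℕ → R} (h : (sliceRow g (g + (d + 1 - 2 * g)) f u v).natDegree ≤ d) :
    (f * headPoly g u v).coeff (2 * g - 1) = 0 := by
  rw [← coeff_sliceRow_of_lt (D := g + (d + 1 - 2 * g)) (by omega) _ _ _ (by omega)]
  exact coeff_eq_zero_of_natDegree_lt (by omega)

/-- The exponents that are determined by the degree condition. -/
def boundExponents (d g : ℕ) (ρ : Fin (m + 2) → ℕ) : Finset ℕ :=
  if d + 1 < 2 * g then Finset.univ.image fun l => 2 * g - 1 - 2 * ρ l else ∅

theorem coeff_corrected (hd : d + 1 < 2 * g) (u : R[X]) (v : Fin (m + 2) → ℕ → R) (y : R[X])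
    {j : ℕ} (hj : j ∉ boundExponents d g ρ) :
    (corrected d g ρ u v y).coeff j = (pivotMatrix g ρ u v).det * y.coeff j := by
  rw [corrected, if_pos hd, coeff_sub, coeff_C_mul, finsetSum_coeff, Finset.sum_eq_zero, sub_zero]
  intro l _
  rw [coeff_monomial, if_neg]
  rintro rfl
  exact hj (by rw [boundExponents, if_pos hd]; exact Finset.mem_image_of_mem _ (Finset.mem_univ l))

theorem det_pivotMatrix (hρ : StrictMono ρ) (hρg : ∀ i, ρ i < g) {u : R[X]} (hu : IsCuspParameter u)
    {v : Fin (m + 2) → ℕ → R} (hv : ∀ i, ∀ r < ρ i, v i r = 0) :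
    (pivotMatrix g ρ u v).det = ∏ i, v i (ρ i) := by
  rw [Matrix.det_of_isUpperTriangular]
  · refine Finset.prod_congr rfl fun i _ => ?_
    rw [pivotMatrix, Matrix.of_apply, hu.coeff_headPoly _ (hρg i), Finset.sum_eq_zero, add_zero]
    intro r hr
    rw [hv i r (Finset.mem_range.1 hr), zero_mul]
  · intro i l hil
    have : ρ l < ρ i := hρ hil
    exact hu.coeff_headPoly_of_lt (hv i) (by omega)

end

/-- Every solution of the degree condition is a modification. -/
theorem exists_eq_corrected {m g : ℕ} {ρ : Fin (m + 2) → ℕ} (hd : d + 1 < 2 * g)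
    (hρ : StrictMono ρ) (hρg : ∀ i, ρ i < g) {f u : ℂ[X]} (hf : ∀ j, 2 * g ≤ j → f.coeff j = 0)
    {v : Fin (m + 2) → ℕ → ℂ} (hdet : (pivotMatrix g ρ u v).det ≠ 0)
    (h : ∀ i, (f * headPoly g u (v i)).coeff (2 * g - 1) = 0) :
    ∃ y : ℂ[X], (∀ j, 2 * g ≤ j ∨ j ∈ boundExponents d g ρ → y.coeff j = 0) ∧
      f = corrected d g ρ u v y := by
  set P := pivotMatrix g ρ u v with hP
  -- `y` is f without the coefficients at the bound exponents, divided by the determinant. The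
  -- omitted coefficients `c` are then forced by the linear system of the pivot matrix.
  set y : ℂ[X] := ∑ j ∈ Finset.range (2 * g) \ boundExponents d g ρ,
    monomial j (P.det⁻¹ * f.coeff j) with hy
  have hyc : ∀ j, y.coeff j = if j ∈ Finset.range (2 * g) \ boundExponents d g ρ then
      P.det⁻¹ * f.coeff j else 0 := fun j => by
    simp [hy, finsetSum_coeff, coeff_monomial]
  have hinj : Function.Injective fun l => 2 * g - 1 - 2 * ρ l := by
    intro l l' hll
    apply hρ.injective
    have := hρg l; have := hρg l'
    simp only at hll
    omega
  set c : Fin (m + 2) → ℂ := fun l => f.coeff (2 * g - 1 - 2 * ρ l)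
  have hfy : f = C P.det * y + ∑ l, monomial (2 * g - 1 - 2 * ρ l) (c l) := by
    ext j
    rw [coeff_add, coeff_C_mul, hyc, finsetSum_coeff]
    by_cases hj : j ∈ boundExponents d g ρ
    · rw [if_neg (by simp [hj]), mul_zero, zero_add]
      rw [boundExponents, if_pos hd, Finset.mem_image] at hj
      obtain ⟨l, -, rfl⟩ := hj
      rw [Finset.sum_eq_single l]
      · simp [c]
      · intro l' _ hl'
        rw [coeff_monomial, if_neg fun hh => hl' (hinj hh)]
      · simp
    · rw [Finset.sum_eq_zero, add_zero]
      · by_cases hj2 : j < 2 * g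
        · rw [if_pos (by simp [hj, hj2]), mul_inv_cancel_left₀ hdet]
        · rw [if_neg (by simp [hj2]), mul_zero, hf j (by omega)]
      · intro l _
        rw [coeff_monomial, if_neg]
        rintro rfl
        exact hj (by
          rw [boundExponents, if_pos hd]; exact Finset.mem_image_of_mem _ (Finset.mem_univ l))
  refine ⟨y, fun j hj => ?_, ?_⟩
  · rw [hyc, if_neg]
    simp only [Finset.mem_sdiff, Finset.mem_range, not_and_or, not_lt, not_not]
    exact hj
  · have hc : c = -P.adjugate.mulVec fun i => (y * headPoly g u (v i)).coeff (2 * g - 1) := by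
      have h1 : P.mulVec c = -(P.det • fun i => (y * headPoly g u (v i)).coeff (2 * g - 1)) := by
        ext i
        have h2 := h i
        rw [hfy, add_mul, coeff_add, coeff_sum_pivots_mul hρg, mul_assoc, coeff_C_mul] at h2
        rw [Pi.neg_apply, Pi.smul_apply, smul_eq_mul]
        exact eq_neg_of_add_eq_zero_right h2
      have h3 := congrArg P.adjugate.mulVec h1
      rw [Matrix.mulVec_mulVec, Matrix.adjugate_mul, Matrix.smul_mulVec, Matrix.one_mulVec,
        Matrix.mulVec_neg, Matrix.mulVec_smul, ← smul_neg] at h3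
      exact smul_right_injective _ hdet h3
    rw [corrected, if_pos hd, ← hP]
    conv_lhs => rw [hfy, hc]
    rw [sub_eq_add_neg, ← Finset.sum_neg_distrib]
    simp


/-! ### Parameter spaces of slices -/

/-- Extension of a function by zero. -/
def extendZero {α R : Type*} [Zero R] [DecidableEq α] (S : Finset α) (t : S → R) (j : α) : R :=
  if h : j ∈ S then t ⟨j, h⟩ else 0

theorem extendZero_coe {α R : Type*} [Zero R] [DecidableEq α] {S : Finset α} (t : S → R) (j : S) :
    extendZero S t j = t j := dif_pos j.2

theorem extendZero_of_notMem {α R : Type*} [Zero R] [DecidableEq α] {S : Finset α} (t : S → R)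
    {j : α} (hj : j ∉ S) : extendZero S t j = 0 := dif_neg hj

theorem extendZero_restrict {α R : Type*} [Zero R] [DecidableEq α] {S : Finset α} (t : α → R)
    (j : α) : extendZero S (fun j => t j) j = if j ∈ S then t j else 0 := by
  rw [extendZero]; split_ifs <;> rfl

theorem map_extendZero {α R R' : Type*} [CommRing R] [CommRing R'] [DecidableEq α] (φ : R →+* R')
    (S : Finset α) (t : S → R) (j : α) :
    φ (extendZero S t j) = extendZero S (fun j => φ (t j)) j := by
  rw [extendZero, extendZero]; split_ifs <;> simp

/-- The exponents of the free coefficients of the first form. -/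
abbrev freeExponents {m : ℕ} (d g : ℕ) (ρ : Fin (m + 2) → ℕ) : Finset ℕ :=
  Finset.range (2 * g) \ boundExponents d g ρ

/-- The columns of the adapted basis of order at least `2 g`. -/
abbrev tailColumns (d g : ℕ) : Finset ℕ := Finset.Ico g (g + (d + 1 - 2 * g))

/-- The parameters of slices: the cusp and the constant `c`, the coefficients of the first form, of
the cusp parameter, the tails of the first two rows, the matrix that defines the other rows, and the
free entries (indexed by `P`) of their echelon form. -/
abbrev Params {m : ℕ} (d g : ℕ) (ρ : Fin (m + 2) → ℕ) (P : Finset (Fin m × ℕ)) : Type :=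
  Fin 2 ⊕ freeExponents d g ρ ⊕ Finset.Ico 3 (2 * g) ⊕ tailColumns d g ⊕
    (insert 1 (tailColumns d g) : Finset ℕ) ⊕ (Fin m × Fin (m + 2)) ⊕ P

namespace Params

variable {m g : ℕ} {ρ : Fin (m + 2) → ℕ} {P : Finset (Fin m × ℕ)} {R R' : Type*} [CommRing R]
  [CommRing R']

def y (t : Params d g ρ P → R) : R[X] :=
  ∑ j ∈ freeExponents d g ρ, monomial j (extendZero _ (fun j => t (.inr (.inl j))) j)

def u (t : Params d g ρ P → R) : R[X] :=
  X ^ 2 + ∑ j ∈ Finset.Ico 3 (2 * g), monomial j (extendZero _ (fun j => t (.inr (.inr (.inl j)))) j)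

def v₀ (t : Params d g ρ P → R) (r : ℕ) : R :=
  if r = 0 then 1 else extendZero (tailColumns d g) (fun j => t (.inr (.inr (.inr (.inl j))))) r

def w (t : Params d g ρ P → R) (r : ℕ) : R :=
  extendZero (insert 1 (tailColumns d g)) (fun j => t (.inr (.inr (.inr (.inr (.inl j)))))) r

def A (t : Params d g ρ P → R) (j : Fin m) (l : Fin (m + 2)) : R :=
  t (.inr (.inr (.inr (.inr (.inr (.inl (j, l)))))))

def V (t : Params d g ρ P → R) (l : Fin m) (r : ℕ) : R :=
  if r = ρ l.succ.succ then 1 else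
    extendZero P (fun j => t (.inr (.inr (.inr (.inr (.inr (.inr j))))))) (l, r)

/-- The adapted basis of the space of linear forms. -/
def frame (v₀ w : ℕ → R) (V : Fin m → ℕ → R) : Fin (m + 2) → ℕ → R :=
  Fin.cases v₀ (Fin.cases w V)

/-- The slice with given parameters. -/
def slice (t : Params d g ρ P → R) : SliceData m d g ρ R where
  s := t (.inl 0)
  c := t (.inl 1)
  u := u t
  f := corrected d g ρ (u t) (frame (v₀ t) (w t) (V t)) (y t)
  v₀ := v₀ t
  w := w t
  V := V t
  A₀ j := A t j 0
  A₁ j := A t j 1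
  A j l := A t j l.succ.succ

theorem coeff_y (t : Params d g ρ P → R) (j : ℕ) :
    (y t).coeff j = extendZero _ (fun j => t (.inr (.inl j))) j := by
  rw [y, finsetSum_coeff]
  simp only [coeff_monomial, Finset.sum_ite_eq']
  split_ifs with h
  · rfl
  · rw [extendZero_of_notMem _ h]

theorem coeff_u (t : Params d g ρ P → R) (j : ℕ) :
    (u t).coeff j = if j = 2 then 1 else extendZero _ (fun j => t (.inr (.inr (.inl j)))) j := by
  rw [u, coeff_add, finsetSum_coeff, coeff_X_pow]
  simp only [coeff_monomial, Finset.sum_ite_eq']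
  split_ifs with h1 h2 h2
  · simp at h2; omega
  · simp
  · simp
  · rw [extendZero_of_notMem _ h2, zero_add]

theorem map_y (φ : R →+* R') (t : Params d g ρ P → R) : (y t).map φ = y (φ ∘ t) := by
  ext j; rw [coeff_map, coeff_y, coeff_y, map_extendZero]; rfl

theorem map_u (φ : R →+* R') (t : Params d g ρ P → R) : (u t).map φ = u (φ ∘ t) := by
  ext j; rw [coeff_map, coeff_u, coeff_u]; split_ifs
  · simp
  · rw [map_extendZero]; rfl

theorem map_v₀ (φ : R →+* R') (t : Params d g ρ P → R) (r : ℕ) : φ (v₀ t r) = v₀ (φ ∘ t) r := by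
  rw [v₀, v₀]; split_ifs
  · simp
  · rw [map_extendZero]; rfl

theorem map_w (φ : R →+* R') (t : Params d g ρ P → R) (r : ℕ) : φ (w t r) = w (φ ∘ t) r := by
  rw [w, map_extendZero]; rfl

theorem map_V (φ : R →+* R') (t : Params d g ρ P → R) (l : Fin m) (r : ℕ) :
    φ (V t l r) = V (φ ∘ t) l r := by
  rw [V, V]; split_ifs
  · simp
  · rw [map_extendZero]; rfl

theorem map_frame (φ : R →+* R') (v₀ w : ℕ → R) (V : Fin m → ℕ → R) :
    (fun i r => φ (frame v₀ w V i r)) =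
      frame (fun r => φ (v₀ r)) (fun r => φ (w r)) fun l r => φ (V l r) := by
  ext i r
  refine Fin.cases rfl (fun i => Fin.cases rfl (fun l => rfl) i) i

theorem map_slice (φ : R →+* R') (t : Params d g ρ P → R) :
    (slice t).map φ = slice (φ ∘ t) := by
  simp only [SliceData.map, slice, map_corrected, map_frame, map_u, map_v₀, map_w, map_V, map_y]
  rfl

theorem isNormalSlice (hg : 0 < g) (t : Params d g ρ P → R) :
    IsNormalSlice g (u t) (v₀ t) (w t) := by
  refine ⟨⟨?_, ?_, ?_⟩, ?_, fun r h1 h2 => ?_, ?_, fun r h1 h2 => ?_⟩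
  · rw [coeff_u, if_neg (by omega), extendZero_of_notMem _ (by simp)]
  · rw [coeff_u, if_neg (by omega), extendZero_of_notMem _ (by simp)]
  · rw [coeff_u, if_pos rfl]
  · rw [v₀, if_pos rfl]
  · rw [v₀, if_neg h1.ne', extendZero_of_notMem _ (by simp; omega)]
  · rw [w, extendZero_of_notMem _ (by simp; omega)]
  · rw [w, extendZero_of_notMem _ (by simp; omega)]

theorem V_pivot (hρ : StrictMono ρ) (hP : ∀ q ∈ P, q.2 ∉ Set.range ρ) (t : Params d g ρ P → R)
    (l : Fin m) (i : Fin (m + 2)) : V t l (ρ i) = if i = l.succ.succ then 1 else 0 := by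
  rw [V]
  by_cases h : i = l.succ.succ
  · rw [if_pos (by rw [h]), if_pos h]
  · rw [if_neg (fun hh => h (hρ.injective hh)), if_neg h, extendZero_of_notMem]
    exact fun hh => hP _ hh ⟨i, rfl⟩

theorem isNormal (hg : 0 < g) (hd : 2 * g ≤ d + 2) (hρ : StrictMono ρ)
    (hρD : ∀ i, ρ i < g + (d + 1 - 2 * g)) (hP : ∀ q ∈ P, q.2 ∉ Set.range ρ)
    (t : Params d g ρ P → R) : (slice t).IsNormal := by
  have key : ∀ i, (sliceRow g (g + (d + 1 - 2 * g)) (slice t).f (slice t).u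
      (frame (v₀ t) (w t) (V t) i)).natDegree ≤ d := fun i =>
    natDegree_sliceRow_le hd fun hdg => coeff_corrected_mul hdg (fun i => by
      have := hρD i; omega) _ _ _ i
  exact ⟨isNormalSlice hg t, V_pivot hρ hP t, key 0, key 1, fun l => key l.succ.succ⟩

end Params

/-- The rows of two slices agree if the data agree. -/
theorem SliceData.coeffs_congr {m g : ℕ} {ρ : Fin (m + 2) → ℕ} {R : Type*} [CommRing R]
    {x y : SliceData m d g ρ R} (hs : x.s = y.s) (hf : x.f = y.f) (hu : x.u = y.u) (hc : x.c = y.c)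
    (hv₀ : ∀ r < g + (d + 1 - 2 * g), x.v₀ r = y.v₀ r)
    (hw : ∀ r < g + (d + 1 - 2 * g), x.w r = y.w r)
    (hV : ∀ l, ∀ r < g + (d + 1 - 2 * g), x.V l r = y.V l r)
    (hA₀ : x.A₀ = y.A₀) (hA₁ : x.A₁ = y.A₁) (hA : x.A = y.A) : x.coeffs = y.coeffs := by
  have hrow : ∀ i, x.row i = y.row i := by
    intro i
    rw [SliceData.row, SliceData.row, hf, hu]
    refine sliceRow_congr fun r hr => ?_
    refine Fin.cases (hv₀ r hr) (fun i => Fin.cases ?_ (fun j => ?_) i) i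
    · change x.c * x.v₀ r + x.w r = y.c * y.v₀ r + y.w r
      rw [hc, hv₀ r hr, hw r hr]
    · change x.A₀ j * x.v₀ r + x.A₁ j * x.w r + ∑ l, x.A j l * x.V l r =
        y.A₀ j * y.v₀ r + y.A₁ j * y.w r + ∑ l, y.A j l * y.V l r
      rw [hA₀, hA₁, hA, hv₀ r hr, hw r hr]
      congr 1
      exact Finset.sum_congr rfl fun l _ => by rw [hV l r hr]
  ext q
  rw [SliceData.coeffs, SliceData.coeffs, hs, hrow]

namespace Params

variable {m g : ℕ} {ρ : Fin (m + 2) → ℕ} {P : Finset (Fin m × ℕ)}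

theorem corrected_congr {R : Type*} [CommRing R] {u y : R[X]} {v v' : Fin (m + 2) → ℕ → R}
    (h : ∀ i, headPoly g u (v i) = headPoly g u (v' i)) :
    corrected d g ρ u v y = corrected d g ρ u v' y := by
  have : pivotMatrix g ρ u v = pivotMatrix g ρ u v' := by
    ext i l; rw [pivotMatrix, pivotMatrix, Matrix.of_apply, Matrix.of_apply, h]
  simp only [corrected, this, h]

/-- Every slice in echelon form is given by parameters. -/
theorem exists_params (hg : 0 < g) (hρ : StrictMono ρ) (hρ0 : ρ 0 = 0) (hρ1 : ρ 1 = 1)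
    (hρD : ∀ i, ρ i < g + (d + 1 - 2 * g))
    (hP' : ∀ l r, r < g + (d + 1 - 2 * g) → ρ l.succ.succ < r → r ∉ Set.range ρ → (l, r) ∈ P)
    {x : SliceData m d g ρ ℂ} (hx : x.IsNormal) (hw : x.w 1 ≠ 0)
    (hf : ∀ j, 2 * g ≤ j → x.f.coeff j = 0) (hu : ∀ j, 3 ≤ j → 2 * g ≤ j → x.u.coeff j = 0)
    (hV : ∀ l, ∀ r < ρ l.succ.succ, x.V l r = 0) :
    ∃ t : Params d g ρ P → ℂ, (slice t).coeffs = x.coeffs ∧ t (.inl 0) = x.s ∧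
      (slice t).f = x.f ∧ (slice t).w 1 = x.w 1 ∧
      (d + 1 < 2 * g → (pivotMatrix g ρ (u t) (frame (v₀ t) (w t) (V t))).det ≠ 0) := by
  set D := g + (d + 1 - 2 * g) with hD
  have hdet : d + 1 < 2 * g → (pivotMatrix g ρ x.u (frame x.v₀ x.w x.V)).det ≠ 0 := by
    intro hd
    rw [det_pivotMatrix hρ (fun i => by have := hρD i; omega) hx.slice.cusp]
    · refine Finset.prod_ne_zero_iff.2 fun i _ => ?_
      refine Fin.cases ?_ (fun i => Fin.cases ?_ (fun l => ?_) i) i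
      · change x.v₀ (ρ 0) ≠ 0
        rw [hρ0, hx.slice.zero_zero]; exact one_ne_zero
      · change x.w (ρ 1) ≠ 0
        rwa [hρ1]
      · change x.V l (ρ l.succ.succ) ≠ 0
        rw [hx.pivot, if_pos rfl]; exact one_ne_zero
    · refine fun i => Fin.cases ?_ (fun i => Fin.cases ?_ (fun l => hV l) i) i
      · intro r hr; rw [hρ0] at hr; omega
      · intro r hr
        change r < ρ 1 at hr
        obtain rfl : r = 0 := by omega
        exact hx.slice.one_zero
  obtain ⟨y', hy', hfy⟩ : ∃ y' : ℂ[X], (∀ j, 2 * g ≤ j ∨ j ∈ boundExponents d g ρ → y'.coeff j = 0) ∧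
      x.f = corrected d g ρ x.u (frame x.v₀ x.w x.V) y' := by
    by_cases hd : d + 1 < 2 * g
    · refine exists_eq_corrected hd hρ (fun i => by have := hρD i; omega) hf (hdet hd) fun i => ?_
      refine coeff_eq_zero_of_natDegree_sliceRow hg hd ?_
      exact Fin.cases hx.degree_zero
        (fun i => Fin.cases hx.degree_one (fun l => hx.degree_succ l) i) i
    · refine ⟨x.f, fun j hj => ?_, by rw [corrected, if_neg hd]⟩
      rw [boundExponents, if_neg hd] at hj
      exact hf j (by simpa using hj)
  let B : Fin m → Fin (m + 2) → ℂ := fun j =>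
    Fin.cases (x.A₀ j) (Fin.cases (x.A₁ j) fun l => x.A j l)
  let t : Params d g ρ P → ℂ := Sum.elim ![x.s, x.c] (Sum.elim (fun j => y'.coeff j)
    (Sum.elim (fun j => x.u.coeff j) (Sum.elim (fun r => x.v₀ r) (Sum.elim (fun r => x.w r)
      (Sum.elim (fun q => B q.1 q.2) fun q => x.V q.1.1 q.1.2)))))
  have ht : y t = y' := by
    ext j
    rw [coeff_y]
    change extendZero (freeExponents d g ρ) (fun j => y'.coeff j) j = _
    rw [extendZero_restrict]
    split_ifs with h
    · rfl
    · rw [hy']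
      simpa only [Finset.mem_sdiff, Finset.mem_range, not_and_or, not_lt, not_not] using h
  have htu : u t = x.u := by
    ext j
    rw [coeff_u]
    change (if j = 2 then 1 else extendZero (Finset.Ico 3 (2 * g)) (fun j => x.u.coeff j) j) = _
    rw [extendZero_restrict]
    split_ifs with h1 h2
    · rw [h1, hx.slice.cusp.coeff_two]
    · rfl
    · rw [Finset.mem_Ico] at h2
      by_cases h3 : 3 ≤ j
      · rw [hu j h3 (by omega)]
      · have : j = 0 ∨ j = 1 := by omega
        rcases this with rfl | rfl
        · rw [hx.slice.cusp.coeff_zero]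
        · rw [hx.slice.cusp.coeff_one]
  have htv₀ : ∀ r < D, v₀ t r = x.v₀ r := by
    intro r hr
    rw [v₀]
    change (if r = 0 then 1 else extendZero (tailColumns d g) (fun r => x.v₀ r) r) = _
    rw [extendZero_restrict]
    split_ifs with h1 h2
    · rw [h1, hx.slice.zero_zero]
    · rfl
    · rw [Finset.mem_Ico] at h2
      rw [hx.slice.zero_of_lt r (by omega) (by omega)]
  have htw : ∀ r < D, w t r = x.w r := by
    intro r hr
    rw [w]
    change extendZero (insert 1 (tailColumns d g)) (fun r => x.w r) r = _
    rw [extendZero_restrict]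
    split_ifs with h1
    · rfl
    · rw [Finset.mem_insert, Finset.mem_Ico] at h1
      rcases Nat.eq_zero_or_pos r with rfl | h2
      · rw [hx.slice.one_zero]
      · rw [hx.slice.one_of_lt r (by omega) (by omega)]
  have htV : ∀ l, ∀ r < D, V t l r = x.V l r := by
    intro l r hr
    rw [V]
    change (if r = ρ l.succ.succ then 1 else extendZero P (fun q => x.V q.1.1 q.1.2) (l, r)) = _
    rw [extendZero_restrict (S := P) (fun q => x.V q.1 q.2)]
    split_ifs with h1 h2
    · rw [h1, hx.pivot, if_pos rfl]
    · rfl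
    -- An entry that is not a parameter lies to the left of its pivot or in the column of another
    -- pivot, and vanishes in both cases.
    · rcases lt_trichotomy r (ρ l.succ.succ) with h3 | h3 | h3
      · rw [hV l r h3]
      · exact absurd h3 h1
      · by_cases h4 : r ∈ Set.range ρ
        · obtain ⟨i, rfl⟩ := h4
          rw [hx.pivot, if_neg (fun hi => h1 (by rw [hi]))]
        · exact absurd (hP' l r hr h3 h4) h2
  have hhead : ∀ i, headPoly g x.u (frame (v₀ t) (w t) (V t) i) =
      headPoly g x.u (frame x.v₀ x.w x.V i) := fun i => by
    refine headPoly_congr fun r hr => ?_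
    exact Fin.cases (htv₀ r (by omega)) (fun i => Fin.cases (htw r (by omega))
      (fun l => htV l r (by omega)) i) i
  have htf : (slice t).f = x.f := by
    change corrected d g ρ (u t) (frame (v₀ t) (w t) (V t)) (y t) = x.f
    rw [htu, ht, corrected_congr hhead, ← hfy]
  refine ⟨t, SliceData.coeffs_congr rfl htf htu rfl htv₀ htw htV rfl rfl rfl, rfl, htf,
    htw 1 (hρ1 ▸ hρD 1), fun hd => ?_⟩
  have : pivotMatrix g ρ (u t) (frame (v₀ t) (w t) (V t)) =
      pivotMatrix g ρ x.u (frame x.v₀ x.w x.V) := by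
    ext i l
    rw [htu, pivotMatrix, pivotMatrix, Matrix.of_apply, Matrix.of_apply, hhead]
  rw [this]
  exact hdet hd

end Params


/-! ### Dimension of the image of a family of slices -/

theorem det_mem {L : Type*} [Field L] {K : Subfield L} {m : ℕ} {A : Matrix (Fin m) (Fin m) L}
    (hA : ∀ i j, A i j ∈ K) : A.det ∈ K := by
  rw [Matrix.det_apply]
  refine sum_mem fun σ _ => ?_
  rw [Units.smul_def]
  exact zsmul_mem (prod_mem fun i _ => hA _ _) _

theorem coeff_headPoly_mem {L : Type*} [Field L] {K : Subfield L} {g N : ℕ} {u : L[X]} {v : ℕ → L}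
    (hu : ∀ j < N, u.coeff j ∈ K) (hv : ∀ r < g, v r ∈ K) :
    ∀ j < N, (headPoly g u v).coeff j ∈ K := by
  intro j hj
  rw [headPoly, finsetSum_coeff]
  refine sum_mem fun r hr => ?_
  rw [coeff_C_mul]
  exact mul_mem (hv r (Finset.mem_range.1 hr)) (coeff_pow_mem hu r j hj)

namespace Params

variable {m g : ℕ} {ρ : Fin (m + 2) → ℕ} {P : Finset (Fin m × ℕ)}

/-- The universal slice. -/
def universal (d g : ℕ) (ρ : Fin (m + 2) → ℕ) (P : Finset (Fin m × ℕ)) :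
    SliceData m d g ρ (MvPolynomial (Params d g ρ P) ℂ) :=
  slice MvPolynomial.X

theorem map_universal {R : Type*} [CommRing R] (φ : MvPolynomial (Params d g ρ P) ℂ →+* R) :
    (universal d g ρ P).map φ = slice fun j => φ (MvPolynomial.X j) :=
  map_slice φ _

theorem map_eval_universal (t : Params d g ρ P → ℂ) :
    (universal d g ρ P).map (MvPolynomial.eval t) = slice t := by
  rw [map_universal]
  congr 1
  ext j
  exact MvPolynomial.eval_X j

theorem eval_coeffs_universal (t : Params d g ρ P → ℂ) (q : Fin (m + 2) × Fin (d + 1)) :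
    MvPolynomial.eval t ((universal d g ρ P).coeffs q) = (slice t).coeffs q := by
  rw [← map_eval_universal, SliceData.coeffs_map]

/-- The matrix that expresses the last rows in terms of the adapted basis is generically
invertible. -/
theorem det_A_ne_zero : (Matrix.of (universal d g ρ P).A).det ≠ 0 := by
  intro h
  let t : Params d g ρ P → ℂ := Sum.elim 0 (Sum.elim 0 (Sum.elim 0 (Sum.elim 0 (Sum.elim 0
    (Sum.elim (fun q => if q.2 = q.1.succ.succ then 1 else 0) 0)))))
  have h1 := congrArg (MvPolynomial.eval t) h
  rw [RingHom.map_det, map_zero] at h1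
  have h2 : (MvPolynomial.eval t).mapMatrix (Matrix.of (universal d g ρ P).A) = 1 := by
    ext j l
    rw [RingHom.mapMatrix_apply, Matrix.map_apply, Matrix.of_apply]
    change MvPolynomial.eval t (MvPolynomial.X _) = _
    rw [MvPolynomial.eval_X]
    change (if l.succ.succ = j.succ.succ then (1 : ℂ) else 0) = _
    rw [Matrix.one_apply]
    simp only [Fin.succ_inj, eq_comm]
  rw [h2, Matrix.det_one] at h1
  exact one_ne_zero h1

/-- The dimension of a set that is parameterized by slices. -/
theorem zariskiDim_eq (hg : 0 < g) (hd : 2 * g ≤ d + 2) (hρ : StrictMono ρ) (hρ0 : ρ 0 = 0)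
    (hρ1 : ρ 1 = 1) (hρD : ∀ i, ρ i < g + (d + 1 - 2 * g)) (hP : ∀ q ∈ P, q.2 ∉ Set.range ρ)
    (hPD : ∀ q ∈ P, q.2 < g + (d + 1 - 2 * g)) {t₀ : Params d g ρ P → ℂ}
    (hf : (slice t₀).f.coeff 0 ≠ 0) (hw : (slice t₀).w 1 ≠ 0)
    (hdet : d + 1 < 2 * g → (pivotMatrix g ρ (u t₀) (frame (v₀ t₀) (w t₀) (V t₀))).det ≠ 0)
    (Z : Set (CoeffSpace (m + 1) d))
    (hZ : ∀ h : MvPolynomial (Fin (m + 2) × Fin (d + 1)) ℂ,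
      (∀ z ∈ Z, MvPolynomial.eval z h = 0) ↔
        MvPolynomial.aeval (universal d g ρ P).coeffs h = 0) :
    zariskiDim Z = Fintype.card (Params d g ρ P) := by
  refine zariskiDim_eq_card Z (FractionRing (MvPolynomial (Params d g ρ P) ℂ)) _ hZ ?_
  set L := FractionRing (MvPolynomial (Params d g ρ P) ℂ)
  set φ := algebraMap (MvPolynomial (Params d g ρ P) ℂ) L
  have hinj : Function.Injective φ := IsFractionRing.injective _ _
  have : CharZero L := charZero_of_injective_algebraMap hinj
  intro K hK _ hΨ
  -- Nonvanishing at the single point `t₀` implies generic nonvanishing, so the universal slice over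
  -- the function field satisfies the hypotheses for recovering parameters.
  have hφ : ∀ b : MvPolynomial (Params d g ρ P) ℂ, MvPolynomial.eval t₀ b ≠ 0 → φ b ≠ 0 := by
    intro b hb h0
    rw [map_eq_zero_iff φ hinj] at h0
    rw [h0, map_zero] at hb
    exact hb rfl
  set T : Params d g ρ P → L := fun j => φ (MvPolynomial.X j)
  have hT : (universal d g ρ P).map φ = slice T := map_universal φ
  have hT0 : (universal d g ρ P).map (MvPolynomial.eval t₀) = slice t₀ := map_eval_universal t₀
  have hN : (slice T).IsNormal := isNormal hg hd hρ hρD hP T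
  have hfT : (slice T).f.coeff 0 ≠ 0 := by
    rw [← hT]
    change ((universal d g ρ P).f.map φ).coeff 0 ≠ 0
    rw [coeff_map]
    refine hφ _ ?_
    rw [← coeff_map]
    rw [← hT0] at hf
    exact hf
  have hwT : (slice T).w 1 ≠ 0 := by
    rw [← hT]
    refine hφ ((universal d g ρ P).w 1) ?_
    rw [← hT0] at hw
    exact hw
  have hAT : (Matrix.of (slice T).A).det ≠ 0 := by
    have h1 : Matrix.of (slice T).A = φ.mapMatrix (Matrix.of (universal d g ρ P).A) := by
      rw [← hT]; rfl
    rw [h1, ← RingHom.map_det, Ne, map_eq_zero_iff φ hinj]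
    exact det_A_ne_zero
  obtain ⟨hs, hfK, huK, hc, hvK, hAK⟩ := hN.parameters_mem hK hg hρ0 hρ1 hρD hfT hwT hAT
    fun q => by rw [← hT, SliceData.coeffs_map]; exact hΨ q
  rintro (j | j | j | j | j | j | j)
  · fin_cases j
    exacts [hs, hc]
  · have hj : (j : ℕ) < 2 * g ∧ (j : ℕ) ∉ boundExponents d g ρ := by
      have := j.2; rw [Finset.mem_sdiff, Finset.mem_range] at this; exact this
    have h1 := hfK j hj.1
    have h2 : (y T).coeff j = T (.inr (.inl j)) := by rw [coeff_y, extendZero_coe]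
    change T (.inr (.inl j)) ∈ K
    rw [← h2]
    change (corrected d g ρ (u T) (frame (v₀ T) (w T) (V T)) (y T)).coeff j ∈ K at h1
    -- Here a free coefficient of f is the parameter times the determinant of the pivot matrix,
    -- whose entries involve only parameters already recovered.
    by_cases hdg : d + 1 < 2 * g
    · rw [coeff_corrected hdg _ _ _ hj.2] at h1
      have hPK : (pivotMatrix g ρ (u T) (frame (v₀ T) (w T) (V T))).det ∈ K := by
        refine det_mem fun i l => ?_
        have := hρD l
        refine coeff_headPoly_mem huK (fun r hr => ?_) _ (by omega)
        have hr' := hvK r (by omega)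
        exact Fin.cases hr'.1 (fun i => Fin.cases hr'.2.1 (fun l => hr'.2.2 l) i) i
      have hP0 : (pivotMatrix g ρ (u T) (frame (v₀ T) (w T) (V T))).det ≠ 0 := by
        have hmap : ∀ {R : Type} [CommRing R] (ψ : MvPolynomial (Params d g ρ P) ℂ →+* R),
            ψ (pivotMatrix g ρ (u MvPolynomial.X) (frame (v₀ MvPolynomial.X) (w MvPolynomial.X)
              (V MvPolynomial.X))).det =
            (pivotMatrix g ρ (u fun j => ψ (.X j)) (frame (v₀ fun j => ψ (.X j))
              (w fun j => ψ (.X j)) (V fun j => ψ (.X j)))).det := by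
          intro R _ ψ
          rw [RingHom.map_det, map_pivotMatrix, map_frame, map_u]
          simp only [map_v₀, map_w, map_V]
          rfl
        rw [← hmap φ]
        refine hφ _ ?_
        rw [hmap]
        simp only [MvPolynomial.eval_X]
        exact hdet hdg
      have h3 := mul_mem (inv_mem hPK) h1
      rwa [inv_mul_cancel_left₀ hP0] at h3
    · rwa [corrected, if_neg hdg] at h1
  · have hj := Finset.mem_Ico.1 j.2
    have h1 := huK j hj.2
    change (u T).coeff j ∈ K at h1
    rwa [coeff_u, if_neg (by omega), extendZero_coe] at h1
  · have hj := Finset.mem_Ico.1 j.2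
    have h1 := (hvK j hj.2).1
    change v₀ T j ∈ K at h1
    rwa [v₀, if_neg (by omega), extendZero_coe] at h1
  · have hj : (j : ℕ) < g + (d + 1 - 2 * g) := by
      rcases Finset.mem_insert.1 j.2 with h | h
      · have := hρD 1; omega
      · exact (Finset.mem_Ico.1 h).2
    have h1 := (hvK j hj).2.1
    change w T j ∈ K at h1
    rwa [w, extendZero_coe] at h1
  · obtain ⟨j, l⟩ := j
    exact Fin.cases (hAK j).1 (fun l => Fin.cases (hAK j).2.1 (fun l => (hAK j).2.2 l) l) l
  · have h1 := (hvK j.1.2 (hPD _ j.2)).2.2 j.1.1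
    change V T j.1.1 j.1.2 ∈ K at h1
    rw [V, if_neg] at h1
    · rwa [extendZero_coe] at h1
    · exact fun h => hP _ j.2 ⟨_, h.symm⟩

end Params


/-! ### Density of the curves in general position -/

theorem monomialSpan_eq_pow (a : CoeffSpace n d) (N : ℕ) :
    monomialSpan a N = monomialSpan a 1 ^ N := by
  rw [monomialSpan, monomialSpan, pow_one]

theorem IsHyperellipticAt.congr {g : ℕ} {a b : CoeffSpace n d} {p : OnePoint ℂ}
    (h : IsHyperellipticAt g a p) (hab : monomialSpan a 1 = monomialSpan b 1) :
    IsHyperellipticAt g b p := by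
  have hN : ∀ N, monomialSpan b N = monomialSpan a N := fun N => by
    rw [monomialSpan_eq_pow, ← hab, ← monomialSpan_eq_pow]
  refine ⟨fun M F hF => h.mem_semigroup M F (hN M ▸ hF), ?_⟩
  obtain ⟨N, h1, h2⟩ := h.exists_form
  exact ⟨N, h1, fun s hs hs' => by rw [hN]; exact h2 s hs hs'⟩

theorem rowPoly_ext {F : ℂ[X]} (hF : F ∈ formSpace d) {a : CoeffSpace n d} {i : Fin (n + 1)}
    (h : ∀ j : Fin (d + 1), a (i, j) = F.coeff j) : rowPoly a i = F := by
  ext j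
  by_cases hj : j < d + 1
  · rw [← h ⟨j, hj⟩]
    exact rowPoly_coeff a i ⟨j, hj⟩
  · rw [coeff_eq_zero_of_natDegree_lt, coeff_eq_zero_of_natDegree_lt]
    · have := mem_formSpace.1 hF; omega
    · have := mem_formSpace.1 (rowPoly_mem a i); omega

theorem eval_aeval_arc {σ : Type*} (γ : σ → ℂ[X]) (Q : MvPolynomial σ ℂ) (t : ℂ) :
    (MvPolynomial.aeval γ Q).eval t = MvPolynomial.eval (fun i => (γ i).eval t) Q := by
  have h : (evalRingHom t).comp (algebraMap ℂ ℂ[X]) = RingHom.id ℂ := by ext; simp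
  rw [← coe_evalRingHom, MvPolynomial.aeval_def, MvPolynomial.hom_eval₂, h]
  rfl

/-- If a polynomial vanishes at almost all points of a polynomial arc through `a`, it vanishes at
`a`. -/
theorem eval_eq_zero_of_arc {σ : Type*} {a : σ → ℂ} (γ : σ → ℂ[X]) (hγ : ∀ i, (γ i).eval 0 = a i)
    {q : ℂ[X]} (hq : q ≠ 0) {h : MvPolynomial σ ℂ}
    (hh : ∀ t, q.eval t ≠ 0 → MvPolynomial.eval (fun i => (γ i).eval t) h = 0) :
    MvPolynomial.eval a h = 0 := by
  have hev := eval_aeval_arc γ h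
  have h0 : q * MvPolynomial.aeval γ h = 0 := by
    refine Polynomial.funext fun t => ?_
    rw [eval_mul, eval_zero, hev]
    by_cases hqt : q.eval t = 0
    · rw [hqt, zero_mul]
    · rw [hh t hqt, mul_zero]
  have h1 := (mul_eq_zero.1 h0).resolve_left hq
  have h2 := hev 0
  rw [h1, eval_zero] at h2
  rw [← funext hγ, ← h2]

/-- The first two rows are moved along a line, by `t` times forms of orders 0 and 2 from the same
span. For almost all `t` the span is unchanged, hence so are the semigroup and the vanishing orders,
and the curve is in general position. -/
theorem eval_eq_zero_of_generalPosition {m g : ℕ} (hg : 0 < g) {a : CoeffSpace (m + 1) d} {s : ℂ}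
    (ha : IsUnicuspidalAt g (hyperellipticSemigroup g) a (s : OnePoint ℂ))
    {h : MvPolynomial (Fin (m + 2) × Fin (d + 1)) ℂ}
    (hh : ∀ b : CoeffSpace (m + 1) d, IsUnicuspidalAt g (hyperellipticSemigroup g) b (s : OnePoint ℂ) →
      vanishingOrders b (s : OnePoint ℂ) = vanishingOrders a (s : OnePoint ℂ) →
      InGeneralPosition b s → MvPolynomial.eval b h = 0) : MvPolynomial.eval a h = 0 := by
  have hhyp := isHyperellipticAt_of_isUnicuspidalAt ha
  obtain ⟨⟨ham, -⟩, -⟩ := ha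
  obtain ⟨G₀, hG₀, hG₀'⟩ := exists_form_ordAt_zero (ham.2 s)
  obtain ⟨G₁, hG₁, hG₁'⟩ := hhyp.exists_form_two hg (ham.2 s)
  have hG₀c := (ordAt_coe_eq_iff (m := 0) (mem_formSpace_of_mem_one hG₀)).1 hG₀'
  have hG₁c := (ordAt_coe_eq_iff (m := 2) (mem_formSpace_of_mem_one hG₁)).1 hG₁'
  obtain ⟨Q, hQ, hQ'⟩ := exists_certificate a (linearIndependent_iff_finrank.1 ham.1)
  set G : Fin (m + 2) → ℂ[X] := Fin.cases G₀ (Fin.cases G₁ fun _ => 0) with hG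
  have hGm : ∀ i, G i ∈ monomialSpan a 1 := fun i =>
    Fin.cases hG₀ (fun i => Fin.cases hG₁ (fun _ => zero_mem _) i) i
  set γ : Fin (m + 2) × Fin (d + 1) → ℂ[X] := fun q => C (a q) + C ((G q.1).coeff q.2) * X with hγ
  have hγ0 : ∀ q, (γ q).eval 0 = a q := fun q => by simp [hγ]
  have hrow : ∀ t i, rowPoly (n := m + 1) (fun q => (γ q).eval t) i = rowPoly a i + t • G i := by
    intro t i
    refine rowPoly_ext (add_mem (rowPoly_mem a i)
      (Submodule.smul_mem _ _ (mem_formSpace_of_mem_one (hGm i)))) fun j => ?_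
    change (C (a (i, j)) + C ((G i).coeff j) * X).eval t = _
    rw [eval_add, eval_mul, eval_C, eval_C, eval_X, coeff_add, coeff_smul, rowPoly_coeff,
      smul_eq_mul, mul_comm]
  obtain ⟨q, hq⟩ : ∃ q : ℂ[X], ∀ t, q.eval t = MvPolynomial.eval (fun i => (γ i).eval t) Q :=
    ⟨_, eval_aeval_arc γ Q⟩
  set T : Fin (m + 2) → ℕ → ℂ := fun i j => (taylor s (rowPoly a i)).coeff j
  set T' : Fin (m + 2) → ℕ → ℂ := fun i j => (taylor s (G i)).coeff j
  have hT'0 : T' 0 0 ≠ 0 := hG₀c.1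
  have hT'1 : T' 1 0 = 0 := hG₁c.2 0 (by omega)
  have hT'2 : T' 1 2 ≠ 0 := hG₁c.1
  set ℓ : Fin (m + 2) → ℕ → ℂ[X] := fun i j => C (T i j) + C (T' i j) * X
  have hℓ : ∀ t i j, (ℓ i j).eval t = (taylor s (rowPoly a i + t • G i)).coeff j := by
    intro t i j
    change (C (T i j) + C (T' i j) * X).eval t = _
    rw [eval_add, eval_mul, eval_C, eval_C, eval_X, map_add, map_smul, coeff_add, coeff_smul,
      smul_eq_mul, mul_comm]
  -- The factors express that the rows stay independent, that the first form does not vanish at the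
  -- cusp, and that the coefficients of 1 and t^2 in the first two forms have nonzero determinant.
  set q' := q * ℓ 0 0 * (ℓ 1 2 * ℓ 0 0 - ℓ 1 0 * ℓ 0 2) with hq'
  have hq0 : q' ≠ 0 := by
    refine mul_ne_zero (mul_ne_zero ?_ ?_) ?_
    · intro h0
      have := hq 0
      rw [h0, eval_zero, funext hγ0] at this
      exact hQ this.symm
    · intro h0
      have := congrArg (fun F => coeff F 1) h0
      simp [ℓ] at this
      exact hT'0 this
    · intro h0
      have := congrArg (fun F => coeff F 2) h0
      have e : ℓ 1 2 * ℓ 0 0 - ℓ 1 0 * ℓ 0 2 = C (T 1 2 * T 0 0 - T 1 0 * T 0 2) +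
          C (T 1 2 * T' 0 0 + T' 1 2 * T 0 0 - T 1 0 * T' 0 2) * X +
          C (T' 1 2 * T' 0 0) * X ^ 2 := by
        simp only [ℓ, hT'1, C_0, C_add, C_sub, C_mul]
        ring
      rw [e] at this
      simp only [coeff_add, coeff_C_mul, coeff_C, coeff_X, coeff_X_pow, coeff_zero] at this
      norm_num at this
      exact this.elim hT'2 hT'0
  refine eval_eq_zero_of_arc γ hγ0 hq0 fun t ht => ?_
  rw [hq', eval_mul, eval_mul, hq] at ht
  have hfin := hQ' _ (left_ne_zero_of_mul (left_ne_zero_of_mul ht))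
  have h00 := right_ne_zero_of_mul (left_ne_zero_of_mul ht)
  have hmin := right_ne_zero_of_mul ht
  set b : CoeffSpace (m + 1) d := fun q => (γ q).eval t with hb
  have hspan : monomialSpan b 1 = monomialSpan a 1 := by
    refine Submodule.eq_of_le_of_finrank_le ?_ ((finrank_monomialSpan_one_le a).trans hfin)
    rw [monomialSpan, pow_one, Submodule.span_le]
    rintro _ ⟨i, rfl⟩
    change rowPoly b i ∈ monomialSpan a 1
    rw [hrow]
    exact add_mem (rowPoly_mem_monomialSpan a i) (Submodule.smul_mem _ _ (hGm i))
  have hbhyp := hhyp.congr hspan.symm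
  refine hh b (isUnicuspidalAt_of_isHyperellipticAt (linearIndependent_iff_finrank.2 hfin) hbhyp)
    ?_ ?_
  · ext k
    rw [mem_vanishingOrders, mem_vanishingOrders, hspan]
  · rw [hℓ, ← hrow] at h00
    rw [eval_sub, eval_mul, eval_mul, hℓ, hℓ, hℓ, hℓ, ← hrow, ← hrow] at hmin
    refine ⟨(ordAt_coe_eq_iff (m := 0) (rowPoly_mem b 0)).2 ⟨h00, by simp⟩,
      (taylor s (rowPoly b 1)).coeff 0 / (taylor s (rowPoly b 0)).coeff 0, ?_⟩
    set F₀ := rowPoly b 0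
    set F₁ := rowPoly b 1
    set c := (taylor s F₁).coeff 0 / (taylor s F₀).coeff 0 with hc
    have hF : F₁ - c • F₀ ∈ monomialSpan b 1 :=
      sub_mem (rowPoly_mem_monomialSpan b 1)
        (Submodule.smul_mem _ _ (rowPoly_mem_monomialSpan b 0))
    have h0 : (taylor s (F₁ - c • F₀)).coeff 0 = 0 := by
      rw [map_sub, map_smul, coeff_sub, coeff_smul, smul_eq_mul, hc, div_mul_cancel₀ _ h00, sub_self]
    have h2 : (taylor s (F₁ - c • F₀)).coeff 2 ≠ 0 := by
      intro h2
      rw [map_sub, map_smul, coeff_sub, coeff_smul, smul_eq_mul, hc, sub_eq_zero] at h2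
      apply hmin
      rw [h2]
      field_simp
      ring
    have hne : F₁ - c • F₀ ≠ 0 := fun h => h2 (by rw [h]; simp)
    obtain ⟨k, -, hk⟩ := exists_ordAt_eq (p := (s : OnePoint ℂ)) (mem_formSpace_of_mem_one hF) hne
    have hsem := hbhyp.mem_semigroup 1 _ hF k (by rw [one_mul]; exact hk)
    have hkc := (ordAt_coe_eq_iff (mem_formSpace_of_mem_one hF)).1 hk
    have hk0 : k ≠ 0 := by rintro rfl; exact hkc.1 h0
    have hk2 : k ≤ 2 := by
      by_contra hlt
      exact h2 (hkc.2 2 (by omega))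
    -- The order is 1 or 2, and 1 is not in the semigroup.
    have : k = 2 := by
      rcases hsem with ⟨l, rfl⟩ | h3 <;> omega
    rw [hk, this]; rfl

/-! ### Moving the cusp away from infinity -/

/-- The substitution `X₁ ↦ X₁ - t X₀` in forms of degree `e`. -/
abbrev shear (e : ℕ) (t : ℂ) : ℂ[X] →ₗ[ℂ] ℂ[X] := homEval e (X : ℂ[X]) (1 - C t * X)

theorem shear_mem (e : ℕ) (t : ℂ) (F : ℂ[X]) : shear e t F ∈ formSpace e := by
  rw [shear, homEval_apply]
  refine sum_mem fun j hj => Submodule.smul_mem _ _ ?_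
  have hj' : j ≤ e := Nat.lt_succ_iff.1 (Finset.mem_range.1 hj)
  have h1 : (X : ℂ[X]) ∈ formSpace 1 := mem_formSpace.2 natDegree_X_le
  have h2 : (1 - C t * X : ℂ[X]) ∈ formSpace 1 :=
    sub_mem (mem_formSpace.2 (by simp)) (mem_formSpace.2 ((natDegree_C_mul_le t X).trans natDegree_X_le))
  have := mul_mem_formSpace (pow_mem_formSpace h1 j) (pow_mem_formSpace h2 (e - j))
  rwa [mul_one, mul_one, Nat.add_sub_cancel' hj'] at this

theorem shear_zero {e : ℕ} {F : ℂ[X]} (hF : F ∈ formSpace e) : shear e 0 F = F := by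
  conv_rhs => rw [formSpace_eq_sum hF]
  rw [shear, homEval_apply]
  simp

/-- The substitution carries infinity to `t⁻¹`: the linear form at infinity becomes a multiple of
the one at `t⁻¹`. Dividing by it reduces the claim to forms that do not vanish at infinity. -/
theorem ordAt_shear {t : ℂ} (ht : t ≠ 0) {e : ℕ} {F : ℂ[X]} (hF : F ∈ formSpace e) :
    ordAt e ((t⁻¹ : ℂ) : OnePoint ℂ) (shear e t F) = ordAt e OnePoint.infty F := by
  have hzero : ∀ {e : ℕ} {F : ℂ[X]}, F ∈ formSpace e → ordAt e OnePoint.infty F = 0 →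
      ordAt e ((t⁻¹ : ℂ) : OnePoint ℂ) (shear e t F) = 0 := by
    intro e F hF h0
    rw [ordAt_eq_zero_iff, constantCoeff_expansion_infty] at h0
    rw [ordAt_eq_zero_iff, constantCoeff_expansion_coe (shear_mem e t F), shear, homEval_apply,
      eval_finsetSum, Finset.sum_eq_single e]
    · simp [h0, ht]
    · intro j hj hje
      have : e - j ≠ 0 := by rw [Finset.mem_range] at hj; omega
      simp [ht, this]
    · simp
  induction e generalizing F with
  | zero =>
    by_cases h0 : ordAt 0 OnePoint.infty F = 0
    · rw [h0, hzero hF h0]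
    · have hc : F.coeff 0 = 0 := by
        rwa [ordAt_eq_zero_iff, constantCoeff_expansion_infty, not_not] at h0
      have : F = 0 := by
        rw [eq_C_of_natDegree_le_zero (mem_formSpace.1 hF), hc, C_0]
      rw [this, map_zero, (ordAt_eq_top_iff (zero_mem _)).2 rfl, (ordAt_eq_top_iff (zero_mem _)).2 rfl]
  | succ e ih =>
    by_cases h0 : ordAt (e + 1) OnePoint.infty F = 0
    · rw [h0, hzero hF h0]
    · obtain ⟨G, hG, rfl⟩ := exists_eq_pointForm_mul hF h0
      have h1 : ordAt 1 ((t⁻¹ : ℂ) : OnePoint ℂ) (shear 1 t (pointForm OnePoint.infty)) = 1 := by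
        have e1 : shear 1 t (pointForm OnePoint.infty) = (-t) • pointForm ((t⁻¹ : ℂ) : OnePoint ℂ) := by
          rw [shear, homEval_apply]
          simp [pointForm, coeff_one]
          rw [smul_sub, smul_eq_C_mul, smul_eq_C_mul, ← C_mul, mul_inv_cancel₀ ht]
          simp
        rw [e1, ordAt_smul_of_ne_zero (neg_ne_zero.2 ht), ordAt_pointForm_self]
      rw [add_comm e 1, ordAt_mul (pointForm_mem _) hG, shear, homEval_mul _ _ (pointForm_mem _) hG,
        ordAt_mul (shear_mem 1 t _) (shear_mem e t G), ih hG, h1, ordAt_pointForm_self]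

theorem shear_monomialSpan {a b : CoeffSpace n d} {t : ℂ}
    (hab : ∀ i, rowPoly b i = shear d t (rowPoly a i)) {M : ℕ} {F : ℂ[X]}
    (hF : F ∈ monomialSpan a M) : shear (M * d) t F ∈ monomialSpan b M := by
  have hone : ∀ H ∈ monomialSpan a 1, shear (1 * d) t H ∈ monomialSpan b 1 := by
    intro H hH
    obtain ⟨c, rfl⟩ := mem_monomialSpan_one.1 hH
    rw [one_mul, mem_monomialSpan_one]
    exact ⟨c, by simp only [map_sum, map_smul, hab]⟩
  refine monomialSpan_induction (P := fun M F => shear (M * d) t F ∈ monomialSpan b M)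
    (fun c => ?_) (fun M G hG H hH hP => ?_) (fun M G _ H _ hP hP' => ?_) hF
  · have : shear (0 * d) t (algebraMap ℂ ℂ[X] c) = algebraMap ℂ ℂ[X] c := by
      rw [zero_mul, shear, homEval_apply]
      simp [smul_eq_C_mul]
    rw [this, monomialSpan, pow_zero]
    exact Submodule.algebraMap_mem c
  · rw [add_mul, shear, homEval_mul _ _ (monomialSpan_le _ _ hG) (monomialSpan_le _ _ hH)]
    exact mul_mem_monomialSpan hP (hone H hH)
  · rw [map_add]; exact add_mem hP hP'

theorem exists_shear_eq {a b : CoeffSpace n d} {t : ℂ}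
    (hab : ∀ i, rowPoly b i = shear d t (rowPoly a i)) {M : ℕ} {F : ℂ[X]}
    (hF : F ∈ monomialSpan b M) : ∃ G ∈ monomialSpan a M, shear (M * d) t G = F := by
  refine monomialSpan_induction (P := fun M F => ∃ G ∈ monomialSpan a M, shear (M * d) t G = F)
    (fun c => ?_) ?_ ?_ hF
  · refine ⟨algebraMap ℂ ℂ[X] c, ?_, ?_⟩
    · rw [monomialSpan, pow_zero]
      exact Submodule.algebraMap_mem c
    · rw [zero_mul, shear, homEval_apply]
      simp [smul_eq_C_mul]
  · rintro M _ _ H hH ⟨G, hG, rfl⟩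
    obtain ⟨c, rfl⟩ := mem_monomialSpan_one.1 hH
    have hm : ∑ i, c i • rowPoly a i ∈ monomialSpan a 1 := mem_monomialSpan_one.2 ⟨c, rfl⟩
    refine ⟨G * ∑ i, c i • rowPoly a i, mul_mem_monomialSpan hG hm, ?_⟩
    rw [add_mul, shear, homEval_mul _ _ (monomialSpan_le _ _ hG) (monomialSpan_le _ _ hm), one_mul]
    congr 1
    simp only [map_sum, map_smul, hab]
  · rintro M _ _ _ _ ⟨G, hG, rfl⟩ ⟨G', hG', rfl⟩
    exact ⟨G + G', add_mem hG hG', map_add _ _ _⟩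

/-- The sheared curves form a polynomial arc through `a` at `t = 0`. For nonzero `t` the cusp is at
the finite point `t⁻¹`, with the same vanishing orders. -/
theorem eval_eq_zero_of_infty {g : ℕ} {a : CoeffSpace n d}
    (ha : IsUnicuspidalAt g (hyperellipticSemigroup g) a OnePoint.infty) {k : Fin (n + 1) → ℕ}
    (hk : StrictMono k) (hka : Set.range k = vanishingOrders a OnePoint.infty)
    {h : MvPolynomial (Fin (n + 1) × Fin (d + 1)) ℂ}
    (hh : ∀ (b : CoeffSpace n d) (s : ℂ),
      IsUnicuspidalAt g (hyperellipticSemigroup g) b (s : OnePoint ℂ) →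
      Set.range k = vanishingOrders b (s : OnePoint ℂ) → MvPolynomial.eval b h = 0) :
    MvPolynomial.eval a h = 0 := by
  have hhyp := isHyperellipticAt_of_isUnicuspidalAt ha
  -- The inner variable `C X` is the parameter of the arc.
  set γ : Fin (n + 1) × Fin (d + 1) → ℂ[X] := fun q =>
    (homEval d (X : ℂ[X][X]) (1 - C X * X) (rowPoly a q.1)).coeff q.2 with hγ
  have hγt : ∀ t q, (γ q).eval t = (shear d t (rowPoly a q.1)).coeff q.2 := by
    intro t q
    have : mapAlgHom (aeval t : ℂ[X] →ₐ[ℂ] ℂ)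
        (homEval d (X : ℂ[X][X]) (1 - C X * X) (rowPoly a q.1)) = shear d t (rowPoly a q.1) := by
      rw [shear, homEval_apply, homEval_apply]
      simp only [map_sum, map_smul, map_mul, map_pow, map_sub, map_one]
      simp
    rw [← this, coe_mapAlgHom, coeff_map, hγ]
    simp
  refine eval_eq_zero_of_arc γ (fun q => ?_) X_ne_zero fun t ht => ?_
  · rw [hγt, shear_zero (rowPoly_mem a _), rowPoly_coeff]
  · rw [eval_X] at ht
    set b : CoeffSpace n d := fun q => (γ q).eval t
    have hab : ∀ i, rowPoly b i = shear d t (rowPoly a i) := fun i =>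
      rowPoly_ext (shear_mem d t _) fun j => hγt t (i, j)
    have hbhyp : IsHyperellipticAt g b ((t⁻¹ : ℂ) : OnePoint ℂ) := by
      refine ⟨fun M F hF s hs => ?_, ?_⟩
      · obtain ⟨G, hG, rfl⟩ := exists_shear_eq hab hF
        rw [ordAt_shear ht (monomialSpan_le _ _ hG)] at hs
        exact hhyp.mem_semigroup M G hG s hs
      · obtain ⟨N, hN, hN'⟩ := hhyp.exists_form
        refine ⟨N, hN, fun s hs hs' => ?_⟩
        obtain ⟨F, hF, hFs⟩ := hN' s hs hs'
        exact ⟨_, shear_monomialSpan hab hF, by rw [ordAt_shear ht (monomialSpan_le _ _ hF), hFs]⟩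
    have hvan : Set.range k = vanishingOrders b ((t⁻¹ : ℂ) : OnePoint ℂ) := by
      rw [hka]
      ext s
      rw [mem_vanishingOrders, mem_vanishingOrders]
      constructor
      · rintro ⟨F, hF, hFs⟩
        have h1 := shear_monomialSpan hab hF
        rw [one_mul] at h1
        exact ⟨_, h1, by rw [ordAt_shear ht (mem_formSpace_of_mem_one hF), hFs]⟩
      · rintro ⟨F, hF, hFs⟩
        obtain ⟨G, hG, rfl⟩ := exists_shear_eq hab hF
        rw [one_mul, ordAt_shear ht (mem_formSpace_of_mem_one hG)] at hFs
        exact ⟨G, hG, hFs⟩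
    refine hh b t⁻¹ (isUnicuspidalAt_of_isHyperellipticAt (linearIndependent_iff_finrank.2 ?_) hbhyp)
      hvan
    exact card_le_finrank_of_strictMono_ordAt (fun F hF => mem_formSpace_of_mem_one hF)
      (p := ((t⁻¹ : ℂ) : OnePoint ℂ)) hk fun i =>
        mem_vanishingOrders.1 (hvan ▸ Set.mem_range_self i)


/-! ### Dimensions of unions and of the space of morphisms -/

theorem zariskiDim_mono {σ : Type} {Z Z' : Set (σ → ℂ)} (h : Z ⊆ Z') :
    zariskiDim Z ≤ zariskiDim Z' :=
  ringKrullDim_le_of_surjective (Ideal.Quotient.factor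
    (show MvPolynomial.vanishingIdeal (k := ℂ) Z' ≤ MvPolynomial.vanishingIdeal (k := ℂ) Z from
      fun _ hf x hx => hf x (h hx))) (Ideal.Quotient.factor_surjective _)

/-- The smallest prime of a chain over the ideal of the union contains one of the finitely many
ideals, so the whole chain lies over that piece. -/
theorem zariskiDim_iUnion_le {σ ι : Type} [Finite ι] {Z : ι → Set (σ → ℂ)} {b : WithBot ℕ∞}
    (h : ∀ i, zariskiDim (Z i) ≤ b) : zariskiDim (⋃ i, Z i) ≤ b := by
  have := Fintype.ofFinite ι
  have hI : Finset.univ.inf (fun i => MvPolynomial.vanishingIdeal (k := ℂ) (Z i)) ≤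
      MvPolynomial.vanishingIdeal (k := ℂ) (⋃ i, Z i) := by
    intro f hf x hx
    obtain ⟨i, hi⟩ := Set.mem_iUnion.1 hx
    exact Finset.inf_le (f := fun i => MvPolynomial.vanishingIdeal (k := ℂ) (Z i))
      (Finset.mem_univ i) hf x hi
  rw [zariskiDim, ringKrullDim_quotient, Order.krullDim]
  refine iSup_le fun l => ?_
  have hl := (hI.trans l.head.2)
  obtain ⟨i, -, hi⟩ := ((l.head.1.isPrime).inf_le' (s := Finset.univ)).1 hl
  refine le_trans ?_ (h i)
  rw [zariskiDim, ringKrullDim_quotient]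
  let l' : LTSeries (PrimeSpectrum.zeroLocus
      (MvPolynomial.vanishingIdeal (k := ℂ) (Z i) : Set (MvPolynomial σ ℂ))) :=
    { length := l.length
      toFun := fun j => ⟨(l j).1, hi.trans (show l.head.1 ≤ (l j).1 from l.monotone (Fin.zero_le j))⟩
      step := fun j => l.step j }
  exact Order.LTSeries.length_le_krullDim l'

theorem aeval_eq_zero_of_open {σ τ : Type*} {Ψ : σ → MvPolynomial τ ℂ} {q : MvPolynomial τ ℂ}
    (hq : q ≠ 0) {h : MvPolynomial σ ℂ} (hh : ∀ t, MvPolynomial.eval t q ≠ 0 →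
      MvPolynomial.eval (fun i => MvPolynomial.eval t (Ψ i)) h = 0) :
    MvPolynomial.aeval Ψ h = 0 := by
  have h0 : q * MvPolynomial.aeval Ψ h = 0 := by
    refine MvPolynomial.funext fun t => ?_
    rw [map_mul, map_zero]
    by_cases hqt : MvPolynomial.eval t q = 0
    · rw [hqt, zero_mul]
    · have e : MvPolynomial.eval t (MvPolynomial.aeval Ψ h) =
          MvPolynomial.eval (fun i => MvPolynomial.eval t (Ψ i)) h := by
        have := MvPolynomial.eval₂Hom_bind₁ (RingHom.id ℂ) t Ψ h
        exact this
      rw [e, hh t hqt, mul_zero]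
  exact (mul_eq_zero.1 h0).resolve_left hq

/-- The polynomial map is written with numerators Ψ_i q and denominator q, so that its domain is the
open set on which its values are known to lie in `Z`. -/
theorem isUnirational_of_open {σ τ : Type} [Fintype τ] {Z : Set (σ → ℂ)} {Ψ : σ → MvPolynomial τ ℂ}
    {q : MvPolynomial τ ℂ} (hq : q ≠ 0)
    (hZ : ∀ t, MvPolynomial.eval t q ≠ 0 → (fun i => MvPolynomial.eval t (Ψ i)) ∈ Z)
    (hdense : ∀ h, MvPolynomial.aeval Ψ h = 0 → ∀ z ∈ Z, MvPolynomial.eval z h = 0) :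
    IsUnirational Z := by
  let e := Fintype.equivFin τ
  have hval : ∀ x : Fin (Fintype.card τ) → ℂ, MvPolynomial.eval x (MvPolynomial.rename e q) ≠ 0 →
      (fun i => MvPolynomial.eval x (MvPolynomial.rename e (Ψ i * q)) /
        MvPolynomial.eval x (MvPolynomial.rename e q)) =
      fun i => MvPolynomial.eval (x ∘ e) (Ψ i) := by
    intro x hx
    ext i
    rw [map_mul, map_mul, mul_div_cancel_right₀ _ hx, MvPolynomial.eval_rename]
  refine ⟨Fintype.card τ, fun i => MvPolynomial.rename e (Ψ i * q), MvPolynomial.rename e q,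
    ?_, fun x hx => ?_, fun h hh => hdense h (aeval_eq_zero_of_open hq fun t ht => ?_)⟩
  · rw [Ne, map_eq_zero_iff _ (MvPolynomial.rename_injective _ e.injective)]
    exact hq
  · rw [hval x hx]
    rw [MvPolynomial.eval_rename] at hx
    exact hZ _ hx
  · have ht' : MvPolynomial.eval (t ∘ e.symm) (MvPolynomial.rename e q) ≠ 0 := by
      rw [MvPolynomial.eval_rename, Function.comp_assoc, e.symm_comp_self]; exact ht
    have h1 := hh (t ∘ e.symm) ht'
    rw [hval _ ht', Function.comp_assoc, e.symm_comp_self] at h1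
    exact h1

/-! ### The space of morphisms is dense in affine space -/

theorem valueAt_infty (a : CoeffSpace n d) (i : Fin (n + 1)) :
    valueAt a OnePoint.infty i = (rowPoly a i).coeff d := by
  rw [valueAt, germ_eq_expansion, constantCoeff_expansion_infty]

theorem valueAt_coe (a : CoeffSpace n d) (s : ℂ) (i : Fin (n + 1)) :
    valueAt a (s : OnePoint ℂ) i = (rowPoly a i).eval s := by
  rw [valueAt, germ_eq_expansion, constantCoeff_expansion_coe (rowPoly_mem a i)]

/-- A polynomial that vanishes on the space of morphisms is zero. -/
theorem eq_zero_of_morphismSpace {m : ℕ} (hne : (morphismSpace (m + 1) d).Nonempty)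
    {h : MvPolynomial (Fin (m + 2) × Fin (d + 1)) ℂ}
    (hh : ∀ z ∈ morphismSpace (m + 1) d, MvPolynomial.eval z h = 0) : h = 0 := by
  obtain ⟨z, hz⟩ := hne
  obtain ⟨Q, hQ, hQ'⟩ := exists_certificate z (linearIndependent_iff_finrank.1 hz.1)
  -- `Q` guarantees independent forms, and the leading coefficient of the first form excludes a
  -- common zero at infinity. Finite common zeros are removed by adding a constant to the second
  -- form.
  have key : h * Q * MvPolynomial.X (0, Fin.last d) = 0 := by
    refine MvPolynomial.funext fun a => ?_
    rw [map_mul, map_zero, MvPolynomial.eval_X]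
    by_cases ha : a (0, Fin.last d) = 0
    · rw [ha, mul_zero]
    have hlead : (rowPoly (n := m + 1) a 0).coeff d ≠ 0 := by
      have := rowPoly_coeff (n := m + 1) a 0 (Fin.last d)
      rw [Fin.val_last] at this
      rwa [this]
    have hrow0 : rowPoly (n := m + 1) a 0 ≠ 0 := fun h0 => hlead (by rw [h0, coeff_zero])
    set γ : Fin (m + 2) × Fin (d + 1) → ℂ[X] := fun q =>
      C (a q) + if q = (1, 0) then X else 0 with hγ
    have hγ0 : ∀ q, (γ q).eval 0 = a q := fun q => by
      rw [hγ]; simp only [eval_add, eval_C]; split_ifs <;> simp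
    have hb0 : ∀ t, rowPoly (n := m + 1) (fun q => (γ q).eval t) 0 = rowPoly (n := m + 1) a 0 := by
      intro t
      refine rowPoly_ext (rowPoly_mem _ _) fun j => ?_
      rw [rowPoly_coeff]
      simp only [hγ, eval_add, eval_C, Prod.mk.injEq]
      rw [if_neg (by simp), eval_zero, add_zero]
    have hb1 : ∀ t, rowPoly (n := m + 1) (fun q => (γ q).eval t) 1 =
        rowPoly (n := m + 1) a 1 + C t := by
      intro t
      refine rowPoly_ext (add_mem (rowPoly_mem _ _) (mem_formSpace.2 (by simp))) fun j => ?_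
      rw [coeff_add, rowPoly_coeff, coeff_C]
      simp only [hγ, eval_add, eval_C, Prod.mk.injEq, true_and]
      by_cases hj : j = 0
      · simp [hj]
      · have : (j : ℕ) ≠ 0 := fun h' => hj (Fin.ext h')
        simp [hj]
    -- The roots of `q` are the constants for which the second form acquires a zero at a root of the
    -- first.
    set q : ℂ[X] := ((rowPoly (n := m + 1) a 0).roots.map
      fun α => C ((rowPoly (n := m + 1) a 1).eval α) + X).prod with hq
    have hq0 : q ≠ 0 := by
      refine (monic_multiset_prod_of_monic _ _ fun α _ => ?_).ne_zero
      rw [add_comm]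
      exact monic_X_add_C _
    have hmul : MvPolynomial.eval a (h * Q) = 0 := by
      refine eval_eq_zero_of_arc γ hγ0 hq0 fun t ht => ?_
      rw [map_mul]
      by_cases hQt : MvPolynomial.eval (fun q => (γ q).eval t) Q = 0
      · rw [hQt, mul_zero]
      rw [hh _ ⟨linearIndependent_iff_finrank.2 (hQ' _ hQt), fun p hp => ?_⟩, zero_mul]
      induction p using OnePoint.rec with
      | infty =>
        have h0 := congrFun hp 0
        rw [valueAt_infty, hb0] at h0
        exact hlead h0
      | coe s =>
        have h0 := congrFun hp 0
        have h1 := congrFun hp 1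
        rw [valueAt_coe, hb0] at h0
        rw [valueAt_coe, hb1, eval_add, eval_C] at h1
        apply ht
        rw [hq, eval_multiset_prod]
        refine Multiset.prod_eq_zero (Multiset.mem_map.2 ⟨C ((rowPoly (n := m + 1) a 1).eval s) + X,
          Multiset.mem_map.2 ⟨s, (mem_roots hrow0).2 h0, rfl⟩, ?_⟩)
        rw [eval_add, eval_C, eval_X]
        exact h1
    rw [hmul, zero_mul]
  rcases mul_eq_zero.1 key with h1 | h1
  · rcases mul_eq_zero.1 h1 with h2 | h2
    · exact h2
    · exact absurd (by rw [h2, map_zero]) hQ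
  · exact absurd h1 (MvPolynomial.X_ne_zero _)

theorem zariskiDim_morphismSpace {m : ℕ} (hne : (morphismSpace (m + 1) d).Nonempty) :
    zariskiDim (morphismSpace (m + 1) d) = ((m + 2) * (d + 1) : ℕ) := by
  rw [zariskiDim_eq_card (morphismSpace (m + 1) d)
    (FractionRing (MvPolynomial (Fin (m + 2) × Fin (d + 1)) ℂ)) MvPolynomial.X]
  · rw [Fintype.card_prod, Fintype.card_fin, Fintype.card_fin]
  · intro h
    rw [MvPolynomial.aeval_X_left, AlgHom.id_apply]
    exact ⟨eq_zero_of_morphismSpace hne, fun h0 z _ => by rw [h0, map_zero]⟩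
  · exact fun K _ _ hX => hX

/-! ### Vanishing sequences -/

theorem exists_vanishingSequence {a : CoeffSpace n d} (p : OnePoint ℂ)
    (hli : LinearIndependent ℂ (fun (i : Fin (n + 1)) (j : Fin (d + 1)) => a (i, j))) :
    ∃ k : Fin (n + 1) → ℕ, StrictMono k ∧ (∀ i, k i ≤ d) ∧ Set.range k = vanishingOrders a p := by
  classical
  set O : Finset ℕ := (Finset.range (d + 1)).filter (· ∈ vanishingOrders a p) with hOdef
  have hle : ∀ F ∈ monomialSpan a 1, ∀ s : ℕ, ordAt d p F = s → s ≤ d := by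
    intro F hF s hs
    have h0 : F ≠ 0 := by
      rintro rfl
      rw [(ordAt_eq_top_iff (zero_mem _)).2 rfl] at hs
      exact ENat.natCast_ne_top s hs.symm
    have := ordAt_le (p := p) (mem_formSpace_of_mem_one hF) h0
    rw [hs] at this
    exact_mod_cast this
  have hO : ∀ s, s ∈ O ↔ s ∈ vanishingOrders a p := by
    intro s
    rw [hOdef, Finset.mem_filter, Finset.mem_range]
    refine ⟨And.right, fun h => ⟨?_, h⟩⟩
    obtain ⟨F, hF, hs⟩ := mem_vanishingOrders.1 h
    exact Nat.lt_succ_of_le (hle F hF s hs)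
  have h1 : O.card ≤ n + 1 := by
    refine le_trans ?_ (finrank_monomialSpan_one_le a)
    refine card_le_finrank_of_strictMono_ordAt (fun F hF => mem_formSpace_of_mem_one hF) (p := p)
      (O.orderEmbOfFin rfl).strictMono fun i => ?_
    exact mem_vanishingOrders.1 ((hO _).1 (O.orderEmbOfFin_mem rfl i))
  have h2 : n + 1 ≤ O.card := by
    by_contra hlt
    have hnot : d + 1 ∉ O := by simp [hOdef]
    -- If there were too few orders, adjoining the impossible order `d + 1` would still leave a set
    -- no larger than the dimension, and `d + 1` would be attained.
    obtain ⟨F, hF, hs⟩ := exists_ordAt_eq_of_card_le (W := monomialSpan a 1) (e := d) (p := p)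
      (O := insert (d + 1) O) (fun F hF => mem_formSpace_of_mem_one hF)
      (fun F hF s hs => Finset.mem_insert_of_mem ((hO s).2 (mem_vanishingOrders.2 ⟨F, hF, hs⟩)))
      (by
        rw [Finset.card_insert_of_notMem hnot]
        have := linearIndependent_iff_finrank.1 hli
        omega) (Finset.mem_insert_self _ _)
    have := hle F hF _ hs
    omega
  have hcard : O.card = n + 1 := le_antisymm h1 h2
  refine ⟨O.orderEmbOfFin hcard, (O.orderEmbOfFin hcard).strictMono, fun i => ?_, ?_⟩
  · have := Finset.mem_range.1 (Finset.mem_filter.1 (O.orderEmbOfFin_mem hcard i)).1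
    omega
  · rw [Finset.range_orderEmbOfFin]
    ext s
    exact hO s

/-- The vanishing sequence at a hyperelliptic cusp, in terms of the adapted basis. -/
theorem exists_pivots {m g : ℕ} (hg : 0 < g) {a : CoeffSpace (m + 1) d} {p : OnePoint ℂ}
    (ha : IsUnicuspidalAt g (hyperellipticSemigroup g) a p) {k : Fin (m + 2) → ℕ}
    (hk : StrictMono k) (hka : Set.range k = vanishingOrders a p) :
    ∃ ρ : Fin (m + 2) → ℕ, StrictMono ρ ∧ ρ 0 = 0 ∧ ρ 1 = 1 ∧
      (∀ i, ρ i < g + (d + 1 - 2 * g)) ∧ k = fun i => colOrder g (ρ i) := by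
  have hhyp := isHyperellipticAt_of_isUnicuspidalAt ha
  obtain ⟨⟨ham, -⟩, -⟩ := ha
  have h1 : ∀ i, ∃ r < g + (d + 1 - 2 * g), colOrder g r = k i := by
    intro i
    obtain ⟨F, hF, hs⟩ := mem_vanishingOrders.1 (hka ▸ Set.mem_range_self i)
    refine exists_colOrder_eq (hhyp.mem_semigroup 1 F hF _ (by rw [one_mul]; exact hs)) ?_
    have h0 : F ≠ 0 := by
      rintro rfl
      rw [(ordAt_eq_top_iff (zero_mem _)).2 rfl] at hs
      exact ENat.natCast_ne_top _ hs.symm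
    have := ordAt_le (p := p) (mem_formSpace_of_mem_one hF) h0
    rw [hs] at this
    exact_mod_cast this
  choose ρ hρD hρk using h1
  have hρ : StrictMono ρ := fun i j hij => by
    rw [← (colOrder_strictMono g).lt_iff_lt, hρk, hρk]
    exact hk hij
  have hk0 : k 0 = 0 := by
    obtain ⟨F, hF, hs⟩ := exists_form_ordAt_zero (ham.2 p)
    obtain ⟨i, hi⟩ : (0 : ℕ) ∈ Set.range k := hka ▸ mem_vanishingOrders.2 ⟨F, hF, hs⟩
    have := hk.monotone (Fin.zero_le i)
    omega
  have hk1 : k 1 ≤ 2 := by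
    obtain ⟨F, hF, hs⟩ := hhyp.exists_form_two hg (ham.2 p)
    obtain ⟨i, hi⟩ : (2 : ℕ) ∈ Set.range k := hka ▸ mem_vanishingOrders.2 ⟨F, hF, hs⟩
    have hi0 : i ≠ 0 := by rintro rfl; omega
    have := hk.monotone (Fin.one_le_of_ne_zero hi0)
    omega
  have e0 : ρ 0 = 0 := by
    have := hρk 0
    rw [hk0, colOrder] at this
    split_ifs at this <;> omega
  have e1 : ρ 1 = 1 := by
    have h3 := hρk 1
    have h4 : ρ 0 < ρ 1 := hρ (by simp)
    rw [colOrder] at h3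
    split_ifs at h3 <;> omega
  exact ⟨ρ, hρ, e0, e1, hρD, funext fun i => (hρk i).symm⟩

/-- Linear forms of the two distinct orders 0 and 2 exist. -/
theorem IsUnicuspidalAt.exists_eq_succ {g : ℕ} (hg : 0 < g) {a : CoeffSpace n d} {p : OnePoint ℂ}
    (ha : IsUnicuspidalAt g (hyperellipticSemigroup g) a p) : ∃ m, n = m + 1 := by
  have hhyp := isHyperellipticAt_of_isUnicuspidalAt ha
  obtain ⟨⟨ham, -⟩, -⟩ := ha
  obtain ⟨F, hF, hs⟩ := exists_form_ordAt_zero (ham.2 p)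
  obtain ⟨F', hF', hs'⟩ := hhyp.exists_form_two hg (ham.2 p)
  obtain ⟨k, hk, -, hka⟩ := exists_vanishingSequence p ham.1
  obtain ⟨i, hi⟩ : (0 : ℕ) ∈ Set.range k := hka ▸ mem_vanishingOrders.2 ⟨F, hF, hs⟩
  obtain ⟨j, hj⟩ : (2 : ℕ) ∈ Set.range k := hka ▸ mem_vanishingOrders.2 ⟨F', hF', hs'⟩
  refine Nat.exists_eq_succ_of_ne_zero ?_
  rintro rfl
  have : i = j := Fin.ext (by omega)
  rw [this] at hi
  omega


/-! ### Parameter counts -/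

section count

variable {m g : ℕ} {ρ : Fin (m + 2) → ℕ}

/-- Pairs of a row and a column that is allowed in this row. -/
def columnPairs (S : Fin m → Finset ℕ) : Finset (Fin m × ℕ) :=
  (Finset.univ.sigma S).map (Equiv.sigmaEquivProd (Fin m) ℕ).toEmbedding

theorem mem_columnPairs {S : Fin m → Finset ℕ} {q : Fin m × ℕ} :
    q ∈ columnPairs S ↔ q.2 ∈ S q.1 := by
  rw [columnPairs, Finset.mem_map_equiv, Finset.mem_sigma]
  simp

theorem card_columnPairs (S : Fin m → Finset ℕ) :
    (columnPairs S).card = ∑ l, (S l).card := by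
  rw [columnPairs, Finset.card_map, Finset.card_sigma]

/-- The columns without pivot. -/
def freeColumns (d g : ℕ) (ρ : Fin (m + 2) → ℕ) (_ : Fin m) : Finset ℕ :=
  Finset.range (g + (d + 1 - 2 * g)) \ Finset.univ.image ρ

/-- The columns without pivot, to the right of the pivot of a given row. -/
def echelonColumns (d g : ℕ) (ρ : Fin (m + 2) → ℕ) (l : Fin m) : Finset ℕ :=
  Finset.Ioo (ρ l.succ.succ) (g + (d + 1 - 2 * g)) \ Finset.univ.image ρ

theorem card_freeColumns (hρ : StrictMono ρ) (hρD : ∀ i, ρ i < g + (d + 1 - 2 * g)) (l : Fin m) :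
    (freeColumns d g ρ l).card + (m + 2) = g + (d + 1 - 2 * g) := by
  have hsub : Finset.univ.image ρ ⊆ Finset.range (g + (d + 1 - 2 * g)) := by
    intro r hr
    obtain ⟨i, -, rfl⟩ := Finset.mem_image.1 hr
    exact Finset.mem_range.2 (hρD i)
  have h1 := Finset.card_sdiff_add_card_eq_card hsub
  rwa [Finset.card_image_of_injective _ hρ.injective, Finset.card_univ, Fintype.card_fin,
    Finset.card_range] at h1

theorem le_of_strictMono (hρ : StrictMono ρ) (i : Fin (m + 2)) : (i : ℕ) ≤ ρ i := by
  have h := Finset.card_le_card (s := (Finset.Iio i).image ρ) (t := Finset.range (ρ i)) (by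
    intro r hr
    obtain ⟨j, hj, rfl⟩ := Finset.mem_image.1 hr
    exact Finset.mem_range.2 (hρ (Finset.mem_Iio.1 hj)))
  rwa [Finset.card_image_of_injective _ hρ.injective, Fin.card_Iio, Finset.card_range] at h

/-- To the left of the pivot of row i = l + 2 there are ρ_i columns, of which i carry pivots. The
remaining ρ_i - i are lost in echelon form; this is the origin of e_i. -/
theorem card_echelonColumns (hρ : StrictMono ρ) (hρD : ∀ i, ρ i < g + (d + 1 - 2 * g)) (l : Fin m) :
    (echelonColumns d g ρ l).card + (ρ l.succ.succ - (l + 2)) + (m + 2) = g + (d + 1 - 2 * g) := by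
  set D := g + (d + 1 - 2 * g) with hD
  set i := l.succ.succ with hi
  have hil : (i : ℕ) = l + 2 := by simp [hi]
  have hsub : (Finset.Ioi i).image ρ ⊆ Finset.Ioo (ρ i) D := by
    intro r hr
    obtain ⟨j, hj, rfl⟩ := Finset.mem_image.1 hr
    exact Finset.mem_Ioo.2 ⟨hρ (Finset.mem_Ioi.1 hj), hρD j⟩
  have heq : echelonColumns d g ρ l = Finset.Ioo (ρ i) D \ (Finset.Ioi i).image ρ := by
    ext r
    rw [echelonColumns, Finset.mem_sdiff, Finset.mem_sdiff]
    refine and_congr_right fun hr => not_congr ?_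
    rw [Finset.mem_image, Finset.mem_image]
    constructor
    · rintro ⟨j, -, rfl⟩
      exact ⟨j, Finset.mem_Ioi.2 (hρ.lt_iff_lt.1 (Finset.mem_Ioo.1 hr).1), rfl⟩
    · rintro ⟨j, -, rfl⟩
      exact ⟨j, Finset.mem_univ j, rfl⟩
  have h1 := Finset.card_sdiff_add_card_eq_card hsub
  rw [← heq, Finset.card_image_of_injective _ hρ.injective, Fin.card_Ioi, Nat.card_Ioo] at h1
  have h2 := le_of_strictMono hρ i
  have h3 := hρD i
  have h4 := l.2
  omega

theorem card_boundExponents (hρ : StrictMono ρ) (hρD : ∀ i, ρ i < g + (d + 1 - 2 * g)) :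
    (freeExponents d g ρ).card + (if d + 1 < 2 * g then m + 2 else 0) = 2 * g := by
  by_cases hd : d + 1 < 2 * g
  · have hρg : ∀ i, ρ i < g := fun i => by have := hρD i; omega
    have hinj : Function.Injective fun l => 2 * g - 1 - 2 * ρ l := by
      intro l l' hll
      apply hρ.injective
      have := hρg l; have := hρg l'
      simp only at hll
      omega
    have hsub : boundExponents d g ρ ⊆ Finset.range (2 * g) := by
      intro r hr
      rw [boundExponents, if_pos hd] at hr
      obtain ⟨i, -, rfl⟩ := Finset.mem_image.1 hr
      exact Finset.mem_range.2 (by omega)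
    have h1 := Finset.card_sdiff_add_card_eq_card hsub
    rw [Finset.card_range] at h1
    rw [if_pos hd, ← h1]
    congr 1
    rw [boundExponents, if_pos hd, Finset.card_image_of_injective _ hinj, Finset.card_univ,
      Fintype.card_fin]
  · have h0 : boundExponents d g ρ = ∅ := by rw [boundExponents, if_neg hd]
    rw [if_neg hd, freeExponents, h0, Finset.sdiff_empty, Finset.card_range, add_zero]

theorem card_params (P : Finset (Fin m × ℕ)) : Fintype.card (Params d g ρ P) =
    2 + ((freeExponents d g ρ).card + ((2 * g - 3) + ((d + 1 - 2 * g) +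
      ((insert 1 (tailColumns d g)).card + (m * (m + 2) + P.card))))) := by
  simp only [Fintype.card_sum, Fintype.card_fin, Fintype.card_coe, Fintype.card_prod, Nat.card_Ico]
  rw [Nat.add_sub_cancel_left]

/-- For `2 * g ≤ d + 1` the cusp, `c`, f, u and the first two rows account for 2(d+1) parameters,
and each of the other `m` rows for d+1-g. For `d = 2 * g - 2` each of the `m + 2` rows has one
coordinate more than this, compensated by the `m + 2` bound coefficients of f. For `g = 1` there is
no free coefficient of u, and column 1 already belongs to the tail. -/
theorem card_params_free (hg : 0 < g) (hd : 2 * g ≤ d + 2) (hρ : StrictMono ρ) (hρ1 : ρ 1 = 1)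
    (hρD : ∀ i, ρ i < g + (d + 1 - 2 * g)) :
    Fintype.card (Params d g ρ (columnPairs (freeColumns d g ρ))) + m * g = (m + 2) * (d + 1) := by
  rw [card_params, card_columnPairs]
  have hD : 1 < g + (d + 1 - 2 * g) := by have := hρD 1; omega
  have hb := card_boundExponents hρ hρD
  have hfree : (∑ l, (freeColumns d g ρ l).card) + m * (m + 2) = m * (g + (d + 1 - 2 * g)) := by
    have h1 : ∑ l, ((freeColumns d g ρ l).card + (m + 2)) = ∑ _l : Fin m, (g + (d + 1 - 2 * g)) :=
      Finset.sum_congr rfl fun l _ => card_freeColumns hρ hρD l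
    rw [Finset.sum_add_distrib] at h1
    simpa using h1
  have hins : (insert 1 (tailColumns d g)).card = (d + 1 - 2 * g) + if 1 < g then 1 else 0 := by
    by_cases h1 : 1 < g
    · rw [Finset.card_insert_of_notMem (by simp; omega), Nat.card_Ico, if_pos h1]; omega
    · rw [Finset.insert_eq_of_mem (by simp; omega), Nat.card_Ico, if_neg h1]; omega
  rw [hins]
  by_cases hdg : d + 1 < 2 * g
  · rw [if_pos hdg] at hb
    obtain rfl : d = 2 * g - 2 := by omega
    have hT : 2 * g - 2 + 1 - 2 * g = 0 := by omega
    rw [hT] at hfree ⊢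
    rw [if_pos (by omega)]
    obtain ⟨h, rfl⟩ : ∃ h, g = h + 2 := ⟨g - 2, by omega⟩
    have e : 2 * (h + 2) - 2 + 1 = 2 * h + 3 := by omega
    rw [e]
    have e3 : 2 * (h + 2) - 3 = 2 * h + 1 := by omega
    rw [e3]
    nlinarith
  · rw [if_neg hdg] at hb
    obtain ⟨T, hT⟩ : ∃ T, d + 1 = 2 * g + T := ⟨d + 1 - 2 * g, by omega⟩
    have hT' : d + 1 - 2 * g = T := by omega
    rw [hT'] at hfree ⊢
    rw [hT]
    by_cases h1 : 1 < g
    · rw [if_pos h1]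
      obtain ⟨h, rfl⟩ : ∃ h, g = h + 2 := ⟨g - 2, by omega⟩
      have e3 : 2 * (h + 2) - 3 = 2 * h + 1 := by omega
      rw [e3]
      nlinarith
    · rw [if_neg h1]
      obtain rfl : g = 1 := by omega
      have e3 : 2 * 1 - 3 = 0 := rfl
      rw [e3]
      nlinarith

theorem card_params_echelon (hρ : StrictMono ρ) (hρD : ∀ i, ρ i < g + (d + 1 - 2 * g)) :
    Fintype.card (Params d g ρ (columnPairs (echelonColumns d g ρ))) +
      ∑ l : Fin m, (ρ l.succ.succ - (l + 2)) =
    Fintype.card (Params d g ρ (columnPairs (freeColumns d g ρ))) := by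
  rw [card_params, card_params, card_columnPairs, card_columnPairs]
  have h : (∑ l, (echelonColumns d g ρ l).card) + ∑ l : Fin m, (ρ l.succ.succ - ((l : ℕ) + 2)) =
      ∑ l, (freeColumns d g ρ l).card := by
    rw [← Finset.sum_add_distrib]
    refine Finset.sum_congr rfl fun l _ => ?_
    have h1 := card_echelonColumns hρ hρD l
    have h2 := card_freeColumns hρ hρD l
    omega
  omega

end count


/-! ### The strata -/

/-- Two degenerations are combined: the cusp is moved away from infinity, then the first two rows
into general position. -/
theorem eval_eq_zero_of_mem_stratum {m g : ℕ} (hg : 0 < g) {k : Fin (m + 2) → ℕ}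
    {a : CoeffSpace (m + 1) d}
    (ha : a ∈ ramificationStratum (m + 1) d g (hyperellipticSemigroup g) k)
    {h : MvPolynomial (Fin (m + 2) × Fin (d + 1)) ℂ}
    (hh : ∀ (b : CoeffSpace (m + 1) d) (s : ℂ),
      IsUnicuspidalAt g (hyperellipticSemigroup g) b (s : OnePoint ℂ) →
      Set.range k = vanishingOrders b (s : OnePoint ℂ) → InGeneralPosition b s →
      MvPolynomial.eval b h = 0) : MvPolynomial.eval a h = 0 := by
  have hfinite : ∀ (b : CoeffSpace (m + 1) d) (s : ℂ),
      IsUnicuspidalAt g (hyperellipticSemigroup g) b (s : OnePoint ℂ) →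
      Set.range k = vanishingOrders b (s : OnePoint ℂ) → MvPolynomial.eval b h = 0 :=
    fun b s hb hkb => eval_eq_zero_of_generalPosition hg hb fun b' hb' hv hpos =>
      hh b' s hb' (hkb.trans hv.symm) hpos
  obtain ⟨p, hp, hk, hka⟩ := ha
  induction p using OnePoint.rec with
  | infty => exact eval_eq_zero_of_infty hp hk hka hfinite
  | coe s => exact hfinite a s hp hka

namespace Params

variable {m g : ℕ} {ρ : Fin (m + 2) → ℕ} {P : Finset (Fin m × ℕ)}

/-- The curves in general position are slices. -/
theorem exists_params_eq (hg : 0 < g) (hρ : StrictMono ρ) (hρ0 : ρ 0 = 0)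
    (hρ1 : ρ 1 = 1) (hρD : ∀ i, ρ i < g + (d + 1 - 2 * g))
    (hP' : ∀ l r, r < g + (d + 1 - 2 * g) → ρ l.succ.succ < r → r ∉ Set.range ρ → (l, r) ∈ P)
    {b : CoeffSpace (m + 1) d} {s : ℂ}
    (hb : IsUnicuspidalAt g (hyperellipticSemigroup g) b (s : OnePoint ℂ))
    (hkb : Set.range (fun i => colOrder g (ρ i)) = vanishingOrders b (s : OnePoint ℂ))
    (hpos : InGeneralPosition b s) :
    ∃ t : Params d g ρ P → ℂ, (slice t).coeffs = b ∧ (slice t).s = s ∧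
      (slice t).f.coeff 0 ≠ 0 ∧ (slice t).w 1 ≠ 0 ∧
      (d + 1 < 2 * g → (pivotMatrix g ρ (u t) (frame (v₀ t) (w t) (V t))).det ≠ 0) := by
  obtain ⟨x, hxb, hx, hxs, hxf, hxw, hxf', hxu, hxV⟩ := exists_sliceData hg hρ hρ0 hρ1 hρD
    (isHyperellipticAt_of_isUnicuspidalAt hb) hkb hpos
  obtain ⟨t, ht, hts, htf, htw, htP⟩ := exists_params (P := P) hg hρ hρ0 hρ1 hρD hP' hx hxw hxf' hxu hxV
  refine ⟨t, ht.trans hxb, hts.trans hxs, ?_, ?_, htP⟩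
  · rwa [htf]
  · rwa [htw]

/-- The slices that pass through a nonempty stratum. -/
theorem exists_family (hg : 0 < g) (hd : 2 * g ≤ d + 2) (hρ : StrictMono ρ) (hρ0 : ρ 0 = 0)
    (hρ1 : ρ 1 = 1) (hρD : ∀ i, ρ i < g + (d + 1 - 2 * g)) (hP : ∀ q ∈ P, q.2 ∉ Set.range ρ)
    (hP' : ∀ l r, r < g + (d + 1 - 2 * g) → ρ l.succ.succ < r → r ∉ Set.range ρ → (l, r) ∈ P)
    (hne : (ramificationStratum (m + 1) d g (hyperellipticSemigroup g)
      fun i => colOrder g (ρ i)).Nonempty) :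
    ∃ (t₀ : Params d g ρ P → ℂ) (q : MvPolynomial (Params d g ρ P) ℂ), q ≠ 0 ∧
      (slice t₀).f.coeff 0 ≠ 0 ∧ (slice t₀).w 1 ≠ 0 ∧
      (d + 1 < 2 * g → (pivotMatrix g ρ (u t₀) (frame (v₀ t₀) (w t₀) (V t₀))).det ≠ 0) ∧
      ∀ t, MvPolynomial.eval t q ≠ 0 → (slice t).f.coeff 0 ≠ 0 ∧ (slice t).w 1 ≠ 0 ∧
        m + 2 ≤ Module.finrank ℂ (monomialSpan (n := m + 1) (slice t).coeffs 1) ∧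
        IsUnicuspidalAt (n := m + 1) g (hyperellipticSemigroup g) (slice t).coeffs
          ((slice t).s : OnePoint ℂ) := by
  obtain ⟨a, ha⟩ := hne
  obtain ⟨b, s, hb, hkb, hpos⟩ : ∃ (b : CoeffSpace (m + 1) d) (s : ℂ),
      IsUnicuspidalAt g (hyperellipticSemigroup g) b (s : OnePoint ℂ) ∧
      Set.range (fun i => colOrder g (ρ i)) = vanishingOrders b (s : OnePoint ℂ) ∧
      InGeneralPosition b s := by
    by_contra hcon
    push Not at hcon
    -- Density of general position applied to the constant polynomial 1 yields existence.
    have := eval_eq_zero_of_mem_stratum hg ha (h := 1) fun b s h1 h2 h3 =>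
      absurd h3 (hcon b s h1 h2)
    rw [map_one] at this
    exact one_ne_zero this
  obtain ⟨t₀, ht₀, ht₀s, hf, hw, hdet⟩ := exists_params_eq (P := P) hg hρ hρ0 hρ1 hρD hP' hb hkb hpos
  have hev : ∀ t : Params d g ρ P → ℂ, MvPolynomial.eval t ((universal d g ρ P).f.coeff 0) =
      (slice t).f.coeff 0 := fun t => by
    rw [← map_eval_universal, ← coeff_map]; rfl
  have hevw : ∀ t : Params d g ρ P → ℂ, MvPolynomial.eval t ((universal d g ρ P).w 1) =
      (slice t).w 1 := fun t => by
    rw [← map_eval_universal]; rfl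
  have hnorm : (universal d g ρ P).IsNormal := isNormal hg hd hρ hρD hP MvPolynomial.X
  obtain ⟨q, hq, hq'⟩ := hnorm.exists_open (y₀ := t₀) (by rwa [hev]) (by rwa [hevw])
      (by rw [map_eval_universal, ht₀, ht₀s]; exact hb)
  refine ⟨t₀, q, fun h0 => hq (by rw [h0, map_zero]), hf, hw, hdet, fun t ht => ?_⟩
  have := hq' t ht
  rwa [hev, hevw, map_eval_universal] at this

theorem eval_coeffs_universal_funext (t : Params d g ρ P → ℂ) :
    (fun q => MvPolynomial.eval t ((universal d g ρ P).coeffs q)) = (slice t).coeffs :=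
  funext (eval_coeffs_universal t)

end Params

open Params

section strata

variable {m g : ℕ} {ρ : Fin (m + 2) → ℕ}

theorem eval_aeval_universal {P : Finset (Fin m × ℕ)} (t : Params d g ρ P → ℂ)
    (h : MvPolynomial (Fin (m + 2) × Fin (d + 1)) ℂ) :
    MvPolynomial.eval t (MvPolynomial.aeval (universal d g ρ P).coeffs h) =
      MvPolynomial.eval (slice t).coeffs h := by
  rw [← eval_coeffs_universal_funext]
  exact MvPolynomial.eval₂Hom_bind₁ (RingHom.id ℂ) t _ h

/-- A stratum is unirational, of the dimension given by the number of parameters. -/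
theorem stratum_unirational_and_dim (hg : 0 < g) (hd : 2 * g ≤ d + 2) (hρ : StrictMono ρ)
    (hρ0 : ρ 0 = 0) (hρ1 : ρ 1 = 1) (hρD : ∀ i, ρ i < g + (d + 1 - 2 * g))
    (hne : (ramificationStratum (m + 1) d g (hyperellipticSemigroup g)
      fun i => colOrder g (ρ i)).Nonempty) :
    IsUnirational (ramificationStratum (m + 1) d g (hyperellipticSemigroup g)
      fun i => colOrder g (ρ i)) ∧
    zariskiDim (ramificationStratum (m + 1) d g (hyperellipticSemigroup g)
      fun i => colOrder g (ρ i)) =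
      Fintype.card (Params d g ρ (columnPairs (echelonColumns d g ρ))) := by
  set P := columnPairs (echelonColumns d g ρ) with hPdef
  have hPmem : ∀ q, q ∈ P ↔ (ρ q.1.succ.succ < q.2 ∧ q.2 < g + (d + 1 - 2 * g)) ∧
      q.2 ∉ Set.range ρ := fun q => by
    rw [hPdef, mem_columnPairs, echelonColumns, Finset.mem_sdiff, Finset.mem_Ioo]
    simp
  have hP : ∀ q ∈ P, q.2 ∉ Set.range ρ := fun q hq => ((hPmem q).1 hq).2
  have hPD : ∀ q ∈ P, q.2 < g + (d + 1 - 2 * g) := fun q hq => ((hPmem q).1 hq).1.2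
  have hP' : ∀ l r, r < g + (d + 1 - 2 * g) → ρ l.succ.succ < r → r ∉ Set.range ρ → (l, r) ∈ P :=
    fun l r h1 h2 h3 => (hPmem _).2 ⟨⟨h2, h1⟩, h3⟩
  obtain ⟨t₀, q, hq, hf, hw, hdet, hopen⟩ := exists_family (P := P) hg hd hρ hρ0 hρ1 hρD hP hP' hne
  have hmem : ∀ t, MvPolynomial.eval t q ≠ 0 → (fun i => MvPolynomial.eval t
      ((universal d g ρ P).coeffs i)) ∈ ramificationStratum (m + 1) d g (hyperellipticSemigroup g)
        fun i => colOrder g (ρ i) := by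
    intro t ht
    obtain ⟨h1, h2, h3, h4⟩ := hopen t ht
    rw [eval_coeffs_universal_funext]
    refine ⟨_, h4, (colOrder_strictMono g).comp hρ, ?_⟩
    refine (isNormal hg hd hρ hρD hP t).range_eq_vanishingOrders hρ hρ0 hρ1 hρD h1 h2 ?_ h3
    intro l r hr
    change V t l r = 0
    rw [V, if_neg hr.ne, extendZero_of_notMem]
    exact fun hh => absurd ((hPmem _).1 hh).1.1 (not_lt.2 hr.le)
  have hdense : ∀ h, MvPolynomial.aeval (universal d g ρ P).coeffs h = 0 →
      ∀ z ∈ ramificationStratum (m + 1) d g (hyperellipticSemigroup g)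
        (fun i => colOrder g (ρ i)), MvPolynomial.eval z h = 0 := by
    intro h h0 z hz
    refine eval_eq_zero_of_mem_stratum hg hz fun b s hb hkb hpos => ?_
    obtain ⟨t, rfl, -⟩ := exists_params_eq (P := P) hg hρ hρ0 hρ1 hρD hP' hb hkb hpos
    rw [← eval_aeval_universal, h0, map_zero]
  refine ⟨isUnirational_of_open hq hmem hdense, ?_⟩
  refine zariskiDim_eq hg hd hρ hρ0 hρ1 hρD hP hPD hf hw hdet _ fun h => ⟨fun hz => ?_, hdense h⟩
  exact aeval_eq_zero_of_open hq fun t ht => hz _ (hmem t ht)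

/-- A nonempty stratum gives a lower bound for the dimension of the space of all unicuspidal curves. -/
theorem le_zariskiDim_unicuspidalLocus (hg : 0 < g) (hd : 2 * g ≤ d + 2) (hρ : StrictMono ρ)
    (hρ0 : ρ 0 = 0) (hρ1 : ρ 1 = 1) (hρD : ∀ i, ρ i < g + (d + 1 - 2 * g))
    (hne : (ramificationStratum (m + 1) d g (hyperellipticSemigroup g)
      fun i => colOrder g (ρ i)).Nonempty) :
    (Fintype.card (Params d g ρ (columnPairs (freeColumns d g ρ))) : WithBot ℕ∞) ≤
      zariskiDim (unicuspidalLocus (m + 1) d g (hyperellipticSemigroup g)) := by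
  set P := columnPairs (freeColumns d g ρ) with hPdef
  have hPmem : ∀ q, q ∈ P ↔ q.2 < g + (d + 1 - 2 * g) ∧ q.2 ∉ Set.range ρ := fun q => by
    rw [hPdef, mem_columnPairs, freeColumns, Finset.mem_sdiff, Finset.mem_range]
    simp
  have hP : ∀ q ∈ P, q.2 ∉ Set.range ρ := fun q hq => ((hPmem q).1 hq).2
  have hPD : ∀ q ∈ P, q.2 < g + (d + 1 - 2 * g) := fun q hq => ((hPmem q).1 hq).1
  obtain ⟨t₀, q, hq, hf, hw, hdet, hopen⟩ := exists_family (P := P) hg hd hρ hρ0 hρ1 hρD hP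
    (fun l r h1 _ h3 => (hPmem _).2 ⟨h1, h3⟩) hne
  -- Entries to the left of the pivots are free here, so the members need not lie in the stratum;
  -- they are still unicuspidal.
  set Z : Set (CoeffSpace (m + 1) d) := {z | ∃ t : Params d g ρ P → ℂ,
    MvPolynomial.eval t q ≠ 0 ∧ z = (slice t).coeffs}
  have hZ : zariskiDim Z = Fintype.card (Params d g ρ P) := by
    refine zariskiDim_eq hg hd hρ hρ0 hρ1 hρD hP hPD hf hw hdet _ fun h => ⟨fun hz => ?_, ?_⟩
    · refine aeval_eq_zero_of_open hq fun t ht => ?_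
      rw [eval_coeffs_universal_funext]
      exact hz _ ⟨t, ht, rfl⟩
    · rintro h0 _ ⟨t, -, rfl⟩
      rw [← eval_aeval_universal, h0, map_zero]
  rw [← hZ]
  refine zariskiDim_mono ?_
  rintro _ ⟨t, ht, rfl⟩
  exact ⟨_, (hopen t ht).2.2.2⟩

end strata

/-! ### Codimensions of the strata and of the whole locus -/

theorem ramificationStratum_subset {g : ℕ} {S : AddSubmonoid ℕ} {k : Fin (n + 1) → ℕ} :
    ramificationStratum n d g S k ⊆ unicuspidalLocus n d g S :=
  fun _ ⟨p, hp, _⟩ => ⟨p, hp⟩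

theorem unicuspidalLocus_subset {g : ℕ} {S : AddSubmonoid ℕ} :
    unicuspidalLocus n d g S ⊆ morphismSpace n d :=
  fun _ ⟨_, ⟨⟨ha, _⟩, _⟩⟩ => ha

theorem sum_filter_two_le {m : ℕ} (F : Fin (m + 2) → ℚ) :
    ∑ i ∈ Finset.univ.filter (fun i : Fin (m + 2) => 2 ≤ (i : ℕ)), F i =
      ∑ l : Fin m, F l.succ.succ := by
  rw [Finset.sum_filter, Fin.sum_univ_succ, Fin.sum_univ_succ]
  simp

/-- Head and tail are divided by `r < g` and the formula by `k ≤ 2 * g`. The two differ only at `r =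
g`, where both expressions agree. -/
theorem colOrder_defect {g r : ℕ} (i : ℕ) :
    (if colOrder g r ≤ 2 * g then (colOrder g r : ℚ) / 2 - i else (colOrder g r : ℚ) - g - i) =
      (r : ℚ) - i := by
  rw [colOrder]
  by_cases h : r < g
  · rw [if_pos h, if_pos (by omega)]; push_cast; ring
  · rw [if_neg h]
    by_cases h2 : r = g
    · rw [if_pos (by omega), h2]; push_cast; ring
    · rw [if_neg (by omega)]; push_cast; ring

theorem hasCodim_stratum {m g : ℕ} (hg : 0 < g) (hd : 2 * g ≤ d + 2) {k : Fin (m + 2) → ℕ}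
    (hne : (ramificationStratum (m + 1) d g (hyperellipticSemigroup g) k).Nonempty) :
    IsUnirational (ramificationStratum (m + 1) d g (hyperellipticSemigroup g) k) ∧
    HasCodim (ramificationStratum (m + 1) d g (hyperellipticSemigroup g) k) (morphismSpace (m + 1) d)
      ((((m + 1 : ℕ) : ℚ) - 1) * g +
        ∑ i ∈ Finset.univ.filter (fun i : Fin (m + 2) => 2 ≤ (i : ℕ)),
          (if k i ≤ 2 * g then (k i : ℚ) / 2 - (i : ℕ) else (k i : ℚ) - g - (i : ℕ))) := by
  obtain ⟨a, ha⟩ := hne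
  have ha' := ha
  obtain ⟨p, hp, hk, hka⟩ := ha'
  obtain ⟨ρ, hρ, hρ0, hρ1, hρD, rfl⟩ := exists_pivots hg hp hk hka
  obtain ⟨huni, hdim⟩ := stratum_unirational_and_dim hg hd hρ hρ0 hρ1 hρD ⟨a, ha⟩
  refine ⟨huni, _, _, hdim, zariskiDim_morphismSpace
    ⟨a, unicuspidalLocus_subset (ramificationStratum_subset ha)⟩, ?_⟩
  have h1 := card_params_free hg hd hρ hρ1 hρD
  rw [← card_params_echelon hρ hρD] at h1
  rw [sum_filter_two_le]
  simp only [colOrder_defect]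
  have h2 : ∑ l : Fin m, ((ρ l.succ.succ : ℚ) - ((l.succ.succ : Fin (m + 2)) : ℕ)) =
      ((∑ l : Fin m, (ρ l.succ.succ - ((l : ℕ) + 2)) : ℕ) : ℚ) := by
    rw [Nat.cast_sum]
    refine Finset.sum_congr rfl fun l _ => ?_
    have := le_of_strictMono hρ l.succ.succ
    have hl : ((l.succ.succ : Fin (m + 2)) : ℕ) = l + 2 := by simp
    rw [hl] at this ⊢
    rw [Nat.cast_sub this]
  rw [h2, ← h1]
  push_cast
  ring

theorem zariskiDim_stratum_le {m g : ℕ} (hg : 0 < g) (hd : 2 * g ≤ d + 2) {k : Fin (m + 2) → ℕ}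
    (hne : (ramificationStratum (m + 1) d g (hyperellipticSemigroup g) k).Nonempty) {N : ℕ}
    (hN : N + m * g = (m + 2) * (d + 1)) :
    zariskiDim (ramificationStratum (m + 1) d g (hyperellipticSemigroup g) k) ≤ N := by
  obtain ⟨a, ha⟩ := hne
  have ha' := ha
  obtain ⟨p, hp, hk, hka⟩ := ha'
  obtain ⟨ρ, hρ, hρ0, hρ1, hρD, rfl⟩ := exists_pivots hg hp hk hka
  rw [(stratum_unirational_and_dim hg hd hρ hρ0 hρ1 hρD ⟨a, ha⟩).2]
  have h1 := card_params_free hg hd hρ hρ1 hρD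
  have h2 := card_params_echelon hρ hρD
  exact_mod_cast (by omega :
    Fintype.card (Params d g ρ (columnPairs (echelonColumns d g ρ))) ≤ N)

theorem hasCodim_unicuspidalLocus {m g : ℕ} (hg : 0 < g) (hd : 2 * g ≤ d + 2)
    (hne : (unicuspidalLocus (m + 1) d g (hyperellipticSemigroup g)).Nonempty) :
    HasCodim (unicuspidalLocus (m + 1) d g (hyperellipticSemigroup g)) (morphismSpace (m + 1) d)
      ((((m + 1 : ℕ) : ℚ) - 1) * g) := by
  obtain ⟨a, ha⟩ := hne
  obtain ⟨N, hN⟩ : ∃ N : ℕ, N + m * g = (m + 2) * (d + 1) ∧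
      (N : WithBot ℕ∞) ≤ zariskiDim (unicuspidalLocus (m + 1) d g (hyperellipticSemigroup g)) := by
    obtain ⟨p, hp⟩ := ha
    obtain ⟨k, hk, -, hka⟩ := exists_vanishingSequence p hp.1.1.1
    obtain ⟨ρ, hρ, hρ0, hρ1, hρD, rfl⟩ := exists_pivots hg hp hk hka
    exact ⟨_, card_params_free hg hd hρ hρ1 hρD,
      le_zariskiDim_unicuspidalLocus hg hd hρ hρ0 hρ1 hρD ⟨a, p, hp, hk, hka⟩⟩
  refine ⟨N, _, le_antisymm ?_ hN.2, zariskiDim_morphismSpace ⟨a, unicuspidalLocus_subset ha⟩, ?_⟩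
  -- Vanishing orders are at most `d`, so finitely many strata cover the locus. Only nonempty ones
  -- are kept, since the dimension bound is available for these.
  · let ι := {k : Fin (m + 2) → Fin (d + 1) // (ramificationStratum (m + 1) d g
      (hyperellipticSemigroup g) fun i => (k i : ℕ)).Nonempty}
    have hsub : unicuspidalLocus (m + 1) d g (hyperellipticSemigroup g) ⊆
        ⋃ k : ι, ramificationStratum (m + 1) d g (hyperellipticSemigroup g)
          fun i => (k.1 i : ℕ) := by
      rintro b ⟨p, hp⟩
      obtain ⟨k, hk, hkd, hkb⟩ := exists_vanishingSequence p hp.1.1.1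
      have hb : b ∈ ramificationStratum (m + 1) d g (hyperellipticSemigroup g)
          fun i => ((⟨k i, Nat.lt_succ_of_le (hkd i)⟩ : Fin (d + 1)) : ℕ) := ⟨p, hp, hk, hkb⟩
      exact Set.mem_iUnion.2 ⟨⟨_, b, hb⟩, hb⟩
    refine (zariskiDim_mono hsub).trans (zariskiDim_iUnion_le fun k => ?_)
    exact zariskiDim_stratum_le hg hd k.2 hN.1
  · rw [← hN.1]
    push_cast
    ring

end UnicuspidalCurves
end

open UnicuspidalCurves in
theorem proposition2p5 (n d g : ℕ) (hg : 0 < g) (hg7 : g ≤ 7) (hn : n ≤ 2 * g)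
    (hd : max n (2 * g - 2) ≤ d) :
    ((unicuspidalLocus n d g (hyperellipticSemigroup g)).Nonempty →
      HasCodim (unicuspidalLocus n d g (hyperellipticSemigroup g)) (morphismSpace n d)
        (((n : ℚ) - 1) * g)) ∧
    ∀ k : Fin (n + 1) → ℕ,
      (ramificationStratum n d g (hyperellipticSemigroup g) k).Nonempty →
        IsUnirational (ramificationStratum n d g (hyperellipticSemigroup g) k) ∧
        HasCodim (ramificationStratum n d g (hyperellipticSemigroup g) k) (morphismSpace n d)
          (((n : ℚ) - 1) * g + ∑ i ∈ Finset.univ.filter (fun i : Fin (n + 1) => 2 ≤ (i : ℕ)),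
            (if k i ≤ 2 * g then (k i : ℚ) / 2 - (i : ℕ) else (k i : ℚ) - g - (i : ℕ))) := by
  have hd' : 2 * g ≤ d + 2 := by
    have := (le_max_right n (2 * g - 2)).trans hd
    omega
  refine ⟨fun hne => ?_, fun k hne => ?_⟩
  · obtain ⟨a, p, hp⟩ := hne
    obtain ⟨m, rfl⟩ := hp.exists_eq_succ hg
    exact hasCodim_unicuspidalLocus hg hd' ⟨a, p, hp⟩
  · obtain ⟨a, ha⟩ := hne
    obtain ⟨p, hp⟩ := ramificationStratum_subset ha
    obtain ⟨m, rfl⟩ := hp.exists_eq_succ hg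
    exact hasCodim_stratum hg hd' ⟨a, ha⟩
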